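/- An instance of \emph{colorful sum of radii} consists of a finite metric space $(P,d)$ with $n=|P|$ points that is partitioned into $\omega$ classes $P_1,\dots,P_\omega$, an integer $k$ with $1\le k\le n$, and numbers $m_1,\dots,m_\omega\in\mathbb N$; put $m=\sum_{i=1}^{\omega}m_i$. A feasible solution consists of a set $\mathcal C\subseteq P$ of $k$ centers, a set $\mathcal M\subseteq P$ of outliers with $|\mathcal M\cap P_i|\le m_i$ for all $i$, and an assignment $\sigma:P\to\mathcal C\cup\mathcal M$ with $\sigma(p)=p$ for $p\in\mathcal M$ and $\sigma(p)\in\mathcal C$ for $p\notin\mathcal M$. Its cost is $\sum_{c\in\mathcal C}\max_{p\in\sigma^{-1}(c)}d(p,c)$, where the maximum over the empty set is $0$. \textbf{Theorem.} There are a deterministic algorithm and an absolute constant $c$ such that, for every instance and every real $\varepsilon>0$, the algorithm on input (instance, $\varepsilon$) outputs a feasible solution whose cost is at most $(7+\varepsilon)$ times the cost of every feasible solution, after at most $$c\cdot n^{\omega^2}\cdot\Bigl((k+m)\cdot\log\max\{2,\,k,\,k/\varepsilon\}\Bigr)^{k}$$ steps, where $\log$ is the natural logarithm. (For $0<\varepsilon\le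 1$ and $k/\varepsilon\ge 2$ the logarithm is just $\log(k/\varepsilon)$.) The running time is that of a real RAM: the distances are available in a table with random access, and reading or writing a memory cell, adding, subtracting or comparing natural numbers, and performing a field operation or a comparison on real numbers cost one step each. -/

import Mathlib

open scoped NNReal

noncomputable section

namespace RealRAM

/-! A deterministic real RAM in structured form. A machine state consists of zero-initialised
arrays of natural numbers and arrays of real numbers; array names are literals of the program, so
that a program uses finitely many arrays, and a scalar variable is cell `0` of an array. Indices are
computed, which gives indirect addressing. In addition there is a read-only two-dimensional table of
real input numbers. Every elementary operation costs one step. On natural numbers these are only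
addition, truncated subtraction and comparison; on real numbers they are the field operations and
comparison. There is no rounding of reals to integers and there are no real constants in programs
other than natural numbers. -/

/-- Expressions with values in `ℕ`. -/
inductive NatExpr : Type
  | const (c : ℕ)
  | get (a : ℕ) (i : NatExpr)
  | add (e f : NatExpr)
  | sub (e f : NatExpr)

/-- Expressions with values in `ℝ`; `table i j` reads the input table. -/
inductive RealExpr : Type
  | ofNat (e : NatExpr)
  | get (a : ℕ) (i : NatExpr)
  | table (i j : NatExpr)
  | add (e f : RealExpr)
  | sub (e f : RealExpr)
  | mul (e f : RealExpr)
  | div (e f : RealExpr)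

/-- Tests. -/
inductive Test : Type
  | natLe (e f : NatExpr)
  | realLe (e f : RealExpr)
  | not (b : Test)
  | and (b c : Test)

/-- Programs. `setNat a i e` stores the value of `e` in cell `i` of the array `a` of natural
numbers, and `setReal` does the same for real numbers. -/
inductive Program : Type
  | skip
  | setNat (a : ℕ) (i : NatExpr) (e : NatExpr)
  | setReal (a : ℕ) (i : NatExpr) (e : RealExpr)
  | seq (p q : Program)
  | cond (b : Test) (p q : Program)
  | loop (b : Test) (p : Program)

/-- The memory: `nat a i` and `real a i` are the contents of cell `i` of the array named `a`. -/
structure State : Type where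
  nat : ℕ → ℕ → ℕ
  real : ℕ → ℕ → ℝ

/-- Value of an expression. -/
def NatExpr.eval (s : State) : NatExpr → ℕ
  | .const c => c
  | .get a i => s.nat a (i.eval s)
  | .add e f => e.eval s + f.eval s
  | .sub e f => e.eval s - f.eval s

/-- Number of elementary operations needed for evaluating an expression. -/
def NatExpr.steps : NatExpr → ℕ
  | .const _ => 1
  | .get _ i => i.steps + 1
  | .add e f => e.steps + f.steps + 1
  | .sub e f => e.steps + f.steps + 1

/-- Value of an expression, where `T` is the input table (a quotient with divisor `0` is `0`). -/
def RealExpr.eval (T : ℕ → ℕ → ℝ) (s : State) : RealExpr → ℝ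
  | .ofNat e => (e.eval s : ℝ)
  | .get a i => s.real a (i.eval s)
  | .table i j => T (i.eval s) (j.eval s)
  | .add e f => e.eval T s + f.eval T s
  | .sub e f => e.eval T s - f.eval T s
  | .mul e f => e.eval T s * f.eval T s
  | .div e f => e.eval T s / f.eval T s

/-- Number of elementary operations needed for evaluating an expression. -/
def RealExpr.steps : RealExpr → ℕ
  | .ofNat e => e.steps + 1
  | .get _ i => i.steps + 1
  | .table i j => i.steps + j.steps + 1
  | .add e f => e.steps + f.steps + 1
  | .sub e f => e.steps + f.steps + 1
  | .mul e f => e.steps + f.steps + 1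
  | .div e f => e.steps + f.steps + 1

/-- The test holds in the state `s`. -/
def Test.Holds (T : ℕ → ℕ → ℝ) (s : State) : Test → Prop
  | .natLe e f => e.eval s ≤ f.eval s
  | .realLe e f => e.eval T s ≤ f.eval T s
  | .not b => ¬ b.Holds T s
  | .and b c => b.Holds T s ∧ c.Holds T s

/-- Number of elementary operations needed for a test. -/
def Test.steps : Test → ℕ
  | .natLe e f => e.steps + f.steps + 1
  | .realLe e f => e.steps + f.steps + 1
  | .not b => b.steps + 1
  | .and b c => b.steps + c.steps + 1

/-- Store `v` in cell `i` of the array `a` of natural numbers. -/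
def State.storeNat (s : State) (a i v : ℕ) : State :=
  { s with nat := Function.update s.nat a (Function.update (s.nat a) i v) }

/-- Store `v` in cell `i` of the array `a` of real numbers. -/
def State.storeReal (s : State) (a i : ℕ) (v : ℝ) : State :=
  { s with real := Function.update s.real a (Function.update (s.real a) i v) }

/-- `Run T p s t s'`: with the input table `T`, the program `p` started in the state `s` halts
after exactly `t` steps in the state `s'`. -/
inductive Run (T : ℕ → ℕ → ℝ) : Program → State → ℕ → State → Prop
  | skip (s : State) : Run T .skip s 1 s
  | setNat (s : State) (a : ℕ) (i e : NatExpr) :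
      Run T (.setNat a i e) s (i.steps + e.steps + 1) (s.storeNat a (i.eval s) (e.eval s))
  | setReal (s : State) (a : ℕ) (i : NatExpr) (e : RealExpr) :
      Run T (.setReal a i e) s (i.steps + e.steps + 1) (s.storeReal a (i.eval s) (e.eval T s))
  | seq {p q : Program} {s s' s'' : State} {t t' : ℕ} (hp : Run T p s t s')
      (hq : Run T q s' t' s'') : Run T (.seq p q) s (t + t') s''
  | condTrue {b : Test} {p q : Program} {s s' : State} {t : ℕ} (hb : b.Holds T s)
      (hp : Run T p s t s') : Run T (.cond b p q) s (b.steps + 1 + t) s'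
  | condFalse {b : Test} {p q : Program} {s s' : State} {t : ℕ} (hb : ¬ b.Holds T s)
      (hq : Run T q s t s') : Run T (.cond b p q) s (b.steps + 1 + t) s'
  | loopStop {b : Test} {p : Program} {s : State} (hb : ¬ b.Holds T s) :
      Run T (.loop b p) s (b.steps + 1) s
  | loopStep {b : Test} {p : Program} {s s' s'' : State} {t t' : ℕ} (hb : b.Holds T s)
      (hp : Run T p s t s') (hl : Run T (.loop b p) s' t' s'') :
      Run T (.loop b p) s (b.steps + 1 + t + t') s''

end RealRAM

namespace ColorfulRadii

/-- An instance of colorful clustering: a finite metric space `P` of `n` points (identified with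
`Fin n`), partitioned into `ω` classes by `color`, a bound `outlierBound i` on the number of
outliers in class `i`, and a number `k` of centers. -/
structure Instance : Type where
  n : ℕ
  ω : ℕ
  k : ℕ
  metric : MetricSpace (Fin n)
  color : Fin n → Fin ω
  outlierBound : Fin ω → ℕ
  one_le_k : 1 ≤ k
  k_le_n : k ≤ n

/-- The distance between two points. -/
def Instance.d (I : Instance) (p q : Fin I.n) : ℝ≥0 :=
  @nndist (Fin I.n) I.metric.toPseudoMetricSpace.toNNDist p q

/-- The total number of allowed outliers. -/
def Instance.m (I : Instance) : ℕ := ∑ i, I.outlierBound i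

/-- A candidate solution: centers, outliers and an assignment of the points. -/
structure Solution (n : ℕ) : Type where
  centers : Finset (Fin n)
  outliers : Finset (Fin n)
  assign : Fin n → Fin n

/-- Exactly `k` centers, at most `outlierBound i` outliers from class `i`, every outlier is assigned
to itself and every other point is assigned to a center. -/
structure Instance.IsFeasible (I : Instance) (S : Solution I.n) : Prop where
  card_centers : S.centers.card = I.k
  card_outliers : ∀ i : Fin I.ω, (S.outliers.filter (fun p => I.color p = i)).card ≤ I.outlierBound i
  assign_outlier : ∀ p ∈ S.outliers, S.assign p = p
  assign_center : ∀ p ∉ S.outliers, S.assign p ∈ S.centers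

/-- The largest distance from `c` to a point assigned to `c` (it is `0` if there is none). -/
def Instance.radius (I : Instance) (S : Solution I.n) (c : Fin I.n) : ℝ≥0 :=
  (Finset.univ.filter (fun p => S.assign p = c)).sup (fun p => I.d p c)

/-- The sum of the cluster radii. -/
def Instance.cost (I : Instance) (S : Solution I.n) : ℝ :=
  ∑ c ∈ S.centers, (I.radius S c : ℝ)

/-- `S` is feasible and its cost is at most `α` times that of any feasible solution. -/
def Instance.IsApprox (I : Instance) (α : ℝ) (S : Solution I.n) : Prop :=
  I.IsFeasible S ∧ ∀ S' : Solution I.n, I.IsFeasible S' → I.cost S ≤ α * I.cost S'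

/-- The input table of distances. -/
def Instance.distTable (I : Instance) (i j : ℕ) : ℝ :=
  if h : i < I.n ∧ j < I.n then (I.d ⟨i, h.1⟩ ⟨j, h.2⟩ : ℝ) else 0

/-- The initial memory. Array `0` of natural numbers holds `n, k, ω`, array `1` the colors of the
points, array `2` the outlier bounds; cell `0` of array `0` of real numbers holds `ε`. All other
cells hold `0`. -/
def Instance.input (I : Instance) (ε : ℝ) : RealRAM.State where
  nat
    | 0, 0 => I.n
    | 0, 1 => I.k
    | 0, 2 => I.ω
    | 1, i => if h : i < I.n then (I.color ⟨i, h⟩ : ℕ) else 0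
    | 2, i => if h : i < I.ω then I.outlierBound ⟨i, h⟩ else 0
    | _, _ => 0
  real
    | 0, 0 => ε
    | _, _ => 0

/-- The final memory `s` represents `S`: array `3` of natural numbers marks the centers and array
`4` the outliers (by the entry `1`), and array `5` holds the assignment. -/
def IsOutput {n : ℕ} (s : RealRAM.State) (S : Solution n) : Prop :=
  ∀ p : Fin n, (s.nat 3 p = 1 ↔ p ∈ S.centers) ∧ (s.nat 4 p = 1 ↔ p ∈ S.outliers) ∧
    s.nat 5 p = S.assign p

end ColorfulRadii

end

/-!
The algorithm guesses the clusters of an optimal solution one by one. As long as some class has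
more uncovered points than it may have outliers, one of the first `m + 1` uncovered points of this
class is not an outlier of the optimal solution: it is guessed and becomes the center of a ball that
contains its optimal cluster. Doubling the radius of the cluster pays for the passage to the new
center. The radius is guessed from a geometric grid below a scale `R`. A radius `x` is approximated
from above by a grid radius of at most `(7 / 2) * x`, hence the factor `7 = 2 * (7 / 2)`; radii
below the finest grid radius cost at most `ε / k` times the optimum each. The sequences of guesses
are enumerated by counting in mixed radix.

It remains to find a scale comparable to the largest optimal radius. Starting from the distance of
the point farthest from point `0`, the scale is lowered as long as some enumeration finds a
solution. The number of lowerings is `O(k * (k + m))`, although distances may be arbitrarily small: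
each `k + 5` of them enlarge a set of points separated at the current scale, and a solution of this
scale exists only while such a set has at most `k + m` points. These searches must not cost more
than a factor `k ^ 2` on top of `(k + m) ^ k`, which leaves no room for enumerating the `m + 1`
values of the first guess in each of them: a search fixes this value, and the lowering passes to the
next value when a search fails. Once the scale cannot be lowered any more, `k + O(1)` doublings of
it, each with a full enumeration, reach the scale of every solution that could still be better.
-/

noncomputable section

namespace RealRAM

/-! ### Program logic for the real RAM -/

section Logic

variable {T : ℕ → ℕ → ℝ} {p q : Program} {τ τ' : ℕ} {Q Q' R : State → Prop} {s s' s'' : State}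

/-- Total correctness with a time bound: started in `s`, the program `p` halts within `τ` steps in a
state that satisfies `Q`. The initial state comes last, so that `WP T p τ Q` is again a predicate
on states. -/
def WP (T : ℕ → ℕ → ℝ) (p : Program) (τ : ℕ) (Q : State → Prop) (s : State) : Prop :=
  ∃ t s', Run T p s t s' ∧ t ≤ τ ∧ Q s'

lemma WP.mono (h : WP T p τ Q s) (hτ : τ ≤ τ') : WP T p τ' Q s := by
  obtain ⟨t, s', hrun, ht, hQ⟩ := h
  exact ⟨t, s', hrun, ht.trans hτ, hQ⟩

lemma WP.imp (h : WP T p τ Q s) (hQ : ∀ s', Q s' → Q' s') : WP T p τ Q' s := by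
  obtain ⟨t, s', hrun, ht, hs'⟩ := h
  exact ⟨t, s', hrun, ht, hQ s' hs'⟩

lemma WP.seq (hp : WP T p τ R s) (hq : ∀ s', R s' → WP T q τ' Q s') :
    WP T (.seq p q) (τ + τ') Q s := by
  obtain ⟨t, s', hrun, ht, hR⟩ := hp
  obtain ⟨t', s'', hrun', ht', hQ⟩ := hq s' hR
  exact ⟨_, s'', .seq hrun hrun', by omega, hQ⟩

lemma WP.cond {b : Test} (hp : b.Holds T s → WP T p τ Q s) (hq : ¬ b.Holds T s → WP T q τ Q s) :
    WP T (.cond b p q) (τ + (b.steps + 1)) Q s := by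
  by_cases hb : b.Holds T s
  · obtain ⟨t, s', hrun, ht, hQ⟩ := hp hb
    exact ⟨_, s', .condTrue hb hrun, by omega, hQ⟩
  · obtain ⟨t, s', hrun, ht, hQ⟩ := hq hb
    exact ⟨_, s', .condFalse hb hrun, by omega, hQ⟩

lemma WP.loop {b : Test} (Inv : ℕ → State → Prop) (N : ℕ) (h0 : Inv 0 s)
    (hN : ∀ j s, Inv j s → b.Holds T s → j < N)
    (hstep : ∀ j s, Inv j s → b.Holds T s → WP T p τ (Inv (j + 1)) s) :
    WP T (.loop b p) (N * (τ + (b.steps + 1)) + (b.steps + 1))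
      (fun s' => ∃ j, Inv j s' ∧ ¬ b.Holds T s') s := by
  suffices H : ∀ r j s, Inv j s → N ≤ j + r → WP T (.loop b p)
      (r * (τ + (b.steps + 1)) + (b.steps + 1)) (fun s' => ∃ j, Inv j s' ∧ ¬ b.Holds T s') s from
    H N 0 s h0 (by omega)
  intro r
  induction r with
  | zero =>
    intro j s hj hr
    have hb : ¬ b.Holds T s := fun hb => by have := hN j s hj hb; omega
    exact ⟨_, s, .loopStop hb, by omega, j, hj, hb⟩
  | succ r ih =>
    intro j s hj hr
    by_cases hb : b.Holds T s
    · obtain ⟨t, s', hrun, ht, hs'⟩ := hstep j s hj hb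
      obtain ⟨t', s'', hrun', ht', hs''⟩ := ih (j + 1) s' hs' (by omega)
      refine ⟨_, s'', .loopStep hb hrun hrun', ?_, hs''⟩
      rw [Nat.succ_mul]
      omega
    · exact ⟨_, s, .loopStop hb, by omega, j, hj, hb⟩

/-- The effect of a program without loops; the value on a loop is irrelevant. -/
def Program.exec (T : ℕ → ℕ → ℝ) : Program → State → State
  | .skip, s => s
  | .setNat a i e, s => s.storeNat a (i.eval s) (e.eval s)
  | .setReal a i e, s => s.storeReal a (i.eval s) (e.eval T s)
  | .seq p q, s => q.exec T (p.exec T s)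
  | .cond b p q, s => open scoped Classical in if b.Holds T s then p.exec T s else q.exec T s
  | .loop _ _, s => s

/-- A bound for the number of steps of a program without loops; both branches of a conditional are
charged. -/
def Program.maxSteps : Program → ℕ
  | .skip => 1
  | .setNat _ i e => i.steps + e.steps + 1
  | .setReal _ i e => i.steps + e.steps + 1
  | .seq p q => p.maxSteps + q.maxSteps
  | .cond b p q => b.steps + 1 + (p.maxSteps + q.maxSteps)
  | .loop _ _ => 0

/-- The program contains no loop. -/
def Program.loopFree : Program → Bool
  | .seq p q => p.loopFree && q.loopFree
  | .cond _ p q => p.loopFree && q.loopFree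
  | .loop _ _ => false
  | _ => true

lemma WP.exec_of_loopFree : ∀ {p : Program} {s : State}, p.loopFree = true →
    WP T p p.maxSteps (fun s' => s' = p.exec T s) s := by
  intro p
  induction p with
  | skip => exact fun _ => ⟨_, _, .skip _, le_rfl, rfl⟩
  | setNat a i e => exact fun _ => ⟨_, _, .setNat _ _ _ _, le_rfl, rfl⟩
  | setReal a i e => exact fun _ => ⟨_, _, .setReal _ _ _ _, le_rfl, rfl⟩
  | seq p q ihp ihq =>
    intro s h
    simp only [Program.loopFree, Bool.and_eq_true] at h
    exact (ihp h.1).seq fun s' hs' => (ihq h.2).imp fun s'' hs'' => by rw [hs'', hs', Program.exec]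
  | cond b p q ihp ihq =>
    intro s h
    simp only [Program.loopFree, Bool.and_eq_true] at h
    refine (WP.cond (τ := p.maxSteps + q.maxSteps)
      (fun hb => ((ihp h.1).mono (Nat.le_add_right _ _)).imp fun s' hs' => ?_)
      (fun hb => ((ihq h.2).mono (Nat.le_add_left _ _)).imp fun s' hs' => ?_)).mono
      (by simp only [Program.maxSteps]; omega)
    · rw [hs', Program.exec, if_pos hb]
    · rw [hs', Program.exec, if_neg hb]
  | loop b p => intro s h; cases h

lemma WP.of_exec (hp : p.loopFree = true) (hτ : p.maxSteps ≤ τ) (h : Q (p.exec T s)) :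
    WP T p τ Q s :=
  ((WP.exec_of_loopFree hp).mono hτ).imp fun _ hs' => hs' ▸ h

/-- The program contains an assignment to the array `a` of natural numbers. -/
def Program.writesNat (a : ℕ) : Program → Bool
  | .setNat b _ _ => a == b
  | .seq p q => p.writesNat a || q.writesNat a
  | .cond _ p q => p.writesNat a || q.writesNat a
  | .loop _ p => p.writesNat a
  | _ => false

/-- The program contains an assignment to the array `a` of real numbers. -/
def Program.writesReal (a : ℕ) : Program → Bool
  | .setReal b _ _ => a == b
  | .seq p q => p.writesReal a || q.writesReal a
  | .cond _ p q => p.writesReal a || q.writesReal a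
  | .loop _ p => p.writesReal a
  | _ => false

@[simp] lemma State.storeNat_nat_self (s : State) (a i v : ℕ) :
    (s.storeNat a i v).nat a = Function.update (s.nat a) i v := by simp [State.storeNat]

lemma State.storeNat_nat_ne (s : State) (a i v : ℕ) {b : ℕ} (h : b ≠ a) :
    (s.storeNat a i v).nat b = s.nat b := by simp [State.storeNat, h]

@[simp] lemma State.storeNat_real (s : State) (a i v : ℕ) : (s.storeNat a i v).real = s.real := rfl

@[simp] lemma State.storeReal_real_self (s : State) (a i : ℕ) (v : ℝ) :
    (s.storeReal a i v).real a = Function.update (s.real a) i v := by simp [State.storeReal]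

lemma State.storeReal_real_ne (s : State) (a i : ℕ) (v : ℝ) {b : ℕ} (h : b ≠ a) :
    (s.storeReal a i v).real b = s.real b := by simp [State.storeReal, h]

@[simp] lemma State.storeReal_nat (s : State) (a i : ℕ) (v : ℝ) :
    (s.storeReal a i v).nat = s.nat := rfl

/-- The frame condition: `s'` arises from `s` by changing only arrays to which `p` writes. -/
structure Frame (p : Program) (s s' : State) : Prop where
  nat : ∀ a, p.writesNat a = false → s'.nat a = s.nat a
  real : ∀ a, p.writesReal a = false → s'.real a = s.real a

lemma Frame.refl (p : Program) (s : State) : Frame p s s := ⟨fun _ _ => rfl, fun _ _ => rfl⟩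

lemma Frame.trans (h : Frame p s s') (h' : Frame p s' s'') : Frame p s s'' :=
  ⟨fun a ha => (h'.nat a ha).trans (h.nat a ha), fun a ha => (h'.real a ha).trans (h.real a ha)⟩

lemma Frame.mono (h : Frame p s s') (hnat : ∀ a, q.writesNat a = false → p.writesNat a = false)
    (hreal : ∀ a, q.writesReal a = false → p.writesReal a = false) : Frame q s s' :=
  ⟨fun a ha => h.nat a (hnat a ha), fun a ha => h.real a (hreal a ha)⟩

lemma Frame.storeNat (s : State) (a i v : ℕ) (ha : p.writesNat a = true) :
    Frame p s (s.storeNat a i v) :=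
  ⟨fun b hb => State.storeNat_nat_ne _ _ _ _ fun h => by simp [h, ha] at hb, fun _ _ => rfl⟩

lemma Frame.storeReal (s : State) (a i : ℕ) (v : ℝ) (ha : p.writesReal a = true) :
    Frame p s (s.storeReal a i v) :=
  ⟨fun _ _ => rfl, fun b hb => State.storeReal_real_ne _ _ _ _ fun h => by simp [h, ha] at hb⟩

lemma Run.frame {t : ℕ} (h : Run T p s t s') : Frame p s s' := by
  induction h with
  | skip s => exact .refl _ s
  | setNat s a i e => exact .storeNat s a _ _ (by simp [Program.writesNat])
  | setReal s a i e => exact .storeReal s a _ _ (by simp [Program.writesReal])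
  | seq _ _ ihp ihq =>
    refine (ihp.mono ?_ ?_).trans (ihq.mono ?_ ?_) <;>
      simp +contextual [Program.writesNat, Program.writesReal]
  | condTrue _ _ ih | condFalse _ _ ih =>
    refine ih.mono ?_ ?_ <;> simp +contextual [Program.writesNat, Program.writesReal]
  | loopStop => exact .refl _ _
  | loopStep _ _ _ ih ih' => exact Frame.trans ⟨ih.nat, ih.real⟩ ih'

lemma WP.frame (h : WP T p τ Q s) : WP T p τ (fun s' => Q s' ∧ Frame p s s') s := by
  obtain ⟨t, s', hrun, ht, hQ⟩ := h
  exact ⟨t, s', hrun, ht, hQ, hrun.frame⟩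

/-- The invariant of `WP.loop` together with the frame condition, so that `Inv` need not mention
the arrays that the loop does not change. -/
lemma WP.loopFrame {b : Test} (Inv : ℕ → State → Prop) (N : ℕ) (h0 : Inv 0 s)
    (hN : ∀ j s', Frame (.loop b p) s s' → Inv j s' → b.Holds T s' → j < N)
    (hstep : ∀ j s', Frame (.loop b p) s s' → Inv j s' → b.Holds T s' →
      WP T p τ (Inv (j + 1)) s') :
    WP T (.loop b p) (N * (τ + (b.steps + 1)) + (b.steps + 1))
      (fun s' => ∃ j, Inv j s' ∧ ¬ b.Holds T s' ∧ Frame (.loop b p) s s') s := by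
  refine (WP.loop (fun j s' => Inv j s' ∧ Frame (.loop b p) s s') N ⟨h0, .refl _ _⟩
    (fun j s' h => hN j s' h.2 h.1) fun j s' h hb => ?_).imp fun s' ⟨j, h, hb⟩ => ⟨j, h.1, hb, h.2⟩
  exact (hstep j s' h.2 h.1 hb).frame.imp fun s'' h'' => ⟨h''.1, h.2.trans ⟨h''.2.nat, h''.2.real⟩⟩

end Logic

section ForLoop

/-- The scalar variable `a` of natural numbers, that is, cell `0` of the array `a`. -/
abbrev NatExpr.var (a : ℕ) : NatExpr := .get a (.const 0)

/-- The scalar variable `a` of real numbers, that is, cell `0` of the array `a`. -/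
abbrev RealExpr.var (a : ℕ) : RealExpr := .get a (.const 0)

/-- The test `e < f` for natural numbers. -/
abbrev Test.natLt (e f : NatExpr) : Test := .not (.natLe f e)

/-- The test `e = f` for natural numbers. -/
abbrev Test.natEq (e f : NatExpr) : Test := .and (.natLe e f) (.natLe f e)

/-- The test `e < f` for real numbers. -/
abbrev Test.realLt (e f : RealExpr) : Test := .not (.realLe f e)

/-- `for v := 0, 1, …, e - 1 do p`, where `e` is evaluated anew before each iteration. -/
def Program.forLoop (v : ℕ) (e : NatExpr) (p : Program) : Program :=
  .seq (.setNat v (.const 0) (.const 0)) (.loop (.natLt (.var v) e)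
    (.seq p (.setNat v (.const 0) (.add (.var v) (.const 1)))))

variable {T : ℕ → ℕ → ℝ} {p : Program} {v τ : ℕ} {e : NatExpr} {s : State}

lemma Program.writesNat_forLoop (a : ℕ) :
    (Program.forLoop v e p).writesNat a = (a == v || p.writesNat a) := by
  cases h : a == v <;> simp [Program.forLoop, Program.writesNat, h]

lemma Program.writesReal_forLoop (a : ℕ) :
    (Program.forLoop v e p).writesReal a = p.writesReal a := by
  simp [Program.forLoop, Program.writesReal]

lemma WP.forLoop (Inv : ℕ → State → Prop) (N : ℕ) (h0 : Inv 0 (s.storeNat v 0 0))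
    (hN : ∀ j s, Inv j s → e.eval s = N ∧ s.nat v 0 = j)
    (hstep : ∀ j s, j < N → Inv j s →
      WP T p τ (fun s' => s'.nat v 0 = j ∧ Inv (j + 1) (s'.storeNat v 0 (j + 1))) s) :
    WP T (.forLoop v e p) (N * (τ + (e.steps + 11)) + (e.steps + 8)) (Inv N) s := by
  have hlt {j : ℕ} {s : State} (hj : Inv j s) : (Test.natLt (.var v) e).Holds T s ↔ j < N := by
    obtain ⟨he, hv⟩ := hN j s hj
    simp only [Test.Holds, NatExpr.eval, he, hv, not_le]
  have hloop := WP.loop (T := T) (b := .natLt (.var v) e)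
    (p := .seq p (.setNat v (.const 0) (.add (.var v) (.const 1)))) (τ := τ + 6)
    (fun j s => Inv j s ∧ j ≤ N) N ⟨h0, Nat.zero_le _⟩ (fun j s hj hb => (hlt hj.1).1 hb)
    (fun j s hj hb => by
      have hjN := (hlt hj.1).1 hb
      refine (hstep j s hjN hj.1).seq fun s' ⟨hv, hs'⟩ => ?_
      refine WP.of_exec rfl (by simp [Program.maxSteps, NatExpr.steps]) ⟨?_, hjN⟩
      simpa [Program.exec, NatExpr.eval, hv] using hs')
  obtain ⟨t, s', hrun, ht, j, ⟨hj, hjN⟩, hb⟩ := hloop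
  obtain rfl : j = N := le_antisymm hjN (not_lt.1 fun h => hb ((hlt hj).2 h))
  refine ⟨_, s', .seq (.setNat _ _ _ _) hrun, (Nat.add_le_add_left ht _).trans (le_of_eq ?_), hj⟩
  simp only [Test.steps, NatExpr.steps]
  ring

lemma WP.forFrame (Inv : ℕ → State → Prop) (N : ℕ)
    (hN : ∀ s', Frame (.forLoop v e p) s s' → e.eval s' = N)
    (hv : p.writesNat v = false) (h0 : Inv 0 (s.storeNat v 0 0))
    (hstep : ∀ j s', j < N → Frame (.forLoop v e p) s s' → s'.nat v 0 = j → Inv j s' →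
      WP T p τ (fun s'' => Inv (j + 1) (s''.storeNat v 0 (j + 1))) s') :
    WP T (.forLoop v e p) (N * (τ + (e.steps + 11)) + (e.steps + 8))
      (fun s' => Inv N s' ∧ Frame (.forLoop v e p) s s') s := by
  have hstore (s : State) (j : ℕ) : Frame (.forLoop v e p) s (s.storeNat v 0 j) :=
    .storeNat s v 0 j (by simp [Program.writesNat_forLoop])
  have hbody {s s' : State} (h : Frame p s s') : Frame (.forLoop v e p) s s' :=
    h.mono (by simp +contextual [Program.writesNat_forLoop])
      (by simp [Program.writesReal_forLoop])
  refine (WP.forLoop (fun j s' => Inv j s' ∧ s'.nat v 0 = j ∧ Frame (.forLoop v e p) s s') N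
    ⟨h0, by simp, hstore s 0⟩ (fun j s' h => ⟨hN s' h.2.2, h.2.1⟩)
    fun j s' hj ⟨hInv, hvj, hf⟩ => ?_).imp fun s' h => ⟨h.1, h.2.2⟩
  refine (hstep j s' hj hf hvj hInv).frame.imp fun s'' ⟨hInv', hf'⟩ => ?_
  exact ⟨by rw [hf'.nat v hv, hvj], hInv', by simp, (hf.trans (hbody hf')).trans (hstore s'' _)⟩

lemma update_ite_lt {α : Type*} (f g : ℕ → α) (j : ℕ) :
    Function.update (fun q => if q < j then f q else g q) j (f j) =
      fun q => if q < j + 1 then f q else g q := by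
  funext q
  rcases lt_trichotomy q j with h | rfl | h
  · simp [h, h.ne, h.trans j.lt_succ_self]
  · simp
  · simp [h.not_gt, h.ne', show ¬ q < j + 1 by omega]

end ForLoop

end RealRAM

namespace ColorfulRadii

/-! ### Greedy covering as a function of the branching decisions -/

/-- The data of an instance as the machine sees them: points, classes and the table of distances are
indexed by natural numbers, of which those below `n` denote points. -/
structure Data : Type where
  n : ℕ
  k : ℕ
  col : ℕ → ℕ
  bnd : ℕ → ℕ
  d : ℕ → ℕ → ℝ

/-- The data describe an instance: the distances form a (pseudo)metric and `1 ≤ k ≤ n`. As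
`Instance.distTable` vanishes outside of the points, only the triangle inequality needs points. -/
structure Data.Valid (D : Data) : Prop where
  d_self : ∀ i, D.d i i = 0
  d_symm : ∀ i j, D.d i j = D.d j i
  d_nonneg : ∀ i j, 0 ≤ D.d i j
  d_triangle : ∀ i j l, i < D.n → j < D.n → l < D.n → D.d i l ≤ D.d i j + D.d j l
  one_le_k : 1 ≤ D.k
  k_le_n : D.k ≤ D.n

/-- A partial clustering. The entry `1` of `covered` and `isCenter` marks the covered points and the
centers, the entry `0` the others; `cost` is an upper bound for the sum of the radii. -/
structure Cover : Type where
  covered : ℕ → ℕ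
  assign : ℕ → ℕ
  isCenter : ℕ → ℕ
  cost : ℝ

namespace Data

section Definitions

variable (D : Data)

/-- The number of uncovered points before `p` in the class of `p`. -/
def rank (cov : ℕ → ℕ) (p : ℕ) : ℕ :=
  ((Finset.range p).filter (fun q => cov q = 0 ∧ D.col q = D.col p)).card

/-- Numbering the uncovered points of each class, `p` is one that no longer fits into the outlier
bound of its class. -/
def Excess (cov : ℕ → ℕ) (p : ℕ) : Prop := cov p = 0 ∧ D.bnd (D.col p) ≤ D.rank cov p

open Classical in
/-- The *successor* of a class whose uncovered points below `j` exceed the outlier bound, and `0` if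
there is no such class. -/
def excessClass (cov : ℕ → ℕ) : ℕ → ℕ
  | 0 => 0
  | j + 1 => if D.Excess cov j then D.col j + 1 else excessClass cov j

/-- The uncovered point of rank `a` in the class `v - 1`, searched below `j`; it is `0` if there is
no such point. -/
def pick (cov : ℕ → ℕ) (v a : ℕ) : ℕ → ℕ
  | 0 => 0
  | j + 1 => if cov j = 0 ∧ D.col j + 1 = v ∧ D.rank cov j = a then j else pick cov v a j

/-- The ball of radius `r` around `p` covers `q`, which was not covered before. -/
def Hit (cov : ℕ → ℕ) (p : ℕ) (r : ℝ) (q : ℕ) : Prop := cov q = 0 ∧ D.d p q ≤ r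

open Classical in
/-- The largest distance from `p` to a newly covered point below `j`. -/
def hitRadius (cov : ℕ → ℕ) (p : ℕ) (r : ℝ) : ℕ → ℝ
  | 0 => 0
  | j + 1 => if D.Hit cov p r j then max (hitRadius cov p r j) (D.d p j) else hitRadius cov p r j

/-- The partial clustering without centers, in which no point is covered. -/
def start : Cover where
  covered _ := 0
  assign q := if q < D.n then q else 0
  isCenter _ := 0
  cost := 0

open Classical in
/-- The partial clustering with the additional center `p`, to which the points newly covered by the
ball of radius `r` are assigned. -/
def addBall (C : Cover) (p : ℕ) (r : ℝ) : Cover where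
  covered q := if q < D.n ∧ D.Hit C.covered p r q then 1 else C.covered q
  assign q := if q < D.n ∧ D.Hit C.covered p r q then p else C.assign q
  isCenter := Function.update C.isCenter p 1
  cost := C.cost + D.hitRadius C.covered p r D.n

/-- The successor of a class with too many uncovered points; it is `0` exactly if the uncovered
points may be declared outliers. -/
abbrev violatedClass (C : Cover) : ℕ := D.excessClass C.covered D.n

/-- The point chosen by the decision `a` as the next center. -/
abbrev candidate (C : Cover) (a : ℕ) : ℕ := D.pick C.covered (D.violatedClass C) a D.n

/-- One branching step, with the decision `a` for a center and the radius `r`. -/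
def step (C : Cover) (a : ℕ) (r : ℝ) : Cover :=
  if D.violatedClass C = 0 then C else D.addBall C (D.candidate C a) r

/-- The result of `l` branching steps. The step `i` uses the decision `δ (2 * i)` for a center and
the decision `δ (2 * i + 1)` for a radius, which is looked up in `rad`. -/
def run (rad : ℕ → ℝ) (δ : ℕ → ℕ) : ℕ → Cover
  | 0 => D.start
  | l + 1 => D.step (run rad δ l) (δ (l + l)) (rad (δ (l + l + 1)))

end Definitions

variable {D : Data} {cov : ℕ → ℕ} {p q j : ℕ} {r : ℝ}

lemma Valid.n_pos (hD : D.Valid) : 0 < D.n := hD.one_le_k.trans hD.k_le_n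

lemma rank_lt_rank (hpq : p < q) (hp : cov p = 0) (hcol : D.col p = D.col q) :
    D.rank cov p < D.rank cov q := by
  refine Finset.card_lt_card (Finset.ssubset_iff_of_subset ?_ |>.2 ⟨p, ?_, ?_⟩)
  · intro x hx
    simp only [Finset.mem_filter, Finset.mem_range] at hx ⊢
    exact ⟨hx.1.trans hpq, hx.2.1, hx.2.2.trans hcol⟩
  · simp [hpq, hp, hcol]
  · simp

lemma rank_inj (hp : cov p = 0) (hq : cov q = 0) (hcol : D.col p = D.col q)
    (hrank : D.rank cov p = D.rank cov q) : p = q := by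
  rcases lt_trichotomy p q with hlt | heq | hgt
  · exact absurd hrank (rank_lt_rank hlt hp hcol).ne
  · exact heq
  · exact absurd hrank.symm (rank_lt_rank hgt hq hcol.symm).ne

lemma excessClass_eq_zero_iff : D.excessClass cov j = 0 ↔ ∀ p < j, ¬ D.Excess cov p := by
  induction j with
  | zero => simp [excessClass]
  | succ j ih =>
    rw [excessClass, Nat.forall_lt_succ_right, ← ih]
    split_ifs with h <;> simp [h]

lemma exists_excess_of_excessClass_ne_zero (h : D.excessClass cov j ≠ 0) :
    ∃ p < j, D.Excess cov p ∧ D.excessClass cov j = D.col p + 1 := by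
  induction j with
  | zero => simp [excessClass] at h
  | succ j ih =>
    rw [excessClass] at h ⊢
    split_ifs at h ⊢ with hj
    · exact ⟨j, j.lt_succ_self, hj, rfl⟩
    · obtain ⟨p, hp, hex⟩ := ih h
      exact ⟨p, hp.trans j.lt_succ_self, hex⟩

lemma card_uncovered_le (h : ∀ p < j, ¬ D.Excess cov p) (c : ℕ) :
    ((Finset.range j).filter (fun q => cov q = 0 ∧ D.col q = c)).card ≤ D.bnd c := by
  induction j with
  | zero => simp
  | succ j ih =>
    rw [Finset.range_add_one, Finset.filter_insert]
    split_ifs with hj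
    · obtain ⟨hcov, rfl⟩ := hj
      rw [Finset.card_insert_of_notMem (by simp)]
      exact not_le.1 fun hle => h j j.lt_succ_self ⟨hcov, hle⟩
    · exact ih fun p hp => h p (hp.trans j.lt_succ_self)

lemma pick_rank (hq : cov q = 0) (hj : q < j) :
    D.pick cov (D.col q + 1) (D.rank cov q) j = q := by
  induction j with
  | zero => omega
  | succ j ih =>
    rw [pick]
    split_ifs with h
    · exact rank_inj h.1 hq (Nat.succ_injective h.2.1) h.2.2
    · refine ih (lt_of_le_of_ne (Nat.lt_succ_iff.1 hj) ?_)
      rintro rfl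
      exact h ⟨hq, rfl, rfl⟩

lemma pick_lt {v a : ℕ} (hj : 0 < j) : D.pick cov v a j < j := by
  induction j with
  | zero => omega
  | succ j ih =>
    rw [pick]
    split_ifs with h
    · exact j.lt_succ_self
    · rcases Nat.eq_zero_or_pos j with rfl | hj
      · simp [pick]
      · exact (ih hj).trans j.lt_succ_self

lemma hitRadius_nonneg (j : ℕ) : 0 ≤ D.hitRadius cov p r j := by
  induction j with
  | zero => simp [hitRadius]
  | succ j ih =>
    rw [hitRadius]
    split_ifs
    exacts [le_max_of_le_left ih, ih]

lemma le_hitRadius (hq : q < j) (h : D.Hit cov p r q) : D.d p q ≤ D.hitRadius cov p r j := by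
  induction j with
  | zero => omega
  | succ j ih =>
    rw [hitRadius]
    rcases Nat.lt_succ_iff_lt_or_eq.1 hq with hlt | rfl
    · split_ifs
      exacts [le_max_of_le_left (ih hlt), ih hlt]
    · rw [if_pos h]
      exact le_max_right _ _

lemma hitRadius_le (hr : 0 ≤ r) (j : ℕ) : D.hitRadius cov p r j ≤ r := by
  induction j with
  | zero => simpa [hitRadius] using hr
  | succ j ih =>
    rw [hitRadius]
    split_ifs with h
    exacts [max_le ih h.2, ih]

lemma hitRadius_eq_zero_or_exists (j : ℕ) :
    D.hitRadius cov p r j = 0 ∨ ∃ q < j, D.hitRadius cov p r j = D.d p q := by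
  induction j with
  | zero => simp [hitRadius]
  | succ j ih =>
    have ih' : D.hitRadius cov p r j = 0 ∨ ∃ q < j + 1, D.hitRadius cov p r j = D.d p q :=
      ih.imp_right fun ⟨q, hq, h⟩ => ⟨q, hq.trans j.lt_succ_self, h⟩
    rw [hitRadius]
    split_ifs with h
    · rcases max_choice (D.hitRadius cov p r j) (D.d p j) with hmax | hmax <;> rw [hmax]
      exacts [ih', .inr ⟨j, j.lt_succ_self, rfl⟩]
    · exact ih'

lemma Valid.exists_hitRadius_eq (hD : D.Valid) (hp : p < D.n) :
    ∃ q < D.n, D.hitRadius cov p r D.n = D.d p q :=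
  (hitRadius_eq_zero_or_exists D.n).elim (fun h => ⟨p, hp, h.trans (hD.d_self p).symm⟩) id

lemma run_congr {rad : ℕ → ℝ} {δ δ' : ℕ → ℕ} {l : ℕ} (h : ∀ i < l + l, δ i = δ' i) :
    D.run rad δ l = D.run rad δ' l := by
  induction l with
  | zero => rfl
  | succ l ih =>
    rw [Data.run, Data.run, ih fun i hi => h i (by omega), h (l + l) (by omega),
      h (l + l + 1) (by omega)]

/-! ### Soundness -/

/-- The cost of `C` bounds the sum of suitable radii for its covered points. -/
def BoundsRadii (D : Data) (C : Cover) : Prop :=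
  ∃ ρ : ℕ → ℝ, (∀ c, 0 ≤ ρ c) ∧
    (∀ q < D.n, C.covered q = 1 → D.d (C.assign q) q ≤ ρ (C.assign q)) ∧
    ∑ c ∈ Finset.range D.n, ρ c ≤ C.cost

/-- The cost of `C` is a distance between two points, up to a factor between `1` and `l`. -/
def HasScale (D : Data) (C : Cover) (l : ℕ) : Prop :=
  ∃ x < D.n, ∃ y < D.n, D.d x y ≤ C.cost ∧ C.cost ≤ l * D.d x y

/-- `C` is a partial clustering with at most `l` balls of radius at most `r`; beyond the points all
arrays vanish. -/
structure Sound (D : Data) (C : Cover) (l : ℕ) (r : ℝ) : Prop where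
  covered_le : ∀ q, C.covered q ≤ 1
  covered_tail : ∀ q, D.n ≤ q → C.covered q = 0
  assign_tail : ∀ q, D.n ≤ q → C.assign q = 0
  isCenter_tail : ∀ q, D.n ≤ q → C.isCenter q = 0
  isCenter_le : ∀ q, C.isCenter q ≤ 1
  card_centers_le : ((Finset.range D.n).filter (fun q => C.isCenter q = 1)).card ≤ l
  assign_uncovered : ∀ q < D.n, C.covered q = 0 → C.assign q = q
  assign_covered : ∀ q < D.n, C.covered q = 1 → C.assign q < D.n ∧ C.isCenter (C.assign q) = 1 ∧
    D.d (C.assign q) q ≤ r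
  cost_le : C.cost ≤ l * r
  boundsRadii : D.BoundsRadii C
  hasScale : D.HasScale C l

variable {C : Cover} {l : ℕ}

lemma BoundsRadii.addBall (h : D.BoundsRadii C) (hp : p < D.n) :
    D.BoundsRadii (D.addBall C p r) := by
  obtain ⟨ρ, hρ0, hρ, hcost⟩ := h
  have hnonneg := hitRadius_nonneg (D := D) (cov := C.covered) (p := p) (r := r) D.n
  refine ⟨fun c => ρ c + if c = p then D.hitRadius C.covered p r D.n else 0, fun c => ?_,
    fun q hq hc => ?_, ?_⟩
  · have := hρ0 c
    positivity
  · simp only [Data.addBall] at hc ⊢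
    split_ifs at hc ⊢ with hnew hqp hqp
    · exact le_add_of_nonneg_of_le (hρ0 p) (le_hitRadius hnew.1 hnew.2)
    · exact absurd rfl hqp
    · exact (hρ q hq hc).trans (le_add_of_nonneg_right hnonneg)
    · simpa using hρ q hq hc
  · rw [Finset.sum_add_distrib, Finset.sum_ite_eq', if_pos (Finset.mem_range.2 hp)]
    simpa [Data.addBall] using hcost

/-- The larger one of the distances witnessing the two summands of the new cost is a witness for the
sum. -/
lemma HasScale.addBall (h : D.HasScale C l) (hD : D.Valid) (hp : p < D.n) :
    D.HasScale (D.addBall C p r) (l + 1) := by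
  obtain ⟨x, hx, y, hy, hlow, hup⟩ := h
  obtain ⟨z, hz, hnew⟩ := hD.exists_hitRadius_eq (cov := C.covered) (r := r) hp
  have hxy := hD.d_nonneg x y
  have hpz := hD.d_nonneg p z
  simp only [HasScale, Data.addBall, hnew]
  push_cast
  rcases le_total (D.d x y) (D.d p z) with hle | hle
  · have : (l : ℝ) * D.d x y ≤ l * D.d p z := by gcongr
    exact ⟨p, hp, z, hz, by linarith, by linarith⟩
  · exact ⟨x, hx, y, hy, by linarith, by linarith⟩

lemma Sound.start (hD : D.Valid) (r : ℝ) : Sound D D.start 0 r where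
  covered_le := by simp [Data.start]
  covered_tail := by simp [Data.start]
  assign_tail q hq := by simp [Data.start, hq]
  isCenter_tail := by simp [Data.start]
  isCenter_le := by simp [Data.start]
  card_centers_le := by simp [Data.start]
  assign_uncovered q hq _ := by simp [Data.start, hq]
  assign_covered := by simp [Data.start]
  cost_le := by simp [Data.start]
  boundsRadii := ⟨fun _ => 0, by simp, by simp [Data.start], by simp [Data.start]⟩
  hasScale := ⟨0, hD.n_pos, 0, hD.n_pos, by simp [Data.start, hD.d_self]⟩

lemma Sound.mono {l' : ℕ} (h : Sound D C l r) (hl : l ≤ l') (hr : 0 ≤ r) (hD : D.Valid) :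
    Sound D C l' r where
  __ := h
  card_centers_le := h.card_centers_le.trans hl
  cost_le := h.cost_le.trans (by gcongr)
  hasScale := by
    obtain ⟨x, hx, y, hy, hlow, hup⟩ := h.hasScale
    have := hD.d_nonneg x y
    exact ⟨x, hx, y, hy, hlow, hup.trans (by gcongr)⟩

lemma card_centers_addBall_le : ((Finset.range D.n).filter
      (fun q => (D.addBall C p r).isCenter q = 1)).card ≤
    ((Finset.range D.n).filter (fun q => C.isCenter q = 1)).card + 1 := by
  refine (Finset.card_le_card fun q hq => ?_).trans (Finset.card_insert_le p _)
  simp only [Data.addBall, Finset.mem_filter, Finset.mem_range, Function.update_apply,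
    Finset.mem_insert] at hq ⊢
  by_cases hqp : q = p
  · exact .inl hqp
  · exact .inr ⟨hq.1, by simpa [hqp] using hq.2⟩

lemma Sound.addBall {r' : ℝ} (h : Sound D C l r) (hD : D.Valid) (hp : p < D.n) (hr' : 0 ≤ r')
    (hr : r' ≤ r) : Sound D (D.addBall C p r') (l + 1) r where
  covered_le q := by
    simp only [Data.addBall]
    split_ifs
    exacts [le_rfl, h.covered_le q]
  covered_tail q hq := by
    simp only [Data.addBall, hq.not_gt, false_and, if_false, h.covered_tail q hq]
  assign_tail q hq := by
    simp only [Data.addBall, hq.not_gt, false_and, if_false, h.assign_tail q hq]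
  isCenter_tail q hq := by
    simp only [Data.addBall]
    rw [Function.update_of_ne (hp.trans_le hq).ne', h.isCenter_tail q hq]
  isCenter_le q := by
    simp only [Data.addBall, Function.update_apply]
    split_ifs
    exacts [le_rfl, h.isCenter_le q]
  card_centers_le := card_centers_addBall_le.trans (Nat.succ_le_succ h.card_centers_le)
  assign_uncovered q hq hc := by
    simp only [Data.addBall] at hc ⊢
    split_ifs at hc ⊢
    exact h.assign_uncovered q hq hc
  assign_covered q hq hc := by
    simp only [Data.addBall] at hc ⊢
    split_ifs at hc ⊢ with hnew
    · exact ⟨hp, by simp, hnew.2.2.trans hr⟩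
    · obtain ⟨hlt, hcenter, hdist⟩ := h.assign_covered q hq hc
      exact ⟨hlt, by simp [Function.update_apply, hcenter], hdist⟩
  cost_le := by
    have hold := h.cost_le
    have hnew := (hitRadius_le (D := D) (cov := C.covered) (p := p) hr' D.n).trans hr
    simp only [Data.addBall]
    push_cast
    linarith
  boundsRadii := h.boundsRadii.addBall hp
  hasScale := h.hasScale.addBall hD hp

lemma Sound.run (hD : D.Valid) {rad : ℕ → ℝ} {δ : ℕ → ℕ} (hr : 0 ≤ r)
    (hrad : ∀ i < l, 0 ≤ rad (δ (i + i + 1)) ∧ rad (δ (i + i + 1)) ≤ r) :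
    Sound D (D.run rad δ l) l r := by
  induction l with
  | zero => exact .start hD r
  | succ l ih =>
    have hl := ih fun i hi => hrad i (hi.trans l.lt_succ_self)
    obtain ⟨hnonneg, hle⟩ := hrad l l.lt_succ_self
    rw [Data.run, Data.step]
    split_ifs
    · exact hl.mono l.le_succ hr hD
    · exact hl.addBall hD (pick_lt hD.n_pos) hnonneg hle

end Data

/-! ### Completeness -/

/-- A clustering with outliers, with which the result of the algorithm is compared. A point that is
not an outlier has distance at most `radius c` to its center `c`. -/
structure Clustering (D : Data) : Type where
  centers : Finset ℕ
  outliers : Finset ℕ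
  assign : ℕ → ℕ
  radius : ℕ → ℝ
  card_centers_le : centers.card ≤ D.k
  lt_n : ∀ c ∈ centers, c < D.n
  card_outliers_le : ∀ c, (outliers.filter (fun q => D.col q = c)).card ≤ D.bnd c
  assign_mem : ∀ q < D.n, q ∉ outliers → assign q ∈ centers
  dist_le : ∀ q < D.n, q ∉ outliers → D.d q (assign q) ≤ radius (assign q)
  radius_nonneg : ∀ c ∈ centers, 0 ≤ radius c

/-- The sum of the radii. -/
def Clustering.cost {D : Data} (S : Clustering D) : ℝ := ∑ c ∈ S.centers, S.radius c

namespace Data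

variable {D : Data} {cov : ℕ → ℕ} {C : Cover} {p M G l : ℕ} {r η : ℝ} {A : Finset ℕ}

lemma Excess.exists_notMem_outliers (S : Clustering D) (h : D.Excess cov p) :
    ∃ q ≤ p, cov q = 0 ∧ D.col q = D.col p ∧ q ∉ S.outliers := by
  by_contra! hall
  have hsub : insert p ((Finset.range p).filter (fun q => cov q = 0 ∧ D.col q = D.col p)) ⊆
      S.outliers.filter (fun q => D.col q = D.col p) := by
    intro q hq
    rw [Finset.mem_insert, Finset.mem_filter, Finset.mem_range] at hq
    rw [Finset.mem_filter]
    rcases hq with rfl | ⟨hlt, hcov, hcol⟩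
    exacts [⟨hall q le_rfl h.1 rfl, rfl⟩, ⟨hall q hlt.le hcov hcol, hcol⟩]
  have hcard := (Finset.card_le_card hsub).trans (S.card_outliers_le (D.col p))
  rw [Finset.card_insert_of_notMem (by simp)] at hcard
  exact (Nat.lt_of_succ_le hcard).not_ge h.2

lemma rank_le_bnd (S : Clustering D)
    (h : ∀ q < p, cov q = 0 → D.col q = D.col p → q ∈ S.outliers) :
    D.rank cov p ≤ D.bnd (D.col p) := by
  refine (Finset.card_le_card fun q hq => ?_).trans (S.card_outliers_le (D.col p))
  rw [Finset.mem_filter, Finset.mem_range] at hq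
  exact Finset.mem_filter.2 ⟨h q hq.1 hq.2.1 hq.2.2, hq.2.2⟩

/-- The decision is the rank of the first uncovered point of the violated class that is not an
outlier of `S`. -/
lemma exists_candidate_notMem_outliers (S : Clustering D) (h : D.violatedClass C ≠ 0)
    (hM : ∀ p < D.n, D.bnd (D.col p) < M) :
    ∃ a < M, D.candidate C a < D.n ∧ D.candidate C a ∉ S.outliers ∧
      C.covered (D.candidate C a) = 0 := by
  classical
  obtain ⟨p, hp, hexcess, hclass⟩ := exists_excess_of_excessClass_ne_zero h
  have hex := hexcess.exists_notMem_outliers S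
  obtain ⟨hqp, hcov, hcol, hout⟩ := Nat.find_spec hex
  have hfirst := fun x => Nat.find_min hex (m := x)
  set q := Nat.find hex
  have hq : q < D.n := hqp.trans_lt hp
  have hrank : D.rank C.covered q ≤ D.bnd (D.col q) := rank_le_bnd S fun x hx hxcov hxcol => by
    by_contra hxout
    exact hfirst x hx ⟨hx.le.trans hqp, hxcov, hxcol.trans hcol, hxout⟩
  have hpick : D.candidate C (D.rank C.covered q) = q := by
    rw [candidate, violatedClass, hclass, ← hcol, pick_rank hcov hq]
  exact ⟨D.rank C.covered q, hrank.trans_lt (hM q hq), by rw [hpick]; exact ⟨hq, hout, hcov⟩⟩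

end Data

lemma exists_le_mul_pow {R x q : ℝ} {G : ℕ} (hG : 0 < G) (hx : x ≤ R) :
    ∃ g < G, x ≤ R * q ^ g ∧ (g = G - 1 ∨ R * q ^ (g + 1) < x) := by
  induction G with
  | zero => omega
  | succ G ih =>
    rcases Nat.eq_zero_or_pos G with rfl | hpos
    · exact ⟨0, hG, by simpa using hx, .inl rfl⟩
    by_cases hlast : x ≤ R * q ^ G
    · exact ⟨G, G.lt_succ_self, hlast, .inl rfl⟩
    obtain ⟨g, hg, hle, hnext⟩ := ih hpos
    refine ⟨g, hg.trans G.lt_succ_self, hle, .inr ?_⟩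
    rcases hnext with hg' | hlt
    · rw [show g + 1 = G by omega]
      exact not_le.1 hlast
    · exact hlt

/-- The ratio `2 / 7` is such that a radius `x`, doubled by the passage to another center of its
cluster, is overestimated by a factor of at most `7`. -/
lemma exists_guess {R x : ℝ} {G : ℕ} (hG : 0 < G) (hR : 0 ≤ R) (hxR : x ≤ R) (hx : 0 ≤ x) :
    ∃ g < G, 2 * x ≤ 2 * (R * (2 / 7) ^ g) ∧
      2 * (R * (2 / 7) ^ g) ≤ 7 * x + 2 * (R * (2 / 7) ^ (G - 1)) := by
  obtain ⟨g, hg, hle, hnext⟩ := exists_le_mul_pow (q := 2 / 7) hG hxR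
  have hη : 0 ≤ R * (2 / 7 : ℝ) ^ (G - 1) := by positivity
  refine ⟨g, hg, by linarith, ?_⟩
  rcases hnext with rfl | hlt
  · linarith
  · rw [pow_succ] at hlt
    linarith

/-- The number of values of the decision `i`: even decisions choose a center, odd ones a radius. -/
def digitBound (M G i : ℕ) : ℕ := if i % 2 = 0 then M else G

/-- The balls of `C` cover the clusters of `S` with centers in `A`, with radii that are at most
`7` times those of `S`, up to `η`. -/
structure Follows {D : Data} (S : Clustering D) (η : ℝ) (C : Cover) (A : Finset ℕ) : Prop where
  subset : A ⊆ S.centers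
  covered_ne_zero : ∀ q < D.n, q ∉ S.outliers → S.assign q ∈ A → C.covered q ≠ 0
  cost_le : C.cost ≤ ∑ c ∈ A, (7 * S.radius c + η)

namespace Follows

open Data

variable {D : Data} {S : Clustering D} {C : Cover} {A : Finset ℕ} {p M G l : ℕ} {r η : ℝ}

lemma start : Follows S η D.start ∅ where
  subset := by simp
  covered_ne_zero := by simp
  cost_le := by simp [Data.start]

lemma assign_notMem (h : Follows S η C A) (hp : p < D.n) (hout : p ∉ S.outliers)
    (hcov : C.covered p = 0) : S.assign p ∉ A :=
  fun hA => h.covered_ne_zero p hp hout hA hcov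

lemma addBall (h : Follows S η C A) (hD : D.Valid) (hp : p < D.n) (hout : p ∉ S.outliers)
    (hcov : C.covered p = 0) (hlow : 2 * S.radius (S.assign p) ≤ r)
    (hup : r ≤ 7 * S.radius (S.assign p) + η) :
    Follows S η (D.addBall C p r) (insert (S.assign p) A) where
  subset := Finset.insert_subset (S.assign_mem p hp hout) h.subset
  covered_ne_zero q hq hqout hqA := by
    simp only [Data.addBall]
    split_ifs with hnew
    · exact one_ne_zero
    rcases Finset.mem_insert.1 hqA with hqp | hqA
    · refine fun hqcov => hnew ⟨hq, hqcov, ?_⟩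
      have hcenter := S.lt_n _ (S.assign_mem p hp hout)
      calc D.d p q ≤ D.d p (S.assign p) + D.d q (S.assign p) := by
            rw [hD.d_symm q]
            exact hD.d_triangle p _ q hp hcenter hq
        _ ≤ S.radius (S.assign p) + S.radius (S.assign p) :=
            add_le_add (S.dist_le p hp hout) (hqp ▸ S.dist_le q hq hqout)
        _ ≤ r := by linarith
    · exact h.covered_ne_zero q hq hqout hqA
  cost_le := by
    have hradius := S.radius_nonneg _ (S.assign_mem p hp hout)
    have hhit := hitRadius_le (D := D) (cov := C.covered) (p := p) (r := r) (by linarith) D.n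
    rw [Finset.sum_insert (h.assign_notMem hp hout hcov), add_comm]
    exact add_le_add h.cost_le (hhit.trans hup)

lemma exists_run_succ (hD : D.Valid) {R : ℝ} (hR0 : 0 ≤ R) (hR : ∀ c ∈ S.centers, S.radius c ≤ R)
    (hG : 0 < G) {rad : ℕ → ℝ} (hrad : ∀ g < G, rad g = 2 * (R * (2 / 7) ^ g)) {δ : ℕ → ℕ}
    (h : Follows S (2 * (R * (2 / 7) ^ (G - 1))) (D.run rad δ l) A)
    (hv : D.violatedClass (D.run rad δ l) ≠ 0) {b : ℕ}
    (hp : D.candidate (D.run rad δ l) b < D.n)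
    (hout : D.candidate (D.run rad δ l) b ∉ S.outliers)
    (hcov : (D.run rad δ l).covered (D.candidate (D.run rad δ l) b) = 0) :
    ∃ g < G, ∃ A', A'.card = A.card + 1 ∧ ∀ δ' : ℕ → ℕ, (∀ i < l + l, δ' i = δ i) →
      δ' (l + l) = b → δ' (l + l + 1) = g →
      Follows S (2 * (R * (2 / 7) ^ (G - 1))) (D.run rad δ' (l + 1)) A' := by
  have hmem := S.assign_mem _ hp hout
  obtain ⟨g, hg, hlow, hup⟩ := exists_guess hG hR0 (hR _ hmem) (S.radius_nonneg _ hmem)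
  rw [← hrad g hg] at hlow hup
  refine ⟨g, hg, _, Finset.card_insert_of_notMem (h.assign_notMem hp hout hcov),
    fun δ' hδ' hb hg' => ?_⟩
  rw [Data.run, run_congr hδ', Data.step, if_neg hv, hb, hg']
  exact h.addBall hD hp hout hcov hlow hup

lemma exists_run (hD : D.Valid) {R : ℝ} (hR0 : 0 ≤ R) (hR : ∀ c ∈ S.centers, S.radius c ≤ R)
    (hG : 0 < G) (hM : ∀ p < D.n, D.bnd (D.col p) < M) {rad : ℕ → ℝ}
    (hrad : ∀ g < G, rad g = 2 * (R * (2 / 7) ^ g)) {a : ℕ}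
    (ha : D.violatedClass D.start ≠ 0 → D.candidate D.start a ∉ S.outliers) (l : ℕ) :
    ∃ (δ : ℕ → ℕ) (A : Finset ℕ), Follows S (2 * (R * (2 / 7) ^ (G - 1))) (D.run rad δ l) A ∧
      δ 0 = a ∧ (∀ i, 1 ≤ i → δ i < digitBound M G i) ∧
      (D.violatedClass (D.run rad δ l) = 0 ∨ A.card = l) := by
  induction l with
  | zero =>
    refine ⟨fun i => if i = 0 then a else 0, ∅, .start, rfl, fun i hi => ?_, .inr rfl⟩
    simp only [digitBound, Nat.ne_of_gt hi, if_false]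
    split_ifs
    exacts [(Nat.zero_le _).trans_lt (hM 0 hD.n_pos), hG]
  | succ l ih =>
    obtain ⟨δ, A, hfollows, h0, hδ, hend⟩ := ih
    by_cases hv : D.violatedClass (D.run rad δ l) = 0
    · refine ⟨δ, A, ?_, h0, hδ, ?_⟩ <;> rw [Data.run, Data.step, if_pos hv]
      exacts [hfollows, .inl hv]
    obtain ⟨b, hba, hbM, hb, hout, hcov⟩ : ∃ b, (l = 0 → b = a) ∧ (l ≠ 0 → b < M) ∧
        D.candidate (D.run rad δ l) b < D.n ∧ D.candidate (D.run rad δ l) b ∉ S.outliers ∧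
        (D.run rad δ l).covered (D.candidate (D.run rad δ l) b) = 0 := by
      rcases Nat.eq_zero_or_pos l with rfl | hl
      · exact ⟨a, fun _ => rfl, fun h => absurd rfl h, pick_lt hD.n_pos, ha hv, rfl⟩
      · obtain ⟨b, hb, h⟩ := exists_candidate_notMem_outliers S hv hM
        exact ⟨b, fun h => absurd h hl.ne', fun _ => hb, h⟩
    obtain ⟨g, hg, A', hcard, hrun⟩ := hfollows.exists_run_succ hD hR0 hR hG hrad hv hb hout hcov
    refine ⟨Function.update (Function.update δ (l + l) b) (l + l + 1) g, A',
      hrun _ (fun i hi => ?_) ?_ (by simp), ?_, fun i hi => ?_,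
      .inr (by rw [hcard, hend.resolve_left hv])⟩
    · simp [show i ≠ l + l + 1 by omega, hi.ne]
    · simp
    · rcases Nat.eq_zero_or_pos l with rfl | hl
      · simpa using hba rfl
      · simp [show 0 ≠ l + l by omega, h0]
    · simp only [Function.update_apply]
      split_ifs with hi1 hi0
      · simpa [digitBound, hi1, show (l + l + 1) % 2 = 1 by omega] using hg
      · simpa [digitBound, hi0, show (l + l) % 2 = 0 by omega] using hbM (by omega)
      · exact hδ i hi

lemma cost_le_add (h : Follows S η C A) (hη : 0 ≤ η) :
    C.cost ≤ 7 * S.cost + D.k * η := by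
  have hcard : (S.centers.card : ℝ) ≤ D.k := by exact_mod_cast S.card_centers_le
  calc C.cost ≤ ∑ c ∈ A, (7 * S.radius c + η) := h.cost_le
    _ ≤ ∑ c ∈ S.centers, (7 * S.radius c + η) :=
        Finset.sum_le_sum_of_subset_of_nonneg h.subset fun c hc _ => by
          have := S.radius_nonneg c hc
          positivity
    _ = 7 * S.cost + S.centers.card * η := by
        rw [Finset.sum_add_distrib, ← Finset.mul_sum, Finset.sum_const, nsmul_eq_mul,
          Clustering.cost]
    _ ≤ 7 * S.cost + D.k * η := by gcongr

end Follows

namespace Data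

variable {D : Data}

lemma exists_run (hD : D.Valid) (S : Clustering D) {R : ℝ} (hR0 : 0 ≤ R)
    (hR : ∀ c ∈ S.centers, S.radius c ≤ R) {M G : ℕ} (hG : 0 < G)
    (hM : ∀ p < D.n, D.bnd (D.col p) < M) {rad : ℕ → ℝ}
    (hrad : ∀ g < G, rad g = 2 * (R * (2 / 7) ^ g)) {a : ℕ}
    (ha : D.violatedClass D.start ≠ 0 → D.candidate D.start a ∉ S.outliers) :
    ∃ δ : ℕ → ℕ, δ 0 = a ∧ (∀ i, 1 ≤ i → δ i < digitBound M G i) ∧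
      D.violatedClass (D.run rad δ D.k) = 0 ∧
      (D.run rad δ D.k).cost ≤ 7 * S.cost + D.k * (2 * (R * (2 / 7) ^ (G - 1))) := by
  obtain ⟨δ, A, hfollows, h0, hδ, hend⟩ := Follows.exists_run hD hR0 hR hG hM hrad ha D.k
  refine ⟨δ, h0, hδ, ?_, hfollows.cost_le_add (by positivity)⟩
  by_contra hv
  have hA : A = S.centers := Finset.eq_of_subset_of_card_le hfollows.subset
    (S.card_centers_le.trans (hend.resolve_left hv).ge)
  obtain ⟨b, -, hb, hout, hcov⟩ := exists_candidate_notMem_outliers S hv hM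
  exact hfollows.assign_notMem hb hout hcov (hA ▸ S.assign_mem _ hb hout)

end Data

/-! ### The number of scales -/

lemma sq_le_two_pow (k : ℕ) : k ^ 2 ≤ 2 ^ (k + 1) := by
  induction k with
  | zero => simp
  | succ k ih =>
    rcases Nat.lt_or_ge k 3 with hk | hk
    · interval_cases k <;> norm_num
    · rw [pow_succ 2]
      nlinarith

namespace Data

/-- The points of `S` have mutual distance at least `s`. -/
structure Separated (D : Data) (s : ℝ) (S : Finset ℕ) : Prop where
  lt_n : ∀ x ∈ S, x < D.n
  le_dist : ∀ x ∈ S, ∀ y ∈ S, x ≠ y → s ≤ D.d x y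

/-- A potential for the number `u` of times the scale `R` was lowered: a set of more than `e` points
is separated at the scale of `R * 2 ^ f`, and `f` was at most `k + 4` each time that `e` grew. -/
def ScalePotential (D : Data) (m u : ℕ) (R : ℝ) : Prop :=
  ∃ (e f : ℕ) (s : ℝ) (S : Finset ℕ), u ≤ (D.k + 5) * e + f ∧ f ≤ D.k + 4 ∧ e ≤ D.k + m ∧
    e + 1 ≤ S.card ∧ D.Separated s S ∧ R * 2 ^ f ≤ D.k * s

variable {D : Data} {ω m u x y : ℕ} {s R R' : ℝ} {C : Cover} {S : Finset ℕ}

lemma card_le_sum_bnd (hcol : ∀ p < D.n, D.col p < ω) (hS : ∀ q ∈ S, q < D.n)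
    (h : ∀ c, (S.filter (fun q => D.col q = c)).card ≤ D.bnd c) :
    S.card ≤ ∑ c ∈ Finset.range ω, D.bnd c := by
  rw [Finset.card_eq_sum_card_fiberwise (f := D.col) (t := Finset.range ω)
    (fun q hq => by simpa using hcol q (hS q hq))]
  exact Finset.sum_le_sum fun c _ => h c

lemma Sound.card_separated_le (hD : D.Valid) (hcol : ∀ p < D.n, D.col p < ω)
    (h : Sound D C D.k R) (hv : D.violatedClass C = 0) (hS : D.Separated s S) (hs : 2 * R < s) :
    S.card ≤ D.k + ∑ c ∈ Finset.range ω, D.bnd c := by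
  rw [← Finset.card_filter_add_card_filter_not (s := S) (fun q => C.covered q = 1)]
  refine Nat.add_le_add
    ((Finset.card_le_card_of_injOn C.assign ?_ ?_).trans h.card_centers_le)
    (card_le_sum_bnd hcol (fun q hq => hS.lt_n q (Finset.mem_filter.1 hq).1) fun c => ?_)
  · intro q hq
    obtain ⟨hq, hcov⟩ := Finset.mem_filter.1 hq
    obtain ⟨hlt, hcenter, -⟩ := h.assign_covered q (hS.lt_n q hq) hcov
    simpa using ⟨hlt, hcenter⟩
  · intro x hx y hy hxy
    obtain ⟨hx, hxcov⟩ := Finset.mem_filter.1 hx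
    obtain ⟨hy, hycov⟩ := Finset.mem_filter.1 hy
    by_contra hne
    obtain ⟨hlt, -, hxR⟩ := h.assign_covered x (hS.lt_n x hx) hxcov
    obtain ⟨-, -, hyR⟩ := h.assign_covered y (hS.lt_n y hy) hycov
    have htri := hD.d_triangle x (C.assign x) y (hS.lt_n x hx) hlt (hS.lt_n y hy)
    have hsep := hS.le_dist x hx y hy hne
    rw [hD.d_symm] at hxR
    rw [← hxy] at hyR
    linarith
  · refine (Finset.card_le_card fun q hq => ?_).trans
      (card_uncovered_le (excessClass_eq_zero_iff.1 hv) c)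
    simp only [Finset.mem_filter, Finset.mem_range] at hq ⊢
    have := h.covered_le q
    exact ⟨hS.lt_n q hq.1.1, by omega, hq.2⟩

lemma Separated.card_filter_dist_lt_le_one (hD : D.Valid) (hS : D.Separated s S) (hx : x < D.n) :
    (S.filter (fun z => ¬ s / 2 ≤ D.d z x)).card ≤ 1 := by
  refine Finset.card_le_one.2 fun z hz w hw => ?_
  obtain ⟨hz, hzx⟩ := Finset.mem_filter.1 hz
  obtain ⟨hw, hwx⟩ := Finset.mem_filter.1 hw
  by_contra hne
  have hsep := hS.le_dist z hz w hw hne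
  have htri := hD.d_triangle z x w (hS.lt_n z hz) hx (hS.lt_n w hw)
  rw [hD.d_symm x w] at htri
  linarith

/-- The pair `x`, `y` replaces the at most one point of `S` that is close to `x`. -/
lemma Separated.exists_card_succ (hD : D.Valid) (hS : D.Separated s S) (hx : x < D.n)
    (hy : y < D.n) (hpos : 0 < D.d x y) (hs : 4 * D.d x y ≤ s) :
    ∃ T, D.Separated (D.d x y) T ∧ S.card + 1 ≤ T.card := by
  set S₀ := S.filter (fun z => s / 2 ≤ D.d z x) with hS₀
  have hfar : ∀ z ∈ S₀, D.d x y ≤ D.d z x ∧ D.d x y ≤ D.d z y := by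
    intro z hz
    obtain ⟨hz, hzx⟩ := Finset.mem_filter.1 hz
    have htri := hD.d_triangle z y x (hS.lt_n z hz) hy hx
    rw [hD.d_symm y x] at htri
    constructor <;> linarith
  have hxS₀ : x ∉ S₀ := fun h => ((hfar x h).1.trans_eq (hD.d_self x)).not_gt hpos
  have hyS₀ : y ∉ S₀ := fun h => ((hfar y h).2.trans_eq (hD.d_self y)).not_gt hpos
  have hxy : x ≠ y := fun h => hpos.ne' (h ▸ hD.d_self x)
  refine ⟨insert x (insert y S₀), ⟨fun z hz => ?_, fun z hz w hw hne => ?_⟩, ?_⟩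
  · rw [Finset.mem_insert, Finset.mem_insert] at hz
    rcases hz with rfl | rfl | hz
    exacts [hx, hy, hS.lt_n z (Finset.mem_filter.1 hz).1]
  · rw [Finset.mem_insert, Finset.mem_insert] at hz hw
    rcases hz with rfl | rfl | hz <;> rcases hw with rfl | rfl | hw
    · exact absurd rfl hne
    · exact le_rfl
    · exact hD.d_symm z w ▸ (hfar w hw).1
    · exact (hD.d_symm w z).le
    · exact absurd rfl hne
    · exact hD.d_symm z w ▸ (hfar w hw).2
    · exact (hfar z hz).1
    · exact (hfar z hz).2
    · have := hS.le_dist z (Finset.mem_filter.1 hz).1 w (Finset.mem_filter.1 hw).1 hne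
      linarith
  · rw [Finset.card_insert_of_notMem (by simp [hxy, hxS₀]), Finset.card_insert_of_notMem hyS₀]
    have hnear := hS.card_filter_dist_lt_le_one hD hx
    have hsplit := Finset.card_filter_add_card_filter_not (s := S) (fun z => s / 2 ≤ D.d z x)
    rw [← hS₀] at hsplit
    omega

namespace ScalePotential

lemma count_le (h : D.ScalePotential m u R) : u ≤ (D.k + 5) * (D.k + m + 1) := by
  obtain ⟨e, f, s, S, hu, hf, he, -⟩ := h
  nlinarith

lemma zero (hD : D.Valid) (hR : 0 ≤ R) : D.ScalePotential m 0 R := by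
  have hk : (1 : ℝ) ≤ D.k := by exact_mod_cast hD.one_le_k
  refine ⟨0, 0, R, {0}, by omega, by omega, by omega, by simp, ⟨?_, by simp⟩, ?_⟩
  · simpa using hD.n_pos
  · simpa using le_mul_of_one_le_left hR hk

end ScalePotential

/-- Either `f` grows, or after `k + 4` halvings the pair `x`, `y` is so close that it enlarges the
separated set. -/
lemma ScalePotential.succ (hD : D.Valid) (hcol : ∀ p < D.n, D.col p < ω)
    (h : D.ScalePotential (∑ c ∈ Finset.range ω, D.bnd c) u R) (hR : 0 < R)
    (hC : Sound D C D.k (2 * R)) (hv : D.violatedClass C = 0) (hx : x < D.n) (hy : y < D.n)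
    (hpos : 0 < D.d x y) (hxy : D.d x y ≤ D.k * (2 * R)) (hR'xy : R' ≤ D.k * D.d x y)
    (hR' : R' ≤ R / 2) :
    D.ScalePotential (∑ c ∈ Finset.range ω, D.bnd c) (u + 1) R' := by
  obtain ⟨e, f, s, S, hu, hf, he, hcard, hS, hs⟩ := h
  rcases hf.lt_or_eq with hlt | rfl
  · refine ⟨e, f + 1, s, S, by omega, hlt, he, hcard, hS, le_trans ?_ hs⟩
    calc R' * 2 ^ (f + 1) ≤ R / 2 * 2 ^ (f + 1) := by gcongr
      _ = R * 2 ^ f := by ring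
  have hk : (1 : ℝ) ≤ D.k := by exact_mod_cast hD.one_le_k
  have hsR : 8 * D.k * R ≤ s := by
    have hpow : (D.k : ℝ) ^ 2 ≤ 2 ^ (D.k + 1) := by exact_mod_cast sq_le_two_pow D.k
    refine le_of_mul_le_mul_left ?_ (zero_lt_one.trans_le hk)
    calc (D.k : ℝ) * (8 * D.k * R) = R * (D.k ^ 2 * 8) := by ring
      _ ≤ R * (2 ^ (D.k + 1) * 8) := by gcongr
      _ = R * 2 ^ (D.k + 4) := by ring
      _ ≤ D.k * s := hs
  have hpack : S.card ≤ D.k + ∑ c ∈ Finset.range ω, D.bnd c :=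
    hC.card_separated_le hD hcol hv hS (by nlinarith)
  obtain ⟨T, hT, hTcard⟩ := hS.exists_card_succ hD hx hy hpos (by linarith)
  exact ⟨e + 1, 0, D.d x y, T, by linarith, by omega, by omega, by omega, hT, by simpa using hR'xy⟩

end Data

/-! ### Mixed radix counting -/

namespace MixedRadix

/-- The weight of the digit `i` if `B j` is the number of values of the digit `j`. As the first
decision is never changed, the digits are numbered from `1`. -/
def weight (B : ℕ → ℕ) (i : ℕ) : ℕ := ∏ j ∈ Finset.Ico 1 i, B j

/-- The number represented by the digits below `i`. -/
def value (B δ : ℕ → ℕ) (i : ℕ) : ℕ := ∑ j ∈ Finset.Ico 1 i, δ j * weight B j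

/-- The entries of `δ` below `i`, except for the first one, are digits for the bounds `B`. -/
def IsDigits (B δ : ℕ → ℕ) (i : ℕ) : Prop := ∀ j, 1 ≤ j → j < i → δ j < B j

variable {B δ δ' : ℕ → ℕ} {i : ℕ}

lemma weight_succ (B : ℕ → ℕ) (hi : 1 ≤ i) : weight B (i + 1) = weight B i * B i := by
  rw [weight, Finset.prod_Ico_succ_top hi, weight]

lemma value_succ (B δ : ℕ → ℕ) (hi : 1 ≤ i) :
    value B δ (i + 1) = value B δ i + δ i * weight B i := by
  rw [value, Finset.sum_Ico_succ_top hi, value]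

lemma value_lt_weight (hi : 1 ≤ i) (h : IsDigits B δ i) : value B δ i < weight B i := by
  induction i, hi using Nat.le_induction with
  | base => simp [value, weight]
  | succ i hi ih =>
    rw [value_succ _ _ hi, weight_succ _ hi]
    have hlow := ih fun j hj hji => h j hj (by omega)
    have hdigit := h i hi (by omega)
    nlinarith

lemma value_injOn (hi : 1 ≤ i) (h : IsDigits B δ i) (h' : IsDigits B δ' i)
    (heq : value B δ i = value B δ' i) : ∀ j, 1 ≤ j → j < i → δ j = δ' j := by
  induction i, hi using Nat.le_induction with
  | base => intro j hj hj1; omega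
  | succ i hi ih =>
    have hlow : IsDigits B δ i := fun j hj hji => h j hj (by omega)
    have hlow' : IsDigits B δ' i := fun j hj hji => h' j hj (by omega)
    rw [value_succ _ _ hi, value_succ _ _ hi] at heq
    have hlt := value_lt_weight hi hlow
    have hlt' := value_lt_weight hi hlow'
    have htop : δ i = δ' i := by
      rcases lt_trichotomy (δ i) (δ' i) with hδ | hδ | hδ
      · nlinarith
      · exact hδ
      · nlinarith
    intro j hj hji
    rcases Nat.lt_succ_iff_lt_or_eq.1 hji with hji | rfl
    exacts [ih hlow hlow' (by rw [htop] at heq; omega) j hj hji, htop]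

lemma value_of_maximal (hi : 1 ≤ i) (h : ∀ j, 1 ≤ j → j < i → δ j + 1 = B j) :
    value B δ i + 1 = weight B i := by
  induction i, hi using Nat.le_induction with
  | base => simp [value, weight]
  | succ i hi ih =>
    rw [value_succ _ _ hi, weight_succ _ hi, ← h i hi (by omega),
      ← ih fun j hj hji => h j hj (by omega)]
    ring

lemma value_increment {K : ℕ} (hi : 1 ≤ i) (hK : i < K)
    (hmax : ∀ j, 1 ≤ j → j < i → δ j + 1 = B j) (hzero : ∀ j, 1 ≤ j → j < i → δ' j = 0)
    (hincr : δ' i = δ i + 1) (heq : ∀ j, i < j → δ' j = δ j) :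
    value B δ' K = value B δ K + 1 := by
  induction K, hK using Nat.le_induction with
  | base =>
    have hlow : value B δ' i = 0 := Finset.sum_eq_zero fun j hj => by
      rw [Finset.mem_Ico] at hj
      rw [hzero j hj.1 hj.2, zero_mul]
    rw [Nat.succ_eq_add_one, value_succ _ _ hi, value_succ _ _ hi, hincr, hlow, add_mul, one_mul,
      ← value_of_maximal hi hmax]
    ring
  | succ K hK ih =>
    have hiK : i < K := hK
    rw [value_succ _ _ (by omega), value_succ _ _ (by omega), ih, heq K hiK]
    ring

end MixedRadix

open MixedRadix in
lemma weight_digitBound (M G : ℕ) {k : ℕ} (hk : 1 ≤ k) :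
    weight (digitBound M G) (k + k) = M ^ (k - 1) * G ^ k := by
  induction k, hk using Nat.le_induction with
  | base => simp [weight, digitBound]
  | succ k hk ih =>
    rw [show k + 1 + (k + 1) = k + k + 1 + 1 by ring, weight_succ _ (by omega),
      weight_succ _ (by omega), ih, digitBound, digitBound, if_pos (by omega), if_neg (by omega)]
    obtain ⟨k, rfl⟩ : ∃ j, k = j + 1 := ⟨k - 1, by omega⟩
    simp only [Nat.add_sub_cancel]
    ring

open RealRAM

/-! ### Names of arrays and variables -/

-- These are notations and not definitions so that `simp` can tell the arrays apart by evaluating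
-- numerals.
local notation "sizeArr" => 0
local notation "classArr" => 1
local notation "boundArr" => 2
local notation "outCenterArr" => 3
local notation "outOutlierArr" => 4
local notation "outAssignArr" => 5
local notation "covArr" => 6
local notation "asgArr" => 7
local notation "centerArr" => 8
local notation "rankArr" => 9
local notation "countArr" => 10
local notation "digitArr" => 11
local notation "radixArr" => 12
local notation "ptVar" => 13
local notation "levelVar" => 14
local notation "violVar" => 15
local notation "candVar" => 16
local notation "okVar" => 18
local notation "endVar" => 19
local notation "pointChoicesVar" => 20
local notation "radiusChoicesVar" => 21
local notation "posVar" => 22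
local notation "centerCountVar" => 23

local notation "epsVar" => 0
local notation "scaleVar" => 1
local notation "bestVar" => 2
local notation "costVar" => 3
local notation "hitVar" => 4
local notation "multArr" => 5
local notation "radVar" => 6
local notation "powVar" => 7

local notation:67 p:68 " ;; " q:67 => Program.seq p q

/-- Assignment to the scalar variable `v` of natural numbers. -/
abbrev assignNat (v : ℕ) (e : NatExpr) : Program := .setNat v (.const 0) e

/-- Assignment to the scalar variable `v` of real numbers. -/
abbrev assignReal (v : ℕ) (e : RealExpr) : Program := .setReal v (.const 0) e

/-- A conditional without alternative. -/
abbrev ifThen (b : Test) (p : Program) : Program := .cond b p .skip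

variable {D : Data} {s s' : State} {p : Program}

/-! ### Following the decisions -/

section Programs

/-- The number of points. -/
abbrev pointCount : NatExpr := .get sizeArr (.const 0)

/-- The number of centers. -/
abbrev centerCount : NatExpr := .get sizeArr (.const 1)

/-- The current point of a loop over the points. -/
abbrev point : NatExpr := .var ptVar

/-- Start with the partial clustering `Data.start`. -/
def resetProgram : Program :=
  .forLoop ptVar pointCount
    (.setNat covArr point (.const 0) ;; .setNat asgArr point point ;;
      .setNat centerArr point (.const 0)) ;;
  assignReal costVar (.ofNat (.const 0))

/-- Compute the rank of the current point if it is uncovered. -/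
def countProgram : Program :=
  ifThen (.natLe (.get covArr point) (.const 0))
    (.setNat rankArr point (.get countArr (.get classArr point)) ;;
      .setNat countArr (.get classArr point) (.add (.get rankArr point) (.const 1)) ;;
      ifThen (.natLe (.get boundArr (.get classArr point)) (.get rankArr point))
        (assignNat violVar (.add (.get classArr point) (.const 1))))

/-- Compute the ranks of the uncovered points and `Data.violatedClass`. -/
def scanProgram : Program :=
  .forLoop ptVar pointCount (.setNat countArr (.get classArr point) (.const 0)) ;;
  assignNat violVar (.const 0) ;;
  .forLoop ptVar pointCount countProgram

/-- Compute `Data.candidate`. -/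
def pickProgram : Program :=
  assignNat candVar (.const 0) ;;
  .forLoop ptVar pointCount
    (ifThen (.and (.natLe (.get covArr point) (.const 0))
        (.and (.natEq (.add (.get classArr point) (.const 1)) (.var violVar))
          (.natEq (.get rankArr point) (.get digitArr (.add (.var levelVar) (.var levelVar))))))
      (assignNat candVar point))

/-- Assign the current point to the new center if the new ball covers it. -/
def hitProgram : Program :=
  ifThen (.and (.natLe (.get covArr point) (.const 0))
      (.realLe (.table (.var candVar) point) (.var radVar)))
    (.setNat covArr point (.const 1) ;; .setNat asgArr point (.var candVar) ;;
      ifThen (.realLe (.var hitVar) (.table (.var candVar) point))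
        (assignReal hitVar (.table (.var candVar) point)))

/-- Change the partial clustering by `Data.addBall`. -/
def ballProgram : Program :=
  assignReal radVar (.mul (.var scaleVar)
    (.get multArr (.get digitArr (.add (.add (.var levelVar) (.var levelVar)) (.const 1))))) ;;
  assignReal hitVar (.ofNat (.const 0)) ;;
  .forLoop ptVar pointCount hitProgram ;;
  .setNat centerArr (.var candVar) (.const 1) ;;
  assignReal costVar (.add (.var costVar) (.var hitVar))

/-- Change the partial clustering by `Data.step`. -/
def stepProgram : Program :=
  scanProgram ;; .cond (.natLe (.var violVar) (.const 0)) .skip (pickProgram ;; ballProgram)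

/-- Compute the partial clustering `Data.run` and its violated class. -/
def followProgram : Program :=
  resetProgram ;; .forLoop levelVar centerCount stepProgram ;; scanProgram

/-- Copy the current partial clustering to the output. -/
def recordProgram : Program :=
  .forLoop ptVar pointCount
    (.setNat outCenterArr point (.get centerArr point) ;;
      .setNat outOutlierArr point (.sub (.const 1) (.get covArr point)) ;;
      .setNat outAssignArr point (.get asgArr point)) ;;
  assignReal bestVar (.var costVar)

/-- If the current partial clustering violates no class, report success, and record it if it is
better than the best solution so far. -/
def acceptProgram : Program :=
  ifThen (.natLe (.var violVar) (.const 0))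
    (assignNat okVar (.const 1) ;;
      ifThen (.realLt (.var costVar) (.var bestVar)) recordProgram)

/-- Follow the decisions in memory and use the result. -/
def tryProgram : Program := followProgram ;; acceptProgram

end Programs

/-- The memory holds the data `D`. -/
structure Env (D : Data) (s : State) : Prop where
  n_eq : s.nat sizeArr 0 = D.n
  k_eq : s.nat sizeArr 1 = D.k
  col_eq : s.nat classArr = D.col
  bnd_eq : s.nat boundArr = D.bnd

lemma Env.frame (h : Env D s) (hf : Frame p s s') (hsize : p.writesNat sizeArr = false := by rfl)
    (hclass : p.writesNat classArr = false := by rfl)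
    (hbound : p.writesNat boundArr = false := by rfl) : Env D s' where
  n_eq := by rw [hf.nat _ hsize, h.n_eq]
  k_eq := by rw [hf.nat _ hsize, h.k_eq]
  col_eq := by rw [hf.nat _ hclass, h.col_eq]
  bnd_eq := by rw [hf.nat _ hbound, h.bnd_eq]

/-- The arrays of the partial clustering vanish outside of the points. -/
structure Tail (D : Data) (s : State) : Prop where
  covered : ∀ q, D.n ≤ q → s.nat covArr q = 0
  assign : ∀ q, D.n ≤ q → s.nat asgArr q = 0
  isCenter : ∀ q, D.n ≤ q → s.nat centerArr q = 0

lemma Tail.frame (h : Tail D s) (hf : Frame p s s') (hcov : p.writesNat covArr = false := by rfl)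
    (hasg : p.writesNat asgArr = false := by rfl)
    (hcenter : p.writesNat centerArr = false := by rfl) : Tail D s' where
  covered := by rw [hf.nat _ hcov]; exact h.covered
  assign := by rw [hf.nat _ hasg]; exact h.assign
  isCenter := by rw [hf.nat _ hcenter]; exact h.isCenter

/-- The memory holds the partial clustering `C`. -/
structure Holds (s : State) (C : Cover) : Prop where
  covered : s.nat covArr = C.covered
  assign : s.nat asgArr = C.assign
  isCenter : s.nat centerArr = C.isCenter
  cost : s.real costVar 0 = C.cost

variable {C : Cover}

lemma Holds.frame (h : Holds s C) (hf : Frame p s s') (hcov : p.writesNat covArr = false := by rfl)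
    (hasg : p.writesNat asgArr = false := by rfl)
    (hcenter : p.writesNat centerArr = false := by rfl)
    (hcost : p.writesReal costVar = false := by rfl) : Holds s' C where
  covered := by rw [hf.nat _ hcov, h.covered]
  assign := by rw [hf.nat _ hasg, h.assign]
  isCenter := by rw [hf.nat _ hcenter, h.isCenter]
  cost := by rw [hf.real _ hcost, h.cost]

lemma Holds.tail {l : ℕ} {r : ℝ} (h : Holds s C) (hC : D.Sound C l r) : Tail D s where
  covered := h.covered ▸ hC.covered_tail
  assign := h.assign ▸ hC.assign_tail
  isCenter := h.isCenter ▸ hC.isCenter_tail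

lemma wp_resetProgram (hs : Env D s) (ht : Tail D s) :
    WP D.d resetProgram (D.n * 40 + 20) (Holds · D.start) s := by
  have hloop := WP.forFrame (T := D.d) (v := ptVar) (e := pointCount) (s := s) (τ := 20)
    (p := .setNat covArr point (.const 0) ;; .setNat asgArr point point ;;
      .setNat centerArr point (.const 0))
    (fun j s' => s'.nat covArr = (fun q => if q < j then 0 else s.nat covArr q) ∧
      s'.nat asgArr = (fun q => if q < j then q else s.nat asgArr q) ∧
      s'.nat centerArr = (fun q => if q < j then 0 else s.nat centerArr q))
    D.n (fun s' hf => (hs.frame hf).n_eq) rfl (by simp [State.storeNat_nat_ne])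
    fun j s' _ _ hpt ⟨hcov, hasg, hcenter⟩ => by
      refine WP.of_exec rfl (by decide) ?_
      simp only [Program.exec, NatExpr.eval, hpt, State.storeNat_nat_self, ne_eq,
        Nat.reduceEqDiff, not_false_eq_true, State.storeNat_nat_ne]
      rw [hcov, hasg, hcenter]
      exact ⟨update_ite_lt .., update_ite_lt (fun q => q) .., update_ite_lt ..⟩
  refine (hloop.seq fun s' ⟨⟨hcov, hasg, hcenter⟩, _⟩ =>
    WP.of_exec (τ := 5) rfl (by decide) ⟨?_, ?_, ?_, ?_⟩).mono (by simp only [NatExpr.steps]; omega)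
  · funext q
    simp only [Program.exec, State.storeReal_nat, hcov, Data.start]
    split_ifs with hq
    exacts [rfl, ht.covered q (not_lt.1 hq)]
  · funext q
    simp only [Program.exec, State.storeReal_nat, hasg, Data.start]
    split_ifs with hq
    exacts [rfl, ht.assign q (not_lt.1 hq)]
  · funext q
    simp only [Program.exec, State.storeReal_nat, hcenter, Data.start]
    split_ifs with hq
    exacts [rfl, ht.isCenter q (not_lt.1 hq)]
  · simp [Program.exec, RealExpr.eval, NatExpr.eval, Data.start]

/-- The number of uncovered points below `j` in the class `c`. -/
def Data.uncoveredCount (D : Data) (cov : ℕ → ℕ) (c j : ℕ) : ℕ :=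
  ((Finset.range j).filter (fun q => cov q = 0 ∧ D.col q = c)).card

lemma Data.uncoveredCount_succ (cov : ℕ → ℕ) (c j : ℕ) : D.uncoveredCount cov c (j + 1) =
    if cov j = 0 ∧ D.col j = c then D.uncoveredCount cov c j + 1 else D.uncoveredCount cov c j := by
  rw [uncoveredCount, Finset.range_add_one, Finset.filter_insert]
  split_ifs with h
  · rw [Finset.card_insert_of_notMem (by simp), uncoveredCount]
  · rfl

/-- The state of a scan of `C` before the point `j`. The counters of classes without points are
not initialised. -/
structure ScannedBelow (D : Data) (C : Cover) (j : ℕ) (s : State) : Prop where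
  count : ∀ q < D.n, s.nat countArr (D.col q) = D.uncoveredCount C.covered (D.col q) j
  rank : ∀ q < j, C.covered q = 0 → s.nat rankArr q = D.rank C.covered q
  violated : s.nat violVar 0 = D.excessClass C.covered j

lemma ScannedBelow.storeNat_ptVar {j : ℕ} (h : ScannedBelow D C j s) (i v : ℕ) :
    ScannedBelow D C j (s.storeNat ptVar i v) := by
  refine ⟨?_, ?_, ?_⟩ <;>
    simp only [ne_eq, Nat.reduceEqDiff, not_false_eq_true, State.storeNat_nat_ne]
  exacts [h.count, h.rank, h.violated]

lemma wp_countProgram {j : ℕ} (hs : Env D s) (hC : Holds s C) (hpt : s.nat ptVar 0 = j)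
    (hj : j < D.n) (h : ScannedBelow D C j s) :
    WP D.d countProgram 60 (ScannedBelow D C (j + 1)) s := by
  refine WP.of_exec rfl (by decide) ?_
  have hrank : s.nat countArr (D.col j) = D.rank C.covered j := h.count j hj
  simp only [countProgram, Program.exec, Test.Holds, NatExpr.eval, hpt, hC.covered, hs.col_eq,
    hs.bnd_eq, State.storeNat_nat_self, ne_eq, Nat.reduceEqDiff, not_false_eq_true,
    State.storeNat_nat_ne, Function.update_self, hrank, Nat.le_zero]
  by_cases hcov : C.covered j = 0
  · have hcount (q : ℕ) (hq : q < D.n) :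
        Function.update (s.nat countArr) (D.col j) (D.rank C.covered j + 1) (D.col q) =
          D.uncoveredCount C.covered (D.col q) (j + 1) := by
      rw [D.uncoveredCount_succ, Function.update_apply]
      by_cases hcol : D.col q = D.col j
      · rw [if_pos hcol, if_pos ⟨hcov, hcol.symm⟩, hcol, ← h.count j hj, hrank]
      · rw [if_neg hcol, if_neg fun h => hcol h.2.symm, h.count q hq]
    have hranks (q : ℕ) (hq : q < j + 1) (hcovq : C.covered q = 0) :
        Function.update (s.nat rankArr) j (D.rank C.covered j) q = D.rank C.covered q := by
      rcases Nat.lt_succ_iff_lt_or_eq.1 hq with hqj | rfl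
      · rw [Function.update_of_ne hqj.ne, h.rank q hqj hcovq]
      · rw [Function.update_self]
    rw [if_pos hcov]
    split_ifs with hbnd <;> refine ⟨?_, ?_, ?_⟩ <;>
      simp only [State.storeNat_nat_self, ne_eq, Nat.reduceEqDiff, not_false_eq_true,
        State.storeNat_nat_ne, Function.update_self]
    · exact hcount
    · exact hranks
    · rw [Data.excessClass, if_pos ⟨hcov, hbnd⟩]
    · exact hcount
    · exact hranks
    · rw [Data.excessClass, if_neg fun h => hbnd h.2, h.violated]
  · rw [if_neg hcov]
    refine ⟨fun q hq => ?_, fun q hq hcovq => h.rank q ?_ hcovq, ?_⟩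
    · rw [D.uncoveredCount_succ, if_neg fun h => hcov h.1, h.count q hq]
    · exact lt_of_le_of_ne (Nat.lt_succ_iff.1 hq) fun hqj => hcov (hqj ▸ hcovq)
    · rw [Data.excessClass, if_neg fun h => hcov h.1, h.violated]

/-- The memory holds the partial clustering `C`, the ranks of the uncovered points and the violated
class. -/
structure Scanned (D : Data) (s : State) (C : Cover) : Prop where
  holds : Holds s C
  rank : ∀ q < D.n, C.covered q = 0 → s.nat rankArr q = D.rank C.covered q
  violated : s.nat violVar 0 = D.violatedClass C

lemma wp_scanProgram (hs : Env D s) (hC : Holds s C) :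
    WP D.d scanProgram (D.n * 120 + 30) (Scanned D · C) s := by
  have hclear := WP.forFrame (T := D.d) (v := ptVar) (e := pointCount) (s := s) (τ := 10)
    (p := .setNat countArr (.get classArr point) (.const 0))
    (fun j s' => ∀ q < j, s'.nat countArr (D.col q) = 0) D.n (fun s' hf => (hs.frame hf).n_eq) rfl
    (fun q hq => absurd hq q.not_lt_zero) fun j s' _ hf hpt h => by
      refine WP.of_exec rfl (by decide) fun q hq => ?_
      simp only [Program.exec, NatExpr.eval, hpt, State.storeNat_nat_self, ne_eq, Nat.reduceEqDiff,
        not_false_eq_true, State.storeNat_nat_ne, (hs.frame hf).col_eq, Function.update_apply]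
      split_ifs with hcol
      · rfl
      · exact h q (lt_of_le_of_ne (Nat.lt_succ_iff.1 hq) fun hqj => hcol (hqj ▸ rfl))
  refine (hclear.seq fun s₁ ⟨hcount, hf₁⟩ => WP.seq (WP.of_exec (τ := 3) rfl (by decide)
    (Q := fun s' => s'.nat violVar 0 = 0) (by simp [Program.exec, NatExpr.eval])).frame
    fun s₂ ⟨hviol, hf₂⟩ => (WP.forFrame (τ := 60) (ScannedBelow D C) D.n ?_ rfl ?_ ?_).imp
    fun s₃ ⟨h, hf₃⟩ => ?_).mono (by simp only [NatExpr.steps]; omega)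
  · exact fun s' hf => (((hs.frame hf₁).frame hf₂).frame hf).n_eq
  · refine ScannedBelow.storeNat_ptVar ⟨fun q hq => ?_, by simp, hviol⟩ 0 0
    rw [hf₂.nat _ rfl, hcount q hq]
    simp [Data.uncoveredCount]
  · exact fun j s' hj hf hpt h => (wp_countProgram (((hs.frame hf₁).frame hf₂).frame hf)
      (((hC.frame hf₁).frame hf₂).frame hf) hpt hj h).imp fun s'' h' => h'.storeNat_ptVar 0 (j + 1)
  · exact ⟨((hC.frame hf₁).frame hf₂).frame hf₃, h.rank, h.violated⟩

lemma wp_pickProgram {l : ℕ} (hs : Env D s) (hC : Scanned D s C) (hl : s.nat levelVar 0 = l) :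
    WP D.d pickProgram (D.n * 80 + 30)
      (fun s' => s'.nat candVar 0 = D.candidate C (s.nat digitArr (l + l))) s := by
  refine (WP.seq (WP.of_exec (τ := 3) rfl (by decide)
    (Q := fun s' => s'.nat candVar 0 = 0) (by simp [Program.exec, NatExpr.eval])).frame
    fun s₁ ⟨hcand, hf₁⟩ => (WP.forFrame (τ := 60)
      (fun j s' => s'.nat candVar 0 = D.pick C.covered (D.violatedClass C)
        (s.nat digitArr (l + l)) j) D.n ?_ rfl ?_ ?_).imp fun s₂ h => h.1).mono
    (by simp only [NatExpr.steps]; omega)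
  · exact fun s' hf => ((hs.frame hf₁).frame hf).n_eq
  · simpa only [ne_eq, Nat.reduceEqDiff, not_false_eq_true, State.storeNat_nat_ne,
      Data.pick] using hcand
  · intro j s' hj hf hpt h
    refine WP.of_exec rfl (by decide) ?_
    have hnat (a : ℕ) (h₁ : (assignNat candVar (.const 0)).writesNat a = false)
        (h₂ : Program.writesNat a (.forLoop ptVar pointCount _) = false) : s'.nat a = s.nat a :=
      (hf.nat a h₂).trans (hf₁.nat a h₁)
    simp only [Program.exec, Test.Holds, NatExpr.eval, hpt, hnat covArr rfl rfl,
      hnat classArr rfl rfl, hnat rankArr rfl rfl, hnat digitArr rfl rfl, hnat levelVar rfl rfl,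
      hnat violVar rfl rfl, hC.holds.covered, hs.col_eq, hl, hC.violated, Nat.le_zero,
      ← Nat.le_antisymm_iff]
    rw [Data.pick]
    by_cases hcov : C.covered j = 0
    · rw [hC.rank j hj hcov]
      split_ifs
      · simp [State.storeNat_nat_ne]
      · simpa [State.storeNat_nat_ne] using h
    · rw [if_neg fun h => hcov h.1, if_neg fun h => hcov h.1]
      simpa [State.storeNat_nat_ne] using h

section Ball

variable {x : ℕ} {r : ℝ}

open Classical in
/-- The state of the addition of the ball of radius `r` around `x` to `C` before the point `j`. -/
structure HitBelow (D : Data) (C : Cover) (x : ℕ) (r : ℝ) (j : ℕ) (s : State) : Prop where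
  covered : s.nat covArr = fun q => if q < j ∧ D.Hit C.covered x r q then 1 else C.covered q
  assign : s.nat asgArr = fun q => if q < j ∧ D.Hit C.covered x r q then x else C.assign q
  hitRadius : s.real hitVar 0 = D.hitRadius C.covered x r j

lemma HitBelow.storeNat_ptVar {j : ℕ} (h : HitBelow D C x r j s) (i v : ℕ) :
    HitBelow D C x r j (s.storeNat ptVar i v) := by
  refine ⟨?_, ?_, ?_⟩ <;> simp only [ne_eq, Nat.reduceEqDiff, not_false_eq_true,
    State.storeNat_nat_ne, State.storeNat_real]
  exacts [h.covered, h.assign, h.hitRadius]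

open Classical in
lemma update_ite_lt_and {α : Type*} {P : ℕ → Prop} {j : ℕ} (hj : P j) (a : α) (g : ℕ → α) :
    Function.update (fun q => if q < j ∧ P q then a else g q) j a =
      fun q => if q < j + 1 ∧ P q then a else g q := by
  have h := update_ite_lt (fun q => if P q then a else g q) g j
  simpa only [hj, if_true, ite_and] using h

open Classical in
lemma wp_hitProgram {j : ℕ} (hpt : s.nat ptVar 0 = j) (hx : s.nat candVar 0 = x)
    (hr : s.real radVar 0 = r) (h : HitBelow D C x r j s) :
    WP D.d hitProgram 60 (HitBelow D C x r (j + 1)) s := by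
  refine WP.of_exec rfl (by decide) ?_
  have hcovj : s.nat covArr j = C.covered j := by simp [h.covered]
  simp only [hitProgram, Program.exec, Test.Holds, NatExpr.eval, RealExpr.eval, hpt, hx, hr, hcovj,
    Nat.le_zero, ne_eq, Nat.reduceEqDiff, not_false_eq_true, State.storeNat_nat_ne,
    State.storeNat_real, h.hitRadius]
  by_cases hhit : D.Hit C.covered x r j
  · have hcov : Function.update (s.nat covArr) j 1 = _ :=
      h.covered ▸ update_ite_lt_and hhit 1 C.covered
    have hasg : Function.update (s.nat asgArr) j x = _ :=
      h.assign ▸ update_ite_lt_and hhit x C.assign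
    rw [if_pos (c := C.covered j = 0 ∧ D.d x j ≤ r) hhit]
    split_ifs with hle <;> refine ⟨?_, ?_, ?_⟩ <;>
      simp only [ne_eq, Nat.reduceEqDiff, not_false_eq_true, State.storeNat_nat_ne,
        State.storeNat_nat_self, State.storeNat_real, State.storeReal_nat,
        State.storeReal_real_self, Function.update_self]
    · exact hcov
    · exact hasg
    · rw [Data.hitRadius, if_pos hhit, max_eq_right hle]
    · exact hcov
    · exact hasg
    · rw [Data.hitRadius, if_pos hhit, max_eq_left (not_le.1 hle).le, h.hitRadius]
  · have hlt (q : ℕ) :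
        (q < j + 1 ∧ D.Hit C.covered x r q) ↔ (q < j ∧ D.Hit C.covered x r q) := by
      refine and_congr_left fun hq => ⟨fun hlt => ?_, fun hlt => hlt.trans j.lt_succ_self⟩
      exact lt_of_le_of_ne (Nat.lt_succ_iff.1 hlt) fun hqj => hhit (hqj ▸ hq)
    rw [if_neg (c := C.covered j = 0 ∧ D.d x j ≤ r) hhit]
    refine ⟨?_, ?_, by rw [Data.hitRadius, if_neg hhit, h.hitRadius]⟩
    · simp only [hlt, h.covered]
    · simp only [hlt, h.assign]

lemma wp_ballProgram {l : ℕ} (hs : Env D s) (hC : Holds s C) (hl : s.nat levelVar 0 = l)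
    (hx : s.nat candVar 0 = x)
    (hr : s.real scaleVar 0 * s.real multArr (s.nat digitArr (l + l + 1)) = r) :
    WP D.d ballProgram (D.n * 80 + 60) (Holds · (D.addBall C x r)) s := by
  refine (WP.seq (WP.of_exec (τ := 15) rfl (by decide) (Q := fun s' => s'.real radVar 0 = r)
      (by simp [Program.exec, RealExpr.eval, NatExpr.eval, hl, hr])).frame fun s₁ ⟨hr₁, hf₁⟩ =>
    WP.seq (WP.of_exec (τ := 5) rfl (by decide) (Q := fun s' => s'.real hitVar 0 = 0)
      (by simp [Program.exec, RealExpr.eval, NatExpr.eval])).frame fun s₂ ⟨hhit, hf₂⟩ =>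
    WP.seq (WP.forFrame (τ := 60) (HitBelow D C x r) D.n ?_ rfl ?_ ?_) fun s₃ ⟨h, hf₃⟩ =>
    WP.of_exec (τ := 15) rfl (by decide) ?_).mono (by simp only [NatExpr.steps]; omega)
  · exact fun s' hf => (((hs.frame hf₁).frame hf₂).frame hf).n_eq
  · have hC₂ := (hC.frame hf₁).frame hf₂
    exact HitBelow.storeNat_ptVar ⟨by simp [hC₂.covered], by simp [hC₂.assign], hhit⟩ 0 0
  · intro j s' _ hf hpt h
    refine (wp_hitProgram hpt ?_ ?_ h).imp fun s'' h' => h'.storeNat_ptVar 0 (j + 1)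
    · rw [hf.nat _ rfl, hf₂.nat _ rfl, hf₁.nat _ rfl, hx]
    · rw [hf.real _ rfl, hf₂.real _ rfl, hr₁]
  · have hx₃ : s₃.nat candVar 0 = x := by rw [hf₃.nat _ rfl, hf₂.nat _ rfl, hf₁.nat _ rfl, hx]
    have hcenter : s₃.nat centerArr = C.isCenter := by
      rw [hf₃.nat _ rfl, hf₂.nat _ rfl, hf₁.nat _ rfl, hC.isCenter]
    have hcost : s₃.real costVar 0 = C.cost := by
      rw [hf₃.real _ rfl, hf₂.real _ rfl, hf₁.real _ rfl, hC.cost]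
    constructor <;> simp only [Program.exec, NatExpr.eval, RealExpr.eval, State.storeReal_nat,
      ne_eq, Nat.reduceEqDiff, not_false_eq_true, State.storeNat_nat_ne, State.storeNat_nat_self,
      State.storeReal_real_self, State.storeNat_real, Function.update_self, Data.addBall]
    · exact h.covered
    · exact h.assign
    · rw [hx₃, hcenter]
    · rw [hcost, h.hitRadius]

end Ball

lemma wp_stepProgram {l : ℕ} (hs : Env D s) (hC : Holds s C) (hl : s.nat levelVar 0 = l) :
    WP D.d stepProgram (D.n * 280 + 130) (Holds · (D.step C (s.nat digitArr (l + l))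
      (s.real scaleVar 0 * s.real multArr (s.nat digitArr (l + l + 1))))) s := by
  refine ((wp_scanProgram hs hC).frame.seq fun s₁ ⟨hscan, hf₁⟩ => WP.cond (τ := D.n * 160 + 90)
    (fun hb => WP.of_exec rfl (by simp [Program.maxSteps]) ?_) fun hb => ?_).mono
    (by simp only [Test.steps, NatExpr.steps]; omega)
  all_goals simp only [Test.Holds, NatExpr.eval, hscan.violated, Nat.le_zero] at hb
  · rw [Data.step, if_pos hb]
    exact hscan.holds
  · have hs₁ := hs.frame hf₁
    have hl₁ : s₁.nat levelVar 0 = l := by rw [hf₁.nat _ rfl, hl]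
    rw [Data.step, if_neg hb]
    refine ((wp_pickProgram hs₁ hscan hl₁).frame.seq fun s₂ ⟨hcand, hf₂⟩ => ?_).mono
      (by omega : D.n * 80 + 30 + (D.n * 80 + 60) ≤ _)
    refine wp_ballProgram (hs₁.frame hf₂) (hscan.holds.frame hf₂) (by rw [hf₂.nat _ rfl, hl₁])
      (by rw [hcand, hf₁.nat _ rfl]) ?_
    rw [hf₂.nat _ rfl, hf₂.real _ rfl, hf₂.real _ rfl, hf₁.nat _ rfl, hf₁.real _ rfl,
      hf₁.real _ rfl]

/-- The result of following the decisions in memory. -/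
abbrev outcome (D : Data) (s : State) : Cover :=
  D.run (fun g => s.real scaleVar 0 * s.real multArr g) (s.nat digitArr) D.k

lemma wp_followProgram (hs : Env D s) (ht : Tail D s) :
    WP D.d followProgram (D.k * (D.n * 280 + 143) + D.n * 160 + 70)
      (Scanned D · (outcome D s)) s := by
  refine ((wp_resetProgram hs ht).frame.seq fun s₁ ⟨hstart, hf₁⟩ => WP.seq
    (WP.forFrame (τ := D.n * 280 + 130) (fun j s' => Holds s'
      (D.run (fun g => s.real scaleVar 0 * s.real multArr g) (s.nat digitArr) j)) D.k ?_ rfl ?_ ?_)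
    fun s₂ ⟨h, hf₂⟩ => wp_scanProgram ((hs.frame hf₁).frame hf₂) h).mono
    (by simp only [NatExpr.steps, Nat.add_assoc, Nat.reduceAdd]; omega)
  · exact fun s' hf => ((hs.frame hf₁).frame hf).k_eq
  · exact hstart.frame (.storeNat (p := assignNat levelVar (.const 0)) s₁ levelVar 0 0 rfl)
  · intro j s' _ hf hlevel h
    refine (wp_stepProgram ((hs.frame hf₁).frame hf) h hlevel).imp fun s'' h' => ?_
    rw [hf.nat _ rfl, hf.real _ rfl, hf.real _ rfl, hf₁.nat _ rfl, hf₁.real _ rfl,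
      hf₁.real _ rfl] at h'
    exact h'.frame (.storeNat (p := assignNat levelVar (.const 0)) s'' levelVar 0 (j + 1) rfl)

/-! ### Using the outcome -/

/-- The output arrays and the best cost describe the partial clustering `C`, with the uncovered
points as outliers. -/
structure Recorded (D : Data) (C : Cover) (s : State) : Prop where
  isCenter : ∀ q < D.n, s.nat outCenterArr q = C.isCenter q
  covered : ∀ q < D.n, s.nat outOutlierArr q = 1 - C.covered q
  assign : ∀ q < D.n, s.nat outAssignArr q = C.assign q
  cost : s.real bestVar 0 = C.cost

lemma wp_recordProgram (hs : Env D s) (hC : Holds s C) :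
    WP D.d recordProgram (D.n * 50 + 20) (Recorded D C) s := by
  refine (WP.seq (WP.forFrame (e := pointCount) (τ := 30) (fun j s' =>
      s'.nat outCenterArr = (fun q => if q < j then C.isCenter q else s.nat outCenterArr q) ∧
      s'.nat outOutlierArr = (fun q => if q < j then 1 - C.covered q else s.nat outOutlierArr q) ∧
      s'.nat outAssignArr = (fun q => if q < j then C.assign q else s.nat outAssignArr q)) D.n
    (fun s' hf => (hs.frame hf).n_eq) rfl (by simp [State.storeNat_nat_ne]) ?_)
    fun s₁ ⟨⟨hcenter, hout, hasg⟩, hf₁⟩ => WP.of_exec (τ := 5) rfl (by decide)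
      ⟨fun q hq => ?_, fun q hq => ?_, fun q hq => ?_, ?_⟩).mono
    (by simp only [NatExpr.steps]; omega)
  · intro j s' _ hf hpt ⟨hcenter, hout, hasg⟩
    refine WP.of_exec rfl (by decide) ?_
    have hC' := hC.frame hf
    simp only [Program.exec, NatExpr.eval, hpt, ne_eq, Nat.reduceEqDiff, not_false_eq_true,
      State.storeNat_nat_ne, State.storeNat_nat_self, hC'.covered, hC'.assign, hC'.isCenter]
    rw [hcenter, hout, hasg]
    exact ⟨update_ite_lt .., update_ite_lt (fun q => 1 - C.covered q) .., update_ite_lt ..⟩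
  · simp only [Program.exec, State.storeReal_nat, hcenter, if_pos hq]
  · simp only [Program.exec, State.storeReal_nat, hout, if_pos hq]
  · simp only [Program.exec, State.storeReal_nat, hasg, if_pos hq]
  · simp [Program.exec, RealExpr.eval, NatExpr.eval, (hC.frame hf₁).cost]

/-- The output arrays hold a solution with at most `k` centers, whose cost is bounded by the best
cost. -/
structure Solved (D : Data) (s : State) : Prop where
  card_centers_le : ((Finset.range D.n).filter (fun q => s.nat outCenterArr q = 1)).card ≤ D.k
  card_outliers_le : ∀ c, ((Finset.range D.n).filter
    (fun q => s.nat outOutlierArr q = 1 ∧ D.col q = c)).card ≤ D.bnd c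
  assign_outlier : ∀ q < D.n, s.nat outOutlierArr q = 1 → s.nat outAssignArr q = q
  assign_center : ∀ q < D.n, s.nat outOutlierArr q ≠ 1 →
    s.nat outAssignArr q < D.n ∧ s.nat outCenterArr (s.nat outAssignArr q) = 1
  boundsRadii : ∃ ρ : ℕ → ℝ, (∀ c, 0 ≤ ρ c) ∧
    (∀ q < D.n, s.nat outOutlierArr q ≠ 1 → D.d (s.nat outAssignArr q) q ≤
      ρ (s.nat outAssignArr q)) ∧
    ∑ c ∈ Finset.range D.n, ρ c ≤ s.real bestVar 0
  hasScale : ∃ x < D.n, ∃ y < D.n, D.d x y ≤ s.real bestVar 0 ∧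
    s.real bestVar 0 ≤ D.k * D.d x y

lemma Solved.congr (h : Solved D s) (hcenter : s'.nat outCenterArr = s.nat outCenterArr)
    (hout : s'.nat outOutlierArr = s.nat outOutlierArr)
    (hasg : s'.nat outAssignArr = s.nat outAssignArr)
    (hbest : s'.real bestVar = s.real bestVar) : Solved D s' := by
  constructor
  · rw [hcenter]; exact h.card_centers_le
  · rw [hout]; exact h.card_outliers_le
  · rw [hout, hasg]; exact h.assign_outlier
  · rw [hcenter, hout, hasg]; exact h.assign_center
  · rw [hbest, hout, hasg]; exact h.boundsRadii
  · rw [hbest]; exact h.hasScale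

lemma Solved.frame (h : Solved D s) (hf : Frame p s s')
    (hcenter : p.writesNat outCenterArr = false := by rfl)
    (hout : p.writesNat outOutlierArr = false := by rfl)
    (hasg : p.writesNat outAssignArr = false := by rfl)
    (hbest : p.writesReal bestVar = false := by rfl) : Solved D s' :=
  h.congr (hf.nat _ hcenter) (hf.nat _ hout) (hf.nat _ hasg) (hf.real _ hbest)

lemma Recorded.solved {r : ℝ} (h : Recorded D C s) (hC : D.Sound C D.k r)
    (hv : D.violatedClass C = 0) : Solved D s := by
  have hcov (q : ℕ) (hq : q < D.n) (hout : s.nat outOutlierArr q ≠ 1) : C.covered q = 1 := by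
    have := hC.covered_le q
    have := h.covered q hq
    omega
  have huncov (q : ℕ) (hq : q < D.n) (hout : s.nat outOutlierArr q = 1) : C.covered q = 0 := by
    have := h.covered q hq
    omega
  constructor
  · refine le_of_eq_of_le (congrArg _ (Finset.filter_congr fun q hq => ?_)) hC.card_centers_le
    rw [h.isCenter q (Finset.mem_range.1 hq)]
  · refine fun c => (Finset.card_le_card fun q hq => ?_).trans
      (Data.card_uncovered_le (Data.excessClass_eq_zero_iff.1 hv) c)
    simp only [Finset.mem_filter, Finset.mem_range] at hq ⊢
    exact ⟨hq.1, huncov q hq.1 hq.2.1, hq.2.2⟩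
  · intro q hq hout
    rw [h.assign q hq, hC.assign_uncovered q hq (huncov q hq hout)]
  · intro q hq hout
    obtain ⟨hlt, hcenter, -⟩ := hC.assign_covered q hq (hcov q hq hout)
    rw [h.assign q hq, h.isCenter _ hlt]
    exact ⟨hlt, hcenter⟩
  · obtain ⟨ρ, hρ0, hρ, hsum⟩ := hC.boundsRadii
    refine ⟨ρ, hρ0, fun q hq hout => ?_, hsum.trans h.cost.ge⟩
    rw [h.assign q hq]
    exact hρ q hq (hcov q hq hout)
  · rw [h.cost]
    exact hC.hasScale

/-- The effect, from `s` to `s'`, of a successful or failing attempt that ends with `C`. -/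
structure Tried (D : Data) (C : Cover) (s s' : State) : Prop where
  tail : Tail D s'
  solved : Solved D s'
  best_le : s'.real bestVar 0 ≤ s.real bestVar 0
  of_not_violated : D.violatedClass C = 0 →
    s'.nat okVar 0 = 1 ∧ s'.real bestVar 0 ≤ C.cost
  of_violated : D.violatedClass C ≠ 0 → s'.nat okVar 0 = s.nat okVar 0

lemma wp_acceptProgram {r : ℝ} (hs : Env D s) (hS : Solved D s) (hC : Scanned D s C)
    (hr : D.Sound C D.k r) : WP D.d acceptProgram (D.n * 50 + 60) (Tried D C s) s := by
  refine (WP.cond (τ := D.n * 50 + 40) (fun hb => ?_) fun hb =>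
    WP.of_exec rfl (by simp [Program.maxSteps]) ?_).mono
    (by simp only [Test.steps, NatExpr.steps]; omega)
  all_goals simp only [Test.Holds, NatExpr.eval, hC.violated, Nat.le_zero] at hb
  · refine ((WP.of_exec (τ := 3) rfl (by decide) (Q := fun s' => s'.nat okVar 0 = 1)
      (by simp [Program.exec, NatExpr.eval])).frame.seq fun s₁ ⟨hok, hf₁⟩ => WP.cond
        (τ := D.n * 50 + 20) (fun hlt => ?_) fun hle => WP.of_exec rfl
        (by simp [Program.maxSteps]) ?_).mono
      (by simp only [Test.steps, RealExpr.steps, NatExpr.steps]; omega)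
    all_goals
      have hC₁ := hC.holds.frame hf₁
      have hbest₁ : s₁.real bestVar = s.real bestVar := hf₁.real _ rfl
    · simp only [Test.Holds, RealExpr.eval, NatExpr.eval, hbest₁, hC₁.cost, not_le] at hlt
      refine (wp_recordProgram (hs.frame hf₁) hC₁).frame.imp fun s₂ ⟨hrec, hf₂⟩ =>
        ⟨(hC₁.frame hf₂).tail hr, hrec.solved hr hb, hrec.cost.trans_le hlt.le,
          fun _ => ⟨?_, hrec.cost.le⟩, fun h => absurd hb h⟩
      rw [hf₂.nat _ rfl, hok]
    · simp only [Test.Holds, RealExpr.eval, NatExpr.eval, hbest₁, hC₁.cost, not_not] at hle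
      exact ⟨hC₁.tail hr, hS.frame hf₁, (congrFun hbest₁ 0).le,
        fun _ => ⟨hok, (congrFun hbest₁ 0).trans_le hle⟩, fun h => absurd hb h⟩
  · exact ⟨hC.holds.tail hr, hS, le_rfl, fun h => absurd h hb, fun _ => rfl⟩

lemma wp_tryProgram {r : ℝ} (hD : D.Valid) (hs : Env D s) (ht : Tail D s) (hS : Solved D s)
    (hr : D.Sound (outcome D s) D.k r) :
    WP D.d tryProgram (D.n * D.k * 900) (Tried D (outcome D s) s) s := by
  have htime : D.k * (D.n * 280 + 143) + D.n * 160 + 70 + (D.n * 50 + 60) ≤ D.n * D.k * 900 := by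
    nlinarith only [Nat.mul_le_mul hD.n_pos hD.one_le_k, Nat.le_mul_of_pos_right D.n hD.one_le_k,
      Nat.le_mul_of_pos_left D.k hD.n_pos]
  refine ((wp_followProgram hs ht).frame.seq fun s₁ ⟨hscan, hf₁⟩ =>
    (wp_acceptProgram (hs.frame hf₁) (hS.frame hf₁) hscan hr).imp fun s₂ h => ?_).mono htime
  refine ⟨h.tail, h.solved, ?_, h.of_not_violated, fun hv => ?_⟩
  · rw [← hf₁.real bestVar rfl]
    exact h.best_le
  · rw [h.of_violated hv, hf₁.nat _ rfl]

/-! ### Enumerating the decisions -/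

open MixedRadix

section Programs

/-- The number of decisions. -/
abbrev decisionCount : NatExpr := .add centerCount centerCount

/-- The current position of a loop over the decisions. -/
abbrev position : NatExpr := .var posVar

/-- Replace the maximal digits below the first digit that is not maximal by `0`. -/
def carryProgram : Program :=
  assignNat posVar (.const 1) ;;
  .loop (.and (.natLt position decisionCount)
      (.natLe (.get radixArr position) (.add (.get digitArr position) (.const 1))))
    (.setNat digitArr position (.const 0) ;; assignNat posVar (.add position (.const 1)))

/-- Pass to the next sequence of decisions with the same first one, or report the end. -/
def incrementProgram : Program :=
  carryProgram ;;
  .cond (.natLe decisionCount position) (assignNat endVar (.const 1))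
    (.setNat digitArr position (.add (.get digitArr position) (.const 1)))

/-- Try all sequences of decisions with the first one prescribed. -/
def searchProgram : Program :=
  (assignNat okVar (.const 0) ;; assignNat endVar (.const 0)) ;;
  .loop (.natLe (.var endVar) (.const 0)) (tryProgram ;; incrementProgram)

end Programs

variable {B : ℕ → ℕ}

/-- The maximal digits of `δ` below `i` have been replaced by `0`. -/
structure Carried (B δ : ℕ → ℕ) (K i : ℕ) (s : State) : Prop where
  position_eq : s.nat posVar 0 = i
  one_le : 1 ≤ i
  le_top : i ≤ K
  digit_eq : ∀ j, s.nat digitArr j = if 1 ≤ j ∧ j < i then 0 else δ j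
  maximal : ∀ j, 1 ≤ j → j < i → δ j + 1 = B j

lemma wp_carryProgram (hD : D.Valid) (hs : Env D s)
    (hB : ∀ i, 1 ≤ i → i < D.k + D.k → s.nat radixArr i = B i)
    (hδ : IsDigits B (s.nat digitArr) (D.k + D.k)) :
    WP D.d carryProgram (D.k * 100 + 30) (fun s' => ∃ i,
      Carried B (s.nat digitArr) (D.k + D.k) i s' ∧
        (i < D.k + D.k → s.nat digitArr i + 1 < B i)) s := by
  have hk := hD.one_le_k
  refine ((WP.of_exec (τ := 3) rfl (by decide) (Q := fun s' => s'.nat posVar 0 = 1)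
    (by simp [Program.exec, NatExpr.eval])).frame.seq fun s₁ ⟨hpos, hf₁⟩ => (WP.loopFrame
      (τ := 20) (fun j => Carried B (s.nat digitArr) (D.k + D.k) (j + 1)) (D.k + D.k)
      ⟨hpos, le_rfl, by omega, fun i => ?_, fun i h h' => by omega⟩ ?_ ?_).imp
      fun s₂ ⟨j, h, hb, hf⟩ => ⟨j + 1, h, fun hj => ?_⟩).mono
      (by simp only [Test.steps, NatExpr.steps]; omega)
  · rw [hf₁.nat digitArr rfl, if_neg (by omega)]
  · intro j s' _ h _
    have := h.le_top
    omega
  · intro j s' hf h hb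
    refine WP.of_exec rfl (by decide) ?_
    simp only [Test.Holds, NatExpr.eval, h.position_eq, ((hs.frame hf₁).frame hf).k_eq,
      hf.nat radixArr rfl, hf₁.nat radixArr rfl, h.digit_eq (j + 1)] at hb
    rw [if_neg (by omega), hB _ (by omega) (by omega)] at hb
    have hlt := hδ (j + 1) (by omega) (by omega)
    simp only [Program.exec, NatExpr.eval, h.position_eq]
    refine ⟨by simp [State.storeNat_nat_ne, h.position_eq], by omega, by omega, fun i => ?_,
      fun i hi hi' => ?_⟩
    · simp only [ne_eq, Nat.reduceEqDiff, not_false_eq_true, State.storeNat_nat_ne,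
        State.storeNat_nat_self, Function.update_apply, h.digit_eq]
      split_ifs <;> first | rfl | omega
    · rcases Nat.lt_succ_iff_lt_or_eq.1 hi' with hij | rfl
      · exact h.maximal i hi hij
      · omega
  · simp only [Test.Holds, NatExpr.eval, h.position_eq, ((hs.frame hf₁).frame hf).k_eq,
      hf.nat radixArr rfl, hf₁.nat radixArr rfl, h.digit_eq (j + 1)] at hb
    rw [if_neg (by omega), hB _ (by omega) hj] at hb
    omega

/-- The effect, from `s` to `s'`, of passing to the next sequence of decisions. -/
structure Incremented (B : ℕ → ℕ) (K : ℕ) (s s' : State) : Prop where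
  first_eq : s'.nat digitArr 0 = s.nat digitArr 0
  next_or_end : (s'.nat endVar 0 = s.nat endVar 0 ∧ IsDigits B (s'.nat digitArr) K ∧
      value B (s'.nat digitArr) K = value B (s.nat digitArr) K + 1) ∨
    (s'.nat endVar 0 = 1 ∧ (∀ i, 1 ≤ i → i < K → s'.nat digitArr i = 0) ∧
      value B (s.nat digitArr) K + 1 = weight B K)

lemma wp_incrementProgram (hD : D.Valid) (hs : Env D s)
    (hB : ∀ i, 1 ≤ i → i < D.k + D.k → s.nat radixArr i = B i)
    (hδ : IsDigits B (s.nat digitArr) (D.k + D.k)) :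
    WP D.d incrementProgram (D.k * 200) (Incremented B (D.k + D.k) s) s := by
  have hk := hD.one_le_k
  refine ((wp_carryProgram hD hs hB hδ).frame.seq fun s₁ ⟨⟨i, h, hi⟩, hf⟩ => WP.cond (τ := 10)
    (fun hb => WP.of_exec rfl (by decide) ?_) fun hb => WP.of_exec rfl (by decide) ?_).mono
    (by simp only [Test.steps, NatExpr.steps]; omega)
  all_goals
    simp only [Test.Holds, NatExpr.eval, h.position_eq, (hs.frame hf).k_eq] at hb
    have hone := h.one_le
    simp only [Program.exec, NatExpr.eval, h.position_eq]
  · obtain rfl : i = D.k + D.k := h.le_top.antisymm hb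
    refine ⟨?_, .inr ⟨by simp, fun j hj hj' => ?_, value_of_maximal hone h.maximal⟩⟩
    · rw [State.storeNat_nat_ne _ _ _ _ (by decide), h.digit_eq, if_neg (by omega)]
    · rw [State.storeNat_nat_ne _ _ _ _ (by decide), h.digit_eq, if_pos ⟨hj, hj'⟩]
  · have hdigit (j : ℕ) : (s₁.storeNat digitArr i (s₁.nat digitArr i + 1)).nat digitArr j =
        if j = i then s.nat digitArr i + 1 else if 1 ≤ j ∧ j < i then 0 else s.nat digitArr j := by
      rw [State.storeNat_nat_self, Function.update_apply, h.digit_eq i, h.digit_eq j,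
        if_neg (by omega : ¬ (1 ≤ i ∧ i < i))]
    refine ⟨?_, .inl ⟨?_, fun j hj hj' => ?_, value_increment (i := i) hone (by omega) h.maximal
      (fun j hj hj' => ?_) ?_ fun j hj => ?_⟩⟩
    · rw [hdigit, if_neg (by omega), if_neg (by omega)]
    · rw [State.storeNat_nat_ne _ _ _ _ (by decide), hf.nat endVar rfl]
    · rw [hdigit]
      split_ifs with hji
      · exact hji ▸ hi (by omega)
      · exact (Nat.zero_le _).trans_lt (hδ j hj hj')
      · exact hδ j hj hj'
    · rw [hdigit, if_neg (by omega), if_pos ⟨hj, hj'⟩]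
    · rw [hdigit, if_pos rfl]
    · rw [hdigit, if_neg (by omega), if_neg (by omega)]

/-! ### Searching -/

/-- The sequences of decisions that start with `a` and whose other digits represent a number below
`v`. -/
def decisionsBelow (B : ℕ → ℕ) (K a v : ℕ) : Set (ℕ → ℕ) :=
  {δ | δ 0 = a ∧ IsDigits B δ K ∧ value B δ K < v}

/-- The effect, from `s` to `s'`, of trying the sequences of decisions in `Δ` in a search with the
radii `rad`, where `r` bounds these radii. -/
structure Explored (D : Data) (rad : ℕ → ℝ) (r : ℝ) (Δ : Set (ℕ → ℕ)) (s s' : State) : Prop where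
  tail : Tail D s'
  solved : Solved D s'
  best_le : s'.real bestVar 0 ≤ s.real bestVar 0
  success : s'.nat okVar 0 = 1 → ∃ C, D.Sound C D.k r ∧ D.violatedClass C = 0 ∧
    s'.real bestVar 0 ≤ C.cost
  complete : ∀ δ ∈ Δ, D.violatedClass (D.run rad δ D.k) = 0 →
    s'.nat okVar 0 = 1 ∧ s'.real bestVar 0 ≤ (D.run rad δ D.k).cost

variable {rad : ℕ → ℝ} {r : ℝ} {Δ Δ' : Set (ℕ → ℕ)} {s₁ s₂ : State} {a v : ℕ}

lemma Explored.insert {δ : ℕ → ℕ} (h : Explored D rad r Δ s s₁)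
    (ht : Tried D (D.run rad δ D.k) s₁ s₂) (hC : D.Sound (D.run rad δ D.k) D.k r)
    (hΔ : ∀ δ' ∈ Δ', δ' ∈ Δ ∨ D.run rad δ' D.k = D.run rad δ D.k) :
    Explored D rad r Δ' s s₂ := by
  refine ⟨ht.tail, ht.solved, ht.best_le.trans h.best_le, fun hok => ?_, fun δ' hδ' hv' => ?_⟩
  · by_cases hv : D.violatedClass (D.run rad δ D.k) = 0
    · exact ⟨_, hC, hv, (ht.of_not_violated hv).2⟩
    · obtain ⟨C, hC, hCv, hle⟩ := h.success (by rw [← ht.of_violated hv, hok])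
      exact ⟨C, hC, hCv, ht.best_le.trans hle⟩
  · rcases hΔ δ' hδ' with hmem | heq
    · obtain ⟨hok, hle⟩ := h.complete δ' hmem hv'
      refine ⟨?_, ht.best_le.trans hle⟩
      by_cases hv : D.violatedClass (D.run rad δ D.k) = 0
      · exact (ht.of_not_violated hv).1
      · rw [ht.of_violated hv, hok]
    · rw [heq] at hv' ⊢
      exact ht.of_not_violated hv'

lemma Explored.frame_increment (h : Explored D rad r Δ s s₁)
    (hf : Frame incrementProgram s₁ s₂) : Explored D rad r Δ s s₂ where
  tail := h.tail.frame hf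
  solved := h.solved.frame hf
  best_le := by rw [hf.real bestVar rfl]; exact h.best_le
  success := by rw [hf.real bestVar rfl, hf.nat okVar rfl]; exact h.success
  complete := by rw [hf.real bestVar rfl, hf.nat okVar rfl]; exact h.complete

/-- The state `s'`, with number `v`, of a search from `s`. -/
structure Searching (D : Data) (B : ℕ → ℕ) (rad : ℕ → ℝ) (r : ℝ) (a : ℕ) (s : State) (v : ℕ)
    (s' : State) : Prop where
  explored : Explored D rad r (decisionsBelow B (D.k + D.k) a v) s s'
  first_eq : s'.nat digitArr 0 = a
  next_or_end : (s'.nat endVar 0 = 0 ∧ IsDigits B (s'.nat digitArr) (D.k + D.k) ∧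
      value B (s'.nat digitArr) (D.k + D.k) = v) ∨
    (s'.nat endVar 0 = 1 ∧ (∀ i, 1 ≤ i → i < D.k + D.k → s'.nat digitArr i = 0) ∧
      v = weight B (D.k + D.k))

lemma Searching.wp_step (hD : D.Valid) (hs : Env D s') (hout : outcome D s' =
      D.run rad (s'.nat digitArr) D.k) (hB : ∀ i, 1 ≤ i → i < D.k + D.k → s'.nat radixArr i = B i)
    (hsound : ∀ δ, IsDigits B δ (D.k + D.k) → D.Sound (D.run rad δ D.k) D.k r)
    (h : Searching D B rad r a s v s') (hend : s'.nat endVar 0 = 0) :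
    WP D.d (tryProgram ;; incrementProgram) (D.n * D.k * 900 + D.k * 200)
      (Searching D B rad r a s (v + 1)) s' := by
  obtain ⟨-, hdigits, hvalue⟩ := h.next_or_end.resolve_right fun h => by omega
  have hone : 1 ≤ D.k + D.k := le_add_right hD.one_le_k
  have hsound' := hsound _ hdigits
  refine (wp_tryProgram hD hs h.explored.tail h.explored.solved (hout ▸ hsound')).frame.seq
    fun s₁ ⟨htried, hf₁⟩ => ((wp_incrementProgram (B := B) hD (hs.frame hf₁) ?_ ?_).frame.imp
      fun s₂ ⟨hinc, hf₂⟩ => ⟨?_, ?_, ?_⟩)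
  · rwa [hf₁.nat radixArr rfl]
  · rwa [hf₁.nat digitArr rfl]
  · refine .frame_increment (.insert h.explored (hout ▸ htried) hsound' fun δ ⟨h0, hδ, hlt⟩ => ?_)
      hf₂
    rcases Nat.lt_succ_iff_lt_or_eq.1 hlt with hlt | heq
    · exact .inl ⟨h0, hδ, hlt⟩
    · refine .inr (Data.run_congr fun i hi => ?_)
      rcases Nat.eq_zero_or_pos i with rfl | hi0
      · rw [h0, h.first_eq]
      · exact value_injOn hone hδ hdigits (heq.trans hvalue.symm) i hi0 hi
  · rw [hinc.first_eq, hf₁.nat digitArr rfl, h.first_eq]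
  · have hnext := hinc.next_or_end
    rw [hf₁.nat endVar rfl, hf₁.nat digitArr rfl, hend, hvalue] at hnext
    exact hnext

/-- The memory is prepared for a search with `M` possible centers and `G` possible radii for each
ball. -/
structure Ready (D : Data) (M G : ℕ) (s : State) : Prop where
  env : Env D s
  tail : Tail D s
  solved : Solved D s
  radix_eq : ∀ i, 1 ≤ i → i < D.k + D.k → s.nat radixArr i = digitBound M G i
  digit_eq_zero : ∀ i, 1 ≤ i → i < D.k + D.k → s.nat digitArr i = 0
  mult_eq : ∀ g < G, s.real multArr g = 2 * (2 / 7) ^ g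
  scale_nonneg : 0 ≤ s.real scaleVar 0

lemma Ready.radius_eq {M G : ℕ} (hs : Ready D M G s) (g : ℕ) (hg : g < G) :
    s.real scaleVar 0 * s.real multArr g = 2 * (s.real scaleVar 0 * (2 / 7) ^ g) := by
  rw [hs.mult_eq g hg]
  ring

/-- The number of sequences of decisions with the first one prescribed. -/
abbrev searchSize (D : Data) (M G : ℕ) : ℕ := M ^ (D.k - 1) * G ^ D.k

/-- The number of steps of a search. -/
abbrev searchTime (D : Data) (M G : ℕ) : ℕ := searchSize D M G * (D.n * D.k * 1110) + 20

/-- The effect, from `s` to `s'`, of a search with first decision `a` and radii up to `2 * R`. -/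
structure Searched (D : Data) (M G : ℕ) (a : ℕ) (R : ℝ) (s s' : State) : Prop where
  ready : Ready D M G s'
  scale_eq : s'.real scaleVar 0 = R
  first_eq : s'.nat digitArr 0 = a
  best_le : s'.real bestVar 0 ≤ s.real bestVar 0
  success : s'.nat okVar 0 = 1 → ∃ C, D.Sound C D.k (2 * R) ∧ D.violatedClass C = 0 ∧
    s'.real bestVar 0 ≤ C.cost
  complete : ∀ S : Clustering D, (∀ c ∈ S.centers, S.radius c ≤ R) →
    (D.violatedClass D.start ≠ 0 → D.candidate D.start a ∉ S.outliers) →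
    s'.nat okVar 0 = 1 ∧
      s'.real bestVar 0 ≤ 7 * S.cost + D.k * (2 * (R * (2 / 7) ^ (G - 1)))

lemma Data.sound_run (hD : D.Valid) {M G : ℕ} {R : ℝ} (hR : 0 ≤ R)
    (hrad : ∀ g < G, rad g = 2 * (R * (2 / 7) ^ g)) {δ : ℕ → ℕ}
    (hδ : IsDigits (digitBound M G) δ (D.k + D.k)) :
    D.Sound (D.run rad δ D.k) D.k (2 * R) := by
  refine .run hD (by positivity) fun i hi => ?_
  have hg := hδ (i + i + 1) (by omega) (by omega)
  rw [digitBound, if_neg (by omega)] at hg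
  have hpow : (2 / 7 : ℝ) ^ δ (i + i + 1) ≤ 1 := pow_le_one₀ (by norm_num) (by norm_num)
  rw [hrad _ hg]
  exact ⟨by positivity, by nlinarith⟩

lemma Ready.searching {M G : ℕ} (hs : Ready D M G s) (hM : 0 < M) (hG : 0 < G)
    (hf : Frame (assignNat okVar (.const 0) ;; assignNat endVar (.const 0)) s s')
    (hok : s'.nat okVar 0 = 0) (hend : s'.nat endVar 0 = 0) :
    Searching D (digitBound M G) rad r (s.nat digitArr 0) s 0 s' := by
  have hdigit : s'.nat digitArr = s.nat digitArr := hf.nat _ rfl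
  refine ⟨⟨hs.tail.frame hf, hs.solved.frame hf, (congrFun (hf.real bestVar rfl) 0).le,
    fun h => by omega, fun δ hδ => absurd hδ.2.2 (Nat.not_lt_zero _)⟩, by rw [hdigit],
    .inl ⟨hend, fun i hi hi' => ?_, Finset.sum_eq_zero fun i hi => ?_⟩⟩
  · rw [hdigit, hs.digit_eq_zero i hi hi', digitBound]
    split_ifs <;> assumption
  · rw [Finset.mem_Ico] at hi
    rw [hdigit, hs.digit_eq_zero i hi.1 hi.2, zero_mul]

lemma Searching.searched {M G : ℕ} (h : Searching D (digitBound M G)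
      (fun g => s.real scaleVar 0 * s.real multArr g) (2 * s.real scaleVar 0) a s v s')
    (hD : D.Valid) (hs : Ready D M G s) (hG : 0 < G) (hM : ∀ p < D.n, D.bnd (D.col p) < M)
    (hf : Frame searchProgram s s') (hend : s'.nat endVar 0 ≠ 0) :
    Searched D M G a (s.real scaleVar 0) s s' := by
  obtain ⟨-, hzero, rfl⟩ := h.next_or_end.resolve_left fun h => hend h.1
  have hscale : s'.real scaleVar = s.real scaleVar := hf.real _ rfl
  refine ⟨⟨hs.env.frame hf, h.explored.tail, h.explored.solved, ?_, hzero, ?_, ?_⟩,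
    congrFun hscale 0, h.first_eq, h.explored.best_le, h.explored.success, fun S hS ha => ?_⟩
  · rw [hf.nat radixArr rfl]
    exact hs.radix_eq
  · rw [hf.real multArr rfl]
    exact hs.mult_eq
  · rw [hscale]
    exact hs.scale_nonneg
  · obtain ⟨δ, h0, hδ, hv, hcost⟩ := Data.exists_run hD S hs.scale_nonneg hS hG hM hs.radius_eq ha
    have hdigits : IsDigits (digitBound M G) δ (D.k + D.k) := fun i hi _ => hδ i hi
    obtain ⟨hok, hle⟩ := h.explored.complete δ
      ⟨h0, hdigits, value_lt_weight (le_add_right hD.one_le_k) hdigits⟩ hv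
    exact ⟨hok, hle.trans hcost⟩

lemma wp_searchProgram {M G : ℕ} (hD : D.Valid) (hs : Ready D M G s) (hG : 0 < G)
    (hM : ∀ p < D.n, D.bnd (D.col p) < M) :
    WP D.d searchProgram (searchTime D M G)
      (Searched D M G (s.nat digitArr 0) (s.real scaleVar 0) s) s := by
  have hM0 : 0 < M := (Nat.zero_le _).trans_lt (hM 0 hD.n_pos)
  suffices h : WP D.d searchProgram (searchTime D M G) (fun s' => ∃ v,
      Searching D (digitBound M G) (fun g => s.real scaleVar 0 * s.real multArr g)
        (2 * s.real scaleVar 0) (s.nat digitArr 0) s v s' ∧ s'.nat endVar 0 ≠ 0) s from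
    h.frame.imp fun s' ⟨⟨v, h, hend⟩, hf⟩ => h.searched hD hs hG hM hf hend
  refine ((WP.of_exec (τ := 10) rfl (by decide) (Q := fun s' => s'.nat okVar 0 = 0 ∧
    s'.nat endVar 0 = 0) (by simp [Program.exec, NatExpr.eval, State.storeNat_nat_ne])).frame.seq
    fun s₁ ⟨⟨hok, hend⟩, hf₁⟩ => (WP.loopFrame (τ := D.n * D.k * 900 + D.k * 200) _
      (searchSize D M G) (hs.searching hM0 hG hf₁ hok hend) ?_ ?_).imp
        fun s₂ ⟨v, h, hb, _⟩ => ⟨v, h, fun h0 => hb (Nat.le_zero.2 h0)⟩).mono ?_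
  · intro v s' _ h hb
    simp only [Test.Holds, NatExpr.eval, Nat.le_zero] at hb
    obtain ⟨-, hdigits, rfl⟩ := h.next_or_end.resolve_right fun h => by omega
    exact (value_lt_weight (le_add_right hD.one_le_k) hdigits).trans_eq
      (weight_digitBound M G hD.one_le_k)
  · intro v s' hf h hb
    refine h.wp_step hD ((hs.env.frame hf₁).frame hf) ?_ (fun i hi hi' => ?_)
      (fun δ hδ => Data.sound_run hD hs.scale_nonneg hs.radius_eq hδ) (Nat.le_zero.1 hb)
    · rw [outcome, hf.real scaleVar rfl, hf.real multArr rfl, hf₁.real scaleVar rfl,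
        hf₁.real multArr rfl]
    · rw [hf.nat radixArr rfl, hf₁.nat radixArr rfl, hs.radix_eq i hi hi']
  · have hnk : D.k ≤ D.n * D.k := Nat.le_mul_of_pos_left _ hD.n_pos
    have := hD.one_le_k
    have : searchSize D M G * (D.n * D.k * 900 + D.k * 200 + 5) ≤
        searchSize D M G * (D.n * D.k * 1110) := Nat.mul_le_mul_left _ (by omega)
    simp only [Test.steps, NatExpr.steps, Nat.reduceAdd, searchTime]
    omega

/-! ### Choosing the scale -/

section Programs

/-- Lower the scale at least by half, and at least to the best cost. -/
def lowerScaleProgram : Program :=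
  .cond (.realLe (.var bestVar) (.div (.var scaleVar) (.ofNat (.const 2))))
    (assignReal scaleVar (.var bestVar))
    (assignReal scaleVar (.div (.var scaleVar) (.ofNat (.const 2))))

/-- Lower the scale if a search succeeds, and pass to the next first decision if it fails. -/
def lowerStepProgram : Program :=
  searchProgram ;;
  .cond (.and (.natEq (.var okVar) (.const 1)) (.realLt (.ofNat (.const 0)) (.var bestVar)))
    lowerScaleProgram
    (assignNat digitArr (.add (.var digitArr) (.const 1)))

/-- Lower the scale until no search succeeds. -/
def lowerProgram : Program :=
  .loop (.natLt (.var digitArr) (.var pointChoicesVar)) lowerStepProgram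

/-- Search with each of the first decisions. -/
def sweepProgram : Program := .forLoop digitArr (.var pointChoicesVar) searchProgram

/-- Raise the scale until it exceeds twice the best cost. -/
def raiseProgram : Program :=
  .loop (.and (.realLt (.ofNat (.const 0)) (.var bestVar))
      (.realLe (.var scaleVar) (.add (.var bestVar) (.var bestVar))))
    (sweepProgram ;; assignReal scaleVar (.add (.var scaleVar) (.var scaleVar)))

end Programs

lemma Ready.storeNat_digitArr {M G : ℕ} (h : Ready D M G s) (a : ℕ) :
    Ready D M G (s.storeNat digitArr 0 a) := by
  have hf : Frame (assignNat digitArr (.const 0)) s (s.storeNat digitArr 0 a) :=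
    .storeNat _ _ _ _ rfl
  refine ⟨h.env.frame hf, h.tail.frame hf, h.solved.frame hf, ?_, fun i hi hi' => ?_, h.mult_eq,
    h.scale_nonneg⟩
  · rw [hf.nat radixArr rfl]
    exact h.radix_eq
  · rw [State.storeNat_nat_self, Function.update_of_ne (by omega), h.digit_eq_zero i hi hi']

lemma Ready.storeReal_scaleVar {M G : ℕ} (h : Ready D M G s) {R : ℝ} (hR : 0 ≤ R) :
    Ready D M G (s.storeReal scaleVar 0 R) := by
  have hf : Frame (assignReal scaleVar (.ofNat (.const 0))) s (s.storeReal scaleVar 0 R) :=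
    .storeReal _ _ _ _ rfl
  refine ⟨h.env.frame hf, h.tail.frame hf, h.solved.frame hf, h.radix_eq, h.digit_eq_zero, ?_, ?_⟩
  · rw [hf.real multArr rfl]
    exact h.mult_eq
  · simpa using hR

namespace Clustering

variable (S : Clustering D)

lemma radius_le_cost {c : ℕ} (hc : c ∈ S.centers) : S.radius c ≤ S.cost :=
  Finset.single_le_sum (f := S.radius) S.radius_nonneg hc

lemma cost_nonneg : 0 ≤ S.cost := Finset.sum_nonneg S.radius_nonneg

/-- A search with first decision `a` can find the clusters of `S`. -/
def Allows (a : ℕ) : Prop := D.violatedClass D.start ≠ 0 → D.candidate D.start a ∉ S.outliers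

lemma exists_allows (hD : D.Valid) {M : ℕ} (hM : ∀ p < D.n, D.bnd (D.col p) < M) :
    ∃ a < M, S.Allows a := by
  by_cases hv : D.violatedClass D.start = 0
  · exact ⟨0, (Nat.zero_le _).trans_lt (hM 0 hD.n_pos), fun h => absurd hv h⟩
  · obtain ⟨a, ha, -, hout, -⟩ := Data.exists_candidate_notMem_outliers S hv hM
    exact ⟨a, ha, fun _ => hout⟩

end Clustering

section Lower

variable {M G m j : ℕ}

/-- The invariant of `lowerProgram` after `j` searches, of which `u` have succeeded. -/
structure Lowering (D : Data) (M G m j : ℕ) (s : State) : Prop where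
  ready : Ready D M G s
  best_le : s.real bestVar 0 ≤ 4 * D.k * s.real scaleVar 0
  first_le : s.nat digitArr 0 ≤ M
  count : ∃ u, j = s.nat digitArr 0 + u ∧ u ≤ (D.k + 5) * (D.k + m + 1) ∧
    (0 < s.real scaleVar 0 → D.ScalePotential m u (s.real scaleVar 0))
  lt_radius : ∀ S : Clustering D, S.cost < s.real bestVar 0 → ∀ a < s.nat digitArr 0,
    S.Allows a → ∃ c ∈ S.centers, s.real scaleVar 0 < S.radius c

lemma Lowering.lower_scale (hD : D.Valid) {ω : ℕ} (hcol : ∀ p < D.n, D.col p < ω)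
    (h : Lowering D M G (∑ c ∈ Finset.range ω, D.bnd c) j s)
    (hsearch : Searched D M G (s.nat digitArr 0) (s.real scaleVar 0) s s')
    (hok : s'.nat okVar 0 = 1) (hbest : 0 < s'.real bestVar 0) :
    Lowering D M G (∑ c ∈ Finset.range ω, D.bnd c) (j + 1)
      (s'.storeReal scaleVar 0 (min (s'.real bestVar 0) (s'.real scaleVar 0 / 2))) := by
  obtain ⟨u, rfl, _, hpot⟩ := h.count
  have hk : (1 : ℝ) ≤ D.k := by exact_mod_cast hD.one_le_k
  have hle : s'.real bestVar 0 ≤ 4 * D.k * s.real scaleVar 0 := hsearch.best_le.trans h.best_le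
  have hscale : 0 < s.real scaleVar 0 := pos_of_mul_pos_right (hbest.trans_le hle) (by positivity)
  rw [hsearch.scale_eq]
  set R' := min (s'.real bestVar 0) (s.real scaleVar 0 / 2) with hR'
  have hpos : 0 < R' := lt_min hbest (half_pos hscale)
  have hhalf : R' ≤ s.real scaleVar 0 / 2 := min_le_right _ _
  obtain ⟨C, hC, hv, hcost⟩ := hsearch.success hok
  have hle' : s'.real bestVar 0 ≤ 4 * D.k * R' := by
    rcases min_choice (s'.real bestVar 0) (s.real scaleVar 0 / 2) with hmin | hmin
    · rw [hR', hmin]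
      nlinarith
    · rw [hR', hmin]
      linarith [hcost.trans hC.cost_le]
  obtain ⟨x, hx, y, hy, hxy, hxy'⟩ := hsearch.ready.solved.hasScale
  have hpot' := (hpot hscale).succ hD hcol hscale hC hv hx hy
    (pos_of_mul_pos_right (hbest.trans_le hxy') (by positivity))
    (hxy.trans (hcost.trans hC.cost_le)) ((min_le_left _ _).trans hxy') hhalf
  have hscale' : (s'.storeReal scaleVar 0 R').real scaleVar 0 = R' := by simp
  have hbest' : (s'.storeReal scaleVar 0 R').real bestVar = s'.real bestVar :=
    State.storeReal_real_ne _ _ _ _ (by decide)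
  refine ⟨hsearch.ready.storeReal_scaleVar hpos.le, ?_, hsearch.first_eq.trans_le h.first_le,
    ⟨u + 1, ?_, hpot'.count_le, fun _ => ?_⟩, fun S hS a ha hSa => ?_⟩
  · rwa [hscale', hbest']
  · rw [State.storeReal_nat, hsearch.first_eq, add_assoc]
  · rwa [hscale']
  · rw [hbest'] at hS
    rw [State.storeReal_nat, hsearch.first_eq] at ha
    obtain ⟨c, hc, hlt⟩ := h.lt_radius S (hS.trans_le hsearch.best_le) a ha hSa
    exact ⟨c, hc, by rw [hscale']; linarith⟩

lemma Lowering.next_first (h : Lowering D M G m j s)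
    (hsearch : Searched D M G (s.nat digitArr 0) (s.real scaleVar 0) s s')
    (hfirst : s.nat digitArr 0 < M) (hfail : ¬ (s'.nat okVar 0 = 1 ∧ 0 < s'.real bestVar 0)) :
    Lowering D M G m (j + 1) (s'.storeNat digitArr 0 (s'.nat digitArr 0 + 1)) := by
  obtain ⟨u, rfl, hu, hpot⟩ := h.count
  rw [hsearch.first_eq]
  have hfirst' : (s'.storeNat digitArr 0 (s.nat digitArr 0 + 1)).nat digitArr 0 =
      s.nat digitArr 0 + 1 := by simp
  refine ⟨hsearch.ready.storeNat_digitArr _, ?_, by omega, ⟨u, by omega, hu, ?_⟩,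
    fun S hS a ha hSa => ?_⟩
  · rw [State.storeNat_real, hsearch.scale_eq]
    exact hsearch.best_le.trans h.best_le
  · rwa [State.storeNat_real, hsearch.scale_eq]
  · rw [State.storeNat_real] at hS ⊢
    rw [hfirst'] at ha
    rw [hsearch.scale_eq]
    rcases Nat.lt_succ_iff_lt_or_eq.1 ha with ha | rfl
    · exact h.lt_radius S (hS.trans_le hsearch.best_le) a ha hSa
    · by_contra! hle
      exact hfail ⟨(hsearch.complete S hle hSa).1, S.cost_nonneg.trans_lt hS⟩

/-- The result of lowering: a solution that costs less than the best one needs a radius larger than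
the scale. -/
structure Lowered (D : Data) (M G : ℕ) (s : State) : Prop where
  ready : Ready D M G s
  pointChoices_eq : s.nat pointChoicesVar 0 = M
  best_le : s.real bestVar 0 ≤ 4 * D.k * s.real scaleVar 0
  lt_radius : ∀ S : Clustering D, S.cost < s.real bestVar 0 →
    ∃ c ∈ S.centers, s.real scaleVar 0 < S.radius c

lemma wp_lowerScaleProgram {T : ℕ → ℕ → ℝ} : WP T lowerScaleProgram 20
    (· = s.storeReal scaleVar 0 (min (s.real bestVar 0) (s.real scaleVar 0 / 2))) s := by
  refine (WP.cond (τ := 8) (fun hle => WP.of_exec rfl (by decide) ?_)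
    fun hlt => WP.of_exec rfl (by decide) ?_).mono (by decide)
  all_goals
    simp only [Test.Holds, NatExpr.eval, RealExpr.eval, Nat.cast_ofNat] at *
    simp only [Program.exec, NatExpr.eval, RealExpr.eval, Nat.cast_ofNat]
  · rw [min_eq_left hle]
  · rw [min_eq_right (le_of_not_ge hlt)]

lemma wp_lowerStepProgram (hD : D.Valid) {ω : ℕ} (hcol : ∀ p < D.n, D.col p < ω) (hG : 0 < G)
    (hM : ∀ p < D.n, D.bnd (D.col p) < M)
    (h : Lowering D M G (∑ c ∈ Finset.range ω, D.bnd c) j s) (hfirst : s.nat digitArr 0 < M) :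
    WP D.d lowerStepProgram (searchTime D M G + 60)
      (Lowering D M G (∑ c ∈ Finset.range ω, D.bnd c) (j + 1)) s := by
  refine ((wp_searchProgram hD h.ready hG hM).seq fun s₁ hsearch => WP.cond (τ := 20)
    (fun hsuccess => (wp_lowerScaleProgram.imp fun s₂ hs₂ => ?_).mono (by norm_num))
    fun hfail => WP.of_exec rfl (by decide) ?_).mono
      (by simp only [Test.steps, NatExpr.steps, RealExpr.steps]; omega)
  all_goals
    simp only [Test.Holds, NatExpr.eval, RealExpr.eval, Nat.cast_zero, not_le,
      ← Nat.le_antisymm_iff] at *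
  · exact hs₂ ▸ h.lower_scale hD hcol hsearch hsuccess.1 hsuccess.2
  · exact h.next_first hsearch hfirst hfail

lemma wp_lowerProgram (hD : D.Valid) {ω : ℕ} (hcol : ∀ p < D.n, D.col p < ω) (hG : 0 < G)
    (hM : ∀ p < D.n, D.bnd (D.col p) < M) (hs : Ready D M G s) (hfirst : s.nat digitArr 0 = 0)
    (hchoices : s.nat pointChoicesVar 0 = M) (hbest : s.real bestVar 0 = s.real scaleVar 0) :
    WP D.d lowerProgram ((M + (D.k + 5) * (D.k + ∑ c ∈ Finset.range ω, D.bnd c + 1)) *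
      (searchTime D M G + 80) + 10) (Lowered D M G) s := by
  have hk : (1 : ℝ) ≤ D.k := by exact_mod_cast hD.one_le_k
  have hinit : Lowering D M G (∑ c ∈ Finset.range ω, D.bnd c) 0 s := by
    refine ⟨hs, ?_, by omega, ⟨0, by omega, Nat.zero_le _, fun h => .zero hD h.le⟩, by omega⟩
    have := hs.scale_nonneg
    nlinarith
  refine ((WP.loopFrame _ (M + (D.k + 5) * (D.k + ∑ c ∈ Finset.range ω, D.bnd c + 1)) hinit
    (fun j s' hf h hb => ?_) fun j s' hf h hb => wp_lowerStepProgram hD hcol hG hM h ?_).imp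
      fun s' hs' => ?_).mono ?_
  · obtain ⟨u, rfl, hu, -⟩ := h.count
    simp only [Test.Holds, NatExpr.eval, hf.nat pointChoicesVar rfl, hchoices] at hb
    omega
  · simpa only [Test.Holds, NatExpr.eval, hf.nat pointChoicesVar rfl, hchoices, not_le] using hb
  · obtain ⟨j, h, hb, hf⟩ := hs'
    have hchoices' : s'.nat pointChoicesVar 0 = M := by rw [hf.nat pointChoicesVar rfl, hchoices]
    simp only [Test.Holds, NatExpr.eval, hchoices', not_not] at hb
    refine ⟨h.ready, hchoices', h.best_le, fun S hS => ?_⟩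
    obtain ⟨a, ha, hSa⟩ := S.exists_allows hD hM
    exact h.lt_radius S hS a (ha.trans_le hb) hSa
  · simp only [Test.steps, NatExpr.steps, Nat.reduceAdd]
    exact Nat.add_le_add (Nat.mul_le_mul_left _ (by omega)) (by omega)

end Lower

section Raise

variable {M G j : ℕ} {ε R : ℝ}

/-- The invariant of `sweepProgram`, started in `s`, after `a` searches. -/
structure Sweeping (D : Data) (M G : ℕ) (ε : ℝ) (s : State) (a : ℕ) (s' : State) : Prop where
  ready : Ready D M G s'
  pointChoices_eq : s'.nat pointChoicesVar 0 = M
  first_eq : s'.nat digitArr 0 = a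
  scale_eq : s'.real scaleVar 0 = s.real scaleVar 0
  best_le : s'.real bestVar 0 ≤ s.real bestVar 0
  approx : ∀ S : Clustering D, (∀ c ∈ S.centers, S.radius c ≤ s.real scaleVar 0) →
    (∃ b < a, S.Allows b) → (∃ c ∈ S.centers, s.real scaleVar 0 < 2 * S.radius c) →
    s'.real bestVar 0 ≤ (7 + ε) * S.cost

/-- The finest radius of the grid is negligible when some radius is at least half the scale. -/
lemma Searched.best_le_mul_cost {a : ℕ} (h : Searched D M G a R s s')
    (hGε : 4 * D.k * (2 / 7) ^ (G - 1) ≤ ε) (hR : 0 ≤ R) (S : Clustering D)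
    (hS : ∀ c ∈ S.centers, S.radius c ≤ R) (ha : S.Allows a)
    (hc : ∃ c ∈ S.centers, R < 2 * S.radius c) : s'.real bestVar 0 ≤ (7 + ε) * S.cost := by
  obtain ⟨c, hc, hlt⟩ := hc
  have hcost := S.radius_le_cost hc
  have hgrid : R * (4 * D.k * (2 / 7) ^ (G - 1)) ≤ 2 * S.cost * ε :=
    mul_le_mul (by linarith) hGε (by positivity) (by linarith)
  calc s'.real bestVar 0 ≤ 7 * S.cost + D.k * (2 * (R * (2 / 7) ^ (G - 1))) :=
        (h.complete S hS ha).2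
    _ = 7 * S.cost + R * (4 * D.k * (2 / 7) ^ (G - 1)) / 2 := by ring
    _ ≤ (7 + ε) * S.cost := by linarith

lemma Sweeping.succ {a : ℕ} {s₁ s₂ : State} (h : Sweeping D M G ε s a s₁)
    (hGε : 4 * D.k * (2 / 7) ^ (G - 1) ≤ ε)
    (hsearch : Searched D M G (s₁.nat digitArr 0) (s₁.real scaleVar 0) s₁ s₂)
    (hf : Frame searchProgram s₁ s₂) :
    Sweeping D M G ε s (a + 1) (s₂.storeNat digitArr 0 (a + 1)) := by
  rw [h.first_eq, h.scale_eq] at hsearch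
  refine ⟨hsearch.ready.storeNat_digitArr _, ?_, by simp, hsearch.scale_eq,
    hsearch.best_le.trans h.best_le, fun S hS ⟨b, hb, hSb⟩ hc => ?_⟩
  · rw [State.storeNat_nat_ne _ _ _ _ (by decide), hf.nat pointChoicesVar rfl, h.pointChoices_eq]
  · rw [State.storeNat_real]
    rcases Nat.lt_succ_iff_lt_or_eq.1 hb with hb | rfl
    · exact hsearch.best_le.trans (h.approx S hS ⟨b, hb, hSb⟩ hc)
    · exact hsearch.best_le_mul_cost hGε (h.scale_eq ▸ h.ready.scale_nonneg) S hS hSb hc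

lemma wp_sweepProgram (hD : D.Valid) (hG : 0 < G) (hM : ∀ p < D.n, D.bnd (D.col p) < M)
    (hGε : 4 * D.k * (2 / 7) ^ (G - 1) ≤ ε) (hs : Ready D M G s)
    (hchoices : s.nat pointChoicesVar 0 = M) :
    WP D.d sweepProgram (M * (searchTime D M G + 13) + 10) (Sweeping D M G ε s M) s :=
  WP.forLoop (Sweeping D M G ε s) M
    ⟨hs.storeNat_digitArr 0, by rwa [State.storeNat_nat_ne _ _ _ _ (by decide)], by simp, rfl,
      le_rfl, by rintro _ _ ⟨b, hb, -⟩; exact absurd hb b.not_lt_zero⟩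
    (fun _ _ h => ⟨h.pointChoices_eq, h.first_eq⟩)
    fun _ _ _ h => (wp_searchProgram hD h.ready hG hM).frame.imp fun _ ⟨hsearch, hf⟩ =>
      ⟨hsearch.first_eq.trans h.first_eq, h.succ hGε hsearch hf⟩

/-- The invariant of `raiseProgram` after `j` rounds: a solution that is much better than the best
one needs a radius of more than half the scale. -/
structure Raising (D : Data) (M G : ℕ) (ε : ℝ) (j : ℕ) (s : State) : Prop where
  ready : Ready D M G s
  two_pow_mul_best_le : 2 ^ j * s.real bestVar 0 ≤ 4 * D.k * s.real scaleVar 0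
  approx : ∀ S : Clustering D, s.real bestVar 0 ≤ (7 + ε) * S.cost ∨
    ∃ c ∈ S.centers, s.real scaleVar 0 < 2 * S.radius c

lemma Lowered.raising (h : Lowered D M G s) (hε : 0 ≤ ε) : Raising D M G ε 0 s := by
  refine ⟨h.ready, by simpa using h.best_le, fun S => ?_⟩
  rcases le_or_gt (s.real bestVar 0) S.cost with hle | hlt
  · exact .inl (hle.trans (le_mul_of_one_le_left S.cost_nonneg (by linarith)))
  · obtain ⟨c, hc, hradius⟩ := h.lt_radius S hlt
    exact .inr ⟨c, hc, by linarith [h.ready.scale_nonneg]⟩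

lemma Raising.lt_of_scale_le (h : Raising D M G ε j s) (hbest : 0 < s.real bestVar 0)
    (hscale : s.real scaleVar 0 ≤ s.real bestVar 0 + s.real bestVar 0) : j < D.k + 3 := by
  have hle : (2 : ℝ) ^ j * s.real bestVar 0 ≤ 8 * D.k * s.real bestVar 0 := by
    nlinarith [h.two_pow_mul_best_le, (Nat.cast_nonneg D.k : (0 : ℝ) ≤ D.k)]
  have hpow : 2 ^ j ≤ 8 * D.k := by exact_mod_cast le_of_mul_le_mul_right hle hbest
  have hk : D.k < 2 ^ D.k := Nat.lt_two_pow_self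
  refine (Nat.pow_lt_pow_iff_right one_lt_two).1 (hpow.trans_lt ?_)
  rw [pow_add]
  omega

lemma Raising.succ {a : ℕ} (h : Raising D M G ε j s) (hsweep : Sweeping D M G ε s a s')
    (hallows : ∀ S : Clustering D, ∃ b < a, S.Allows b) :
    Raising D M G ε (j + 1)
      (s'.storeReal scaleVar 0 (s'.real scaleVar 0 + s'.real scaleVar 0)) := by
  rw [hsweep.scale_eq]
  set R := s.real scaleVar 0
  have hR : 0 ≤ R := h.ready.scale_nonneg
  have hscale : (s'.storeReal scaleVar 0 (R + R)).real scaleVar 0 = R + R := by simp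
  have hbest : (s'.storeReal scaleVar 0 (R + R)).real bestVar = s'.real bestVar :=
    State.storeReal_real_ne _ _ _ _ (by decide)
  refine ⟨hsweep.ready.storeReal_scaleVar (add_nonneg hR hR), ?_, fun S => ?_⟩
  · rw [hscale, hbest, pow_succ]
    have : (2 : ℝ) ^ j * s'.real bestVar 0 ≤ 2 ^ j * s.real bestVar 0 := by
      gcongr
      exact hsweep.best_le
    linarith [h.two_pow_mul_best_le]
  · rw [hscale, hbest]
    rcases h.approx S with hle | hlarge
    · exact .inl (hsweep.best_le.trans hle)
    · by_cases hS : ∀ c ∈ S.centers, S.radius c ≤ R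
      · exact .inl (hsweep.approx S hS (hallows S) hlarge)
      · push Not at hS
        obtain ⟨c, hc, hlt⟩ := hS
        exact .inr ⟨c, hc, by linarith⟩

lemma Raising.best_le_mul_cost (h : Raising D M G ε j s) (hε : 0 ≤ ε)
    (hdone : 0 < s.real bestVar 0 → s.real bestVar 0 + s.real bestVar 0 < s.real scaleVar 0)
    (S : Clustering D) : s.real bestVar 0 ≤ (7 + ε) * S.cost := by
  have hcost := S.cost_nonneg
  rcases h.approx S with hle | ⟨c, hc, hradius⟩
  · exact hle
  rcases le_or_gt (s.real bestVar 0) 0 with hbest | hbest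
  · exact hbest.trans (by positivity)
  · nlinarith [hdone hbest, S.radius_le_cost hc]

lemma wp_raiseProgram (hD : D.Valid) (hG : 0 < G) (hM : ∀ p < D.n, D.bnd (D.col p) < M)
    (hGε : 4 * D.k * (2 / 7) ^ (G - 1) ≤ ε) (hs : Lowered D M G s) :
    WP D.d raiseProgram ((D.k + 3) * (M * (searchTime D M G + 13) + 40) + 20)
      (fun s' => Env D s' ∧ Solved D s' ∧
        ∀ S : Clustering D, s'.real bestVar 0 ≤ (7 + ε) * S.cost) s := by
  have hε : 0 ≤ ε := le_trans (by positivity) hGε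
  refine ((WP.loopFrame (Raising D M G ε) (D.k + 3) (hs.raising hε) (fun j s' _ h hb => ?_)
    fun j s' hf h _ => ((wp_sweepProgram hD hG hM hGε h.ready ?_).seq fun s₁ hsweep =>
      WP.of_exec (τ := 10) rfl (by decide) ?_)).imp
        fun s' hs' => ?_).mono ?_
  · simp only [Test.Holds, NatExpr.eval, RealExpr.eval, Nat.cast_zero, not_le] at hb
    exact h.lt_of_scale_le hb.1 hb.2
  · rw [hf.nat pointChoicesVar rfl, hs.pointChoices_eq]
  · exact h.succ hsweep fun S => S.exists_allows hD hM
  · obtain ⟨j, h, hb, -⟩ := hs'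
    simp only [Test.Holds, NatExpr.eval, RealExpr.eval, Nat.cast_zero, not_le, not_and] at hb
    exact ⟨h.ready.env, h.ready.solved, h.best_le_mul_cost hε hb⟩
  · simp only [Test.steps, NatExpr.steps, RealExpr.steps, Nat.reduceAdd]
    exact Nat.add_le_add (Nat.mul_le_mul_left _ (by omega)) (by omega)

end Raise

/-! ### The whole algorithm -/

section Programs

/-- Compute the largest distance from the point `0` as the first scale. -/
def spreadProgram : Program :=
  .forLoop ptVar pointCount
    (ifThen (.realLe (.var scaleVar) (.table (.const 0) point))
      (assignReal scaleVar (.table (.const 0) point)))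

/-- Compute a number of choices for a point that suffices for every class. -/
def choicesProgram : Program :=
  assignNat pointChoicesVar (.const 1) ;;
  .forLoop ptVar pointCount
    (ifThen (.natLe (.var pointChoicesVar) (.get boundArr (.get classArr point)))
      (assignNat pointChoicesVar (.add (.get boundArr (.get classArr point)) (.const 1))))

/-- The grid of radii is still too coarse: its finest radius is not negligible. -/
def coarseTest : Test :=
  .realLt (.var epsVar) (.mul (.ofNat (.add (.add centerCount centerCount)
    (.add centerCount centerCount))) (.var powVar))

/-- Append a radius to the grid. -/
def refineProgram : Program :=
  assignReal powVar (.mul (.var powVar) (.div (.ofNat (.const 2)) (.ofNat (.const 7)))) ;;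
  .setReal multArr (.var radiusChoicesVar) (.mul (.ofNat (.const 2)) (.var powVar)) ;;
  assignNat radiusChoicesVar (.add (.var radiusChoicesVar) (.const 1))

/-- Compute the grid of radii, as multiples of the scale. -/
def gridProgram : Program :=
  (assignReal powVar (.ofNat (.const 1)) ;; assignReal multArr (.ofNat (.const 2)) ;;
    assignNat radiusChoicesVar (.const 1)) ;;
  .loop coarseTest refineProgram

/-- Store the numbers of values of the decisions. -/
def radixProgram : Program :=
  .forLoop ptVar centerCount
    (.setNat radixArr (.add point point) (.var pointChoicesVar) ;;
      .setNat radixArr (.add (.add point point) (.const 1)) (.var radiusChoicesVar))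

/-- Compute everything that the search needs except for a solution. -/
def prepareProgram : Program := spreadProgram ;; choicesProgram ;; gridProgram ;; radixProgram

/-- Record the solution whose only ball has the center `0`. -/
def firstProgram : Program :=
  assignReal bestVar (.var scaleVar) ;; .setNat outCenterArr (.const 0) (.const 1)

/-- Prepare the memory for the search. -/
def setupProgram : Program := prepareProgram ;; firstProgram

/-- Count the centers of the solution. -/
def countCentersProgram : Program :=
  assignNat centerCountVar (.const 0) ;;
  .forLoop ptVar pointCount
    (ifThen (.natEq (.get outCenterArr point) (.const 1))
      (assignNat centerCountVar (.add (.var centerCountVar) (.const 1))))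

/-- Turn points into centers as long as there are fewer than `k` centers. -/
def fillProgram : Program :=
  .forLoop ptVar pointCount
    (ifThen (.and (.not (.natEq (.get outCenterArr point) (.const 1)))
        (.natLt (.var centerCountVar) centerCount))
      (.setNat outCenterArr point (.const 1) ;;
        assignNat centerCountVar (.add (.var centerCountVar) (.const 1))))

/-- Make the solution use exactly `k` centers. -/
def padProgram : Program := countCentersProgram ;; fillProgram

/-- Find a solution after the preparation of the memory. -/
def solveProgram : Program := lowerProgram ;; raiseProgram ;; padProgram

/-- The algorithm of the theorem. -/
def mainProgram : Program := setupProgram ;; solveProgram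

end Programs

section Setup

variable {M G N j : ℕ} {ε : ℝ}

lemma wp_spreadProgram (hD : D.Valid) (hs : Env D s) (hscale : s.real scaleVar 0 = 0) :
    WP D.d spreadProgram (D.n * 33 + 10) (fun s' =>
      (∀ q < D.n, D.d 0 q ≤ s'.real scaleVar 0) ∧ ∃ x < D.n, s'.real scaleVar 0 = D.d 0 x) s := by
  refine ((WP.forFrame (e := pointCount) (τ := 20)
    (fun j s' => (∀ q < j, D.d 0 q ≤ s'.real scaleVar 0) ∧
      ∃ x < D.n, s'.real scaleVar 0 = D.d 0 x) D.n (fun s' hf => (hs.frame hf).n_eq) rfl ?_ ?_).imp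
      fun _ h => h.1).mono (by simp only [NatExpr.steps]; omega)
  · exact ⟨fun q hq => absurd hq q.not_lt_zero, 0, hD.n_pos, by
      rw [State.storeNat_real, hscale, hD.d_self]⟩
  · rintro j s' hj - hpt ⟨hle, x, hx, heq⟩
    refine WP.of_exec rfl (by decide) ?_
    simp only [Program.exec, Test.Holds, NatExpr.eval, RealExpr.eval, hpt, State.storeNat_real]
    split_ifs with hnew
    · rw [State.storeReal_real_self, Function.update_self]
      exact ⟨Nat.forall_lt_succ_right.2 ⟨fun q hq => (hle q hq).trans hnew, le_rfl⟩, j, hj, rfl⟩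
    · exact ⟨Nat.forall_lt_succ_right.2 ⟨hle, (not_le.1 hnew).le⟩, x, hx, heq⟩

lemma wp_choicesProgram (hs : Env D s) {ω : ℕ} (hcol : ∀ p < D.n, D.col p < ω) :
    WP D.d choicesProgram (D.n * 43 + 20) (fun s' =>
      (∀ q < D.n, D.bnd (D.col q) < s'.nat pointChoicesVar 0) ∧
      s'.nat pointChoicesVar 0 ≤ (∑ c ∈ Finset.range ω, D.bnd c) + 1) s := by
  refine ((WP.of_exec (τ := 3) rfl (by decide) (Q := fun s' => s'.nat pointChoicesVar 0 = 1)
    (by simp [Program.exec, NatExpr.eval])).frame.seq fun s₁ ⟨hone, hf₁⟩ => (WP.forFrame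
      (e := pointCount) (τ := 30)
      (fun j s' => (∀ q < j, D.bnd (D.col q) < s'.nat pointChoicesVar 0) ∧
        s'.nat pointChoicesVar 0 ≤ (∑ c ∈ Finset.range ω, D.bnd c) + 1) D.n
      (fun s' hf => ((hs.frame hf₁).frame hf).n_eq) rfl ?_ ?_).imp fun _ h => h.1).mono
        (by simp only [NatExpr.steps]; omega)
  · rw [State.storeNat_nat_ne _ _ _ _ (by decide), hone]
    exact ⟨fun q hq => absurd hq q.not_lt_zero, by omega⟩
  · rintro j s' hj hf hpt ⟨hlt, hle⟩
    have hs' := (hs.frame hf₁).frame hf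
    refine WP.of_exec rfl (by decide) ?_
    rw [State.storeNat_nat_ne _ _ _ _ (by decide)]
    simp only [Program.exec, Test.Holds, NatExpr.eval, hpt, hs'.col_eq, hs'.bnd_eq]
    split_ifs with hnew
    · rw [State.storeNat_nat_self, Function.update_self]
      exact ⟨Nat.forall_lt_succ_right.2 ⟨fun q hq => by have := hlt q hq; omega, by omega⟩,
        Nat.succ_le_succ (Finset.single_le_sum (f := D.bnd) (fun _ _ => Nat.zero_le _)
          (Finset.mem_range.2 (hcol j hj)))⟩
    · exact ⟨Nat.forall_lt_succ_right.2 ⟨hlt, not_le.1 hnew⟩, hle⟩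

/-- The invariant of `gridProgram` after `j` of `N` refinements. -/
structure Gridded (N j : ℕ) (s : State) : Prop where
  radiusChoices_eq : s.nat radiusChoicesVar 0 = j + 1
  pow_eq : s.real powVar 0 = (2 / 7) ^ j
  le : j ≤ N
  mult_eq : ∀ g < j + 1, s.real multArr g = 2 * (2 / 7) ^ g

lemma Gridded.holds_coarseTest (h : Gridded N j s) (hs : Env D s) (heps : s.real epsVar 0 = ε) :
    coarseTest.Holds D.d s ↔ ε < 4 * D.k * (2 / 7) ^ j := by
  simp only [coarseTest, Test.Holds, NatExpr.eval, RealExpr.eval, h.pow_eq, heps, hs.k_eq, not_le]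
  push_cast
  rw [show (D.k + D.k + (D.k + D.k) : ℝ) = 4 * D.k by ring]

lemma wp_refineProgram {T : ℕ → ℕ → ℝ} (h : Gridded N j s) (hj : j < N) :
    WP T refineProgram 30 (Gridded N (j + 1)) s := by
  refine WP.of_exec rfl (by decide) ⟨?_, ?_, hj, fun g hg => ?_⟩
  all_goals
    simp only [refineProgram, Program.exec, NatExpr.eval, RealExpr.eval, ne_eq, Nat.reduceEqDiff,
      not_false_eq_true, State.storeReal_real_ne, State.storeReal_real_self, State.storeReal_nat,
      State.storeNat_nat_self, State.storeNat_real, Function.update_self, h.radiusChoices_eq,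
      h.pow_eq, Nat.cast_ofNat]
  · rw [pow_succ]
  · rw [Function.update_apply]
    split_ifs with hg'
    · rw [hg', pow_succ]
    · exact h.mult_eq g (by omega)

lemma wp_gridProgram (hs : Env D s) (heps : s.real epsVar 0 = ε)
    (hN : ∀ j, ε < 4 * D.k * (2 / 7) ^ j ↔ j < N) :
    WP D.d gridProgram (N * 60 + 40) (Gridded N N) s := by
  refine ((WP.of_exec (τ := 11) rfl (by decide) (Q := Gridded N 0) ?_).frame.seq
    fun s₁ ⟨h₁, hf₁⟩ => ((WP.loopFrame (τ := 30) (Gridded N) N h₁ ?_ ?_).imp ?_)).mono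
      (by simp only [coarseTest, Test.steps, NatExpr.steps, RealExpr.steps]; omega)
  · refine ⟨?_, ?_, N.zero_le, fun g hg => ?_⟩
    · simp [Program.exec, NatExpr.eval]
    · simp [Program.exec, NatExpr.eval, RealExpr.eval, State.storeReal_real_ne]
    · obtain rfl : g = 0 := by omega
      simp [Program.exec, NatExpr.eval, RealExpr.eval]
  all_goals
    have htest {s'} (hf : Frame (.loop coarseTest refineProgram) s₁ s') {j} (h : Gridded N j s') :
        coarseTest.Holds D.d s' ↔ j < N :=
      (h.holds_coarseTest ((hs.frame hf₁).frame hf)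
        (by rw [hf.real _ rfl, hf₁.real _ rfl, heps])).trans (hN j)
  · exact fun j s' hf h hb => (htest hf h).1 hb
  · exact fun j s' hf h hb => wp_refineProgram h ((htest hf h).1 hb)
  · rintro s' ⟨j, h, hb, hf⟩
    obtain rfl : j = N := h.le.antisymm (not_lt.1 (mt (htest hf h).2 hb))
    exact h

lemma wp_radixProgram (hs : Env D s) (hM : s.nat pointChoicesVar 0 = M)
    (hG : s.nat radiusChoicesVar 0 = G) :
    WP D.d radixProgram (D.k * 50 + 10)
      (fun s' => ∀ i < D.k + D.k, s'.nat radixArr i = digitBound M G i) s := by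
  refine ((WP.forFrame (e := centerCount) (τ := 30)
    (fun j s' => ∀ i < j + j, s'.nat radixArr i = digitBound M G i) D.k
    (fun s' hf => (hs.frame hf).k_eq) rfl (fun i hi => absurd hi i.not_lt_zero) ?_).imp
      fun _ h => h.1).mono (by simp only [NatExpr.steps]; omega)
  intro j s' _ hf hpt h
  refine WP.of_exec rfl (by decide) ?_
  simp only [Program.exec, NatExpr.eval, hpt, ne_eq, Nat.reduceEqDiff, not_false_eq_true,
    State.storeNat_nat_ne, State.storeNat_nat_self, hf.nat pointChoicesVar rfl, hM,
    hf.nat radiusChoicesVar rfl, hG]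
  intro i hi
  rw [Function.update_apply, Function.update_apply]
  split_ifs with hodd heven
  · rw [digitBound, if_neg (by omega)]
  · rw [digitBound, if_pos (by omega)]
  · exact h i (by omega)

/-- The initial memory for the data `D` and the precision `ε`. -/
structure Initial (D : Data) (ε : ℝ) (s : State) : Prop where
  env : Env D s
  nat_eq_zero : ∀ a, 3 ≤ a → s.nat a = fun _ => 0
  scale_eq_zero : s.real scaleVar 0 = 0
  eps_eq : s.real epsVar 0 = ε

/-- The result of `prepareProgram`. -/
structure Prepared (D : Data) (M G : ℕ) (s : State) : Prop where
  env : Env D s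
  pointChoices_eq : s.nat pointChoicesVar 0 = M
  radix_eq : ∀ i < D.k + D.k, s.nat radixArr i = digitBound M G i
  mult_eq : ∀ g < G, s.real multArr g = 2 * (2 / 7) ^ g
  dist_le : ∀ q < D.n, D.d 0 q ≤ s.real scaleVar 0
  exists_scale_eq : ∃ x < D.n, s.real scaleVar 0 = D.d 0 x

lemma wp_prepareProgram (hD : D.Valid) (hs : Initial D ε s) {ω : ℕ}
    (hcol : ∀ p < D.n, D.col p < ω) (hN : ∀ j, ε < 4 * D.k * (2 / 7) ^ j ↔ j < N) :
    WP D.d prepareProgram (D.n * 90 + N * 60 + D.k * 50 + 80) (fun s' => ∃ M,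
      (∀ q < D.n, D.bnd (D.col q) < M) ∧ M ≤ (∑ c ∈ Finset.range ω, D.bnd c) + 1 ∧
      Prepared D M (N + 1) s') s := by
  refine ((wp_spreadProgram hD hs.env hs.scale_eq_zero).frame.seq fun s₁ ⟨hspread, hf₁⟩ =>
    (wp_choicesProgram (hs.env.frame hf₁) hcol).frame.seq fun s₂ ⟨hchoices, hf₂⟩ =>
    (wp_gridProgram ((hs.env.frame hf₁).frame hf₂) ?_ hN).frame.seq fun s₃ ⟨hgrid, hf₃⟩ =>
    (wp_radixProgram (((hs.env.frame hf₁).frame hf₂).frame hf₃) rfl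
      hgrid.radiusChoices_eq).frame.imp fun s₄ ⟨hradix, hf₄⟩ => ?_).mono (by omega)
  · rw [hf₂.real _ rfl, hf₁.real _ rfl, hs.eps_eq]
  · have hchoices_eq : s₃.nat pointChoicesVar = s₂.nat pointChoicesVar := hf₃.nat _ rfl
    have hscale : s₄.real scaleVar = s₁.real scaleVar := by
      rw [hf₄.real _ rfl, hf₃.real _ rfl, hf₂.real _ rfl]
    refine ⟨s₃.nat pointChoicesVar 0, ?_, ?_, (((hs.env.frame hf₁).frame hf₂).frame hf₃).frame hf₄,
      ?_, hradix, ?_, ?_, ?_⟩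
    · rw [hchoices_eq]; exact hchoices.1
    · rw [hchoices_eq]; exact hchoices.2
    · rw [hf₄.nat _ rfl]
    · rw [hf₄.real _ rfl]; exact hgrid.mult_eq
    · rw [hscale]; exact hspread.1
    · rw [hscale]; exact hspread.2

lemma Solved.single_ball (hD : D.Valid)
    (hcenter : s.nat outCenterArr = Function.update (fun _ => 0) 0 1)
    (hout : s.nat outOutlierArr = fun _ => 0) (hasg : s.nat outAssignArr = fun _ => 0)
    (hdist : ∀ q < D.n, D.d 0 q ≤ s.real bestVar 0)
    (hbest : ∃ x < D.n, s.real bestVar 0 = D.d 0 x) : Solved D s := by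
  have hn := hD.n_pos
  have hk : (1 : ℝ) ≤ D.k := by exact_mod_cast hD.one_le_k
  obtain ⟨x, hx, hbest⟩ := hbest
  have hnonneg : 0 ≤ s.real bestVar 0 := hbest ▸ hD.d_nonneg 0 x
  constructor
  · refine (Finset.card_le_card (t := {0}) fun q hq => ?_).trans hD.one_le_k
    have := (Finset.mem_filter.1 hq).2
    by_contra hq0
    rw [hcenter, Function.update_of_ne (by simpa using hq0)] at this
    exact zero_ne_one this
  · simp [hout]
  · simp [hout]
  · simp [hasg, hcenter, hn]
  · refine ⟨fun c => if c = 0 then s.real bestVar 0 else 0, fun c => by positivity,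
      fun q hq _ => ?_, ?_⟩
    · simpa only [hasg, if_true] using hdist q hq
    · rw [Finset.sum_ite_eq', if_pos (by simpa using hn)]
  · exact ⟨0, hn, x, hx, hbest.ge, by nlinarith⟩

lemma wp_setupProgram (hD : D.Valid) (hs : Initial D ε s) {ω : ℕ}
    (hcol : ∀ p < D.n, D.col p < ω) (hN : ∀ j, ε < 4 * D.k * (2 / 7) ^ j ↔ j < N) :
    WP D.d setupProgram (D.n * 90 + N * 60 + D.k * 50 + 90) (fun s' => ∃ M,
      (∀ q < D.n, D.bnd (D.col q) < M) ∧ M ≤ (∑ c ∈ Finset.range ω, D.bnd c) + 1 ∧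
      Ready D M (N + 1) s' ∧ s'.nat digitArr 0 = 0 ∧ s'.nat pointChoicesVar 0 = M ∧
      s'.real bestVar 0 = s'.real scaleVar 0) s := by
  refine ((wp_prepareProgram hD hs hcol hN).frame.seq fun s₁ ⟨⟨M, hM, hle, h⟩, hf₁⟩ =>
    (WP.of_exec (τ := 8) rfl (by decide) (Q := fun s' =>
      s'.real bestVar 0 = s₁.real scaleVar 0 ∧
      s'.nat outCenterArr = Function.update (s₁.nat outCenterArr) 0 1)
      (by simp [firstProgram, Program.exec, NatExpr.eval, RealExpr.eval])).frame.imp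
    fun s₂ ⟨⟨hbest, hcenter⟩, hf₂⟩ => ?_).mono (by omega)
  have hzero (a : ℕ) (ha : 3 ≤ a) (hw : prepareProgram.writesNat a = false := by rfl)
      (hw' : firstProgram.writesNat a = false := by rfl) : s₂.nat a = (fun _ => 0 : ℕ → ℕ) := by
    rw [hf₂.nat a hw', hf₁.nat a hw, hs.nat_eq_zero a ha]
  have hscale : s₂.real scaleVar = s₁.real scaleVar := hf₂.real _ rfl
  refine ⟨M, hM, hle, ⟨h.env.frame hf₂, ⟨?_, ?_, ?_⟩, .single_ball hD ?_ (hzero 4 (by decide))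
    (hzero 5 (by decide)) (hbest ▸ h.dist_le) (hbest ▸ h.exists_scale_eq), ?_, ?_, ?_, ?_⟩,
    congrFun (hzero digitArr (by decide)) 0, ?_, by rw [hbest, hscale]⟩
  · exact fun q _ => congrFun (hzero covArr (by decide)) q
  · exact fun q _ => congrFun (hzero asgArr (by decide)) q
  · exact fun q _ => congrFun (hzero centerArr (by decide)) q
  · rw [hcenter, hf₁.nat outCenterArr rfl, hs.nat_eq_zero outCenterArr le_rfl]
  · rw [hf₂.nat _ rfl]
    exact fun i _ hi => h.radix_eq i hi
  · exact fun i _ _ => congrFun (hzero digitArr (by decide)) i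
  · rw [hf₂.real _ rfl]
    exact h.mult_eq
  · obtain ⟨x, -, hx⟩ := h.exists_scale_eq
    rw [hscale, hx]
    exact hD.d_nonneg 0 x
  · rw [hf₂.nat _ rfl, h.pointChoices_eq]

end Setup

section Padding

variable {j : ℕ}

/-- The centers of the solution in memory. -/
abbrev outCenters (D : Data) (s : State) : Finset ℕ :=
  (Finset.range D.n).filter fun q => s.nat outCenterArr q = 1

lemma wp_countCentersProgram (hs : Env D s) :
    WP D.d countCentersProgram (D.n * 50 + 15)
      (fun s' => s'.nat centerCountVar 0 = (outCenters D s).card) s := by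
  refine ((WP.of_exec (τ := 3) rfl (by decide) (Q := fun s' => s'.nat centerCountVar 0 = 0)
    (by simp [Program.exec, NatExpr.eval])).frame.seq fun s₁ ⟨hzero, hf₁⟩ => (WP.forFrame
      (e := pointCount) (τ := 30) (fun j s' => s'.nat centerCountVar 0 =
        ((Finset.range j).filter fun q => s.nat outCenterArr q = 1).card) D.n
      (fun s' hf => ((hs.frame hf₁).frame hf).n_eq) rfl ?_ ?_).imp fun _ h => h.1).mono
        (by simp only [NatExpr.steps]; omega)
  · rw [State.storeNat_nat_ne _ _ _ _ (by decide), hzero]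
    rfl
  · intro j s' _ hf hpt h
    refine WP.of_exec rfl (by decide) ?_
    rw [State.storeNat_nat_ne _ _ _ _ (by decide), Finset.range_add_one, Finset.filter_insert]
    simp only [Program.exec, Test.Holds, NatExpr.eval, hpt, ← Nat.le_antisymm_iff,
      hf.nat outCenterArr rfl, hf₁.nat outCenterArr rfl]
    split_ifs with hcenter
    · rw [Finset.card_insert_of_notMem (by simp), State.storeNat_nat_self, Function.update_self, h]
    · exact h

/-- The invariant of `fillProgram`, started in `s`, after `j` points. -/
structure Filling (D : Data) (s : State) (j : ℕ) (s' : State) : Prop where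
  count_eq : s'.nat centerCountVar 0 = (outCenters D s').card
  card_le : (outCenters D s').card ≤ D.k
  mono : ∀ q, s.nat outCenterArr q = 1 → s'.nat outCenterArr q = 1
  full : (∀ q < j, s'.nat outCenterArr q = 1) ∨ (outCenters D s').card = D.k

lemma Filling.storeNat_ptVar {v : ℕ} (h : Filling D s j s') :
    Filling D s j (s'.storeNat ptVar 0 v) :=
  ⟨h.count_eq, h.card_le, h.mono, h.full⟩

lemma Filling.add_center (h : Filling D s j s') (hj : j < D.n)
    (hnew : s'.nat outCenterArr j ≠ 1) (hlt : s'.nat centerCountVar 0 < D.k) :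
    Filling D s (j + 1) ((s'.storeNat outCenterArr j 1).storeNat centerCountVar 0
      (s'.nat centerCountVar 0 + 1)) := by
  set s'' := (s'.storeNat outCenterArr j 1).storeNat centerCountVar 0
    (s'.nat centerCountVar 0 + 1) with hs''
  have hcenter : s''.nat outCenterArr = Function.update (s'.nat outCenterArr) j 1 := by
    rw [hs'', State.storeNat_nat_ne _ _ _ _ (by decide), State.storeNat_nat_self]
  have hcount : s''.nat centerCountVar 0 = s'.nat centerCountVar 0 + 1 := by simp [hs'']
  have hinsert : outCenters D s'' = insert j (outCenters D s') := by
    ext q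
    by_cases hq : q = j <;> simp [outCenters, hcenter, Function.update_apply, hq, hj]
  have hcard : (outCenters D s'').card = (outCenters D s').card + 1 := by
    rw [hinsert, Finset.card_insert_of_notMem (by simp [hnew])]
  refine ⟨by rw [hcount, h.count_eq, hcard], by rw [hcard, ← h.count_eq]; exact hlt,
    fun q hq => ?_, h.full.imp (fun hall q hq => ?_) fun hfull => ?_⟩
  · rw [hcenter, Function.update_apply, h.mono q hq, ite_self]
  · rw [hcenter, Function.update_apply]
    split_ifs with hqj
    · rfl
    · exact hall q (by omega)
  · exact absurd (h.count_eq.trans hfull) hlt.ne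

lemma Filling.keep (h : Filling D s j s')
    (hkeep : s'.nat outCenterArr j ≠ 1 → D.k ≤ s'.nat centerCountVar 0) :
    Filling D s (j + 1) s' := by
  refine ⟨h.count_eq, h.card_le, h.mono, ?_⟩
  by_cases hcenter : s'.nat outCenterArr j = 1
  · exact h.full.imp_left fun hall => Nat.forall_lt_succ_right.2 ⟨hall, hcenter⟩
  · exact Or.inr (h.card_le.antisymm (h.count_eq ▸ hkeep hcenter))

lemma Filling.card_eq (hD : D.Valid) (h : Filling D s D.n s') : (outCenters D s').card = D.k := by
  rcases h.full with hall | hfull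
  · have hcard := h.card_le
    rw [outCenters, Finset.filter_true_of_mem fun q hq => hall q (Finset.mem_range.1 hq),
      Finset.card_range] at hcard ⊢
    exact hcard.antisymm hD.k_le_n
  · exact hfull

lemma wp_fillProgram (hs : Env D s) (hcount : s.nat centerCountVar 0 = (outCenters D s).card)
    (hle : (outCenters D s).card ≤ D.k) :
    WP D.d fillProgram (D.n * 70 + 10) (Filling D s D.n) s := by
  refine ((WP.forFrame (e := pointCount) (τ := 50) (Filling D s) D.n
    (fun s' hf => (hs.frame hf).n_eq) rfl
    (Filling.storeNat_ptVar ⟨hcount, hle, fun _ h => h,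
      Or.inl fun q hq => absurd hq q.not_lt_zero⟩) ?_).imp fun _ h => h.1).mono
        (by simp only [NatExpr.steps]; omega)
  intro j s' hj hf hpt h
  refine WP.of_exec rfl (by decide) (Filling.storeNat_ptVar ?_)
  simp only [Program.exec, Test.Holds, NatExpr.eval, hpt, ← Nat.le_antisymm_iff,
    (hs.frame hf).k_eq, not_le]
  split_ifs with hb
  · exact h.add_center hj hb.1 hb.2
  · exact h.keep fun hnew => not_lt.1 fun hlt => hb ⟨hnew, hlt⟩

lemma wp_padProgram (hD : D.Valid) (hs : Env D s) (hsolved : Solved D s) :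
    WP D.d padProgram (D.n * 120 + 25) (fun s' => Solved D s' ∧ (outCenters D s').card = D.k ∧
      s'.real bestVar = s.real bestVar) s := by
  refine ((wp_countCentersProgram hs).frame.seq fun s₁ ⟨hcount, hf₁⟩ =>
    (wp_fillProgram (hs.frame hf₁) ?_ (hsolved.frame hf₁).card_centers_le).frame.imp
      fun s₂ ⟨hfill, hf₂⟩ => ?_).mono (by omega)
  · simpa only [outCenters, hf₁.nat outCenterArr rfl] using hcount
  · have h₁ := hsolved.frame hf₁
    have hout : s₂.nat outOutlierArr = s₁.nat outOutlierArr := hf₂.nat _ rfl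
    have hasg : s₂.nat outAssignArr = s₁.nat outAssignArr := hf₂.nat _ rfl
    have hbest : s₂.real bestVar = s₁.real bestVar := hf₂.real _ rfl
    refine ⟨⟨hfill.card_le, ?_, ?_, ?_, ?_, ?_⟩, hfill.card_eq hD, by rw [hbest, hf₁.real _ rfl]⟩
    · rw [hout]; exact h₁.card_outliers_le
    · rw [hout, hasg]; exact h₁.assign_outlier
    · rw [hout, hasg]
      exact fun q hq hq' => (h₁.assign_center q hq hq').imp_right (hfill.mono _)
    · rw [hout, hasg, hbest]; exact h₁.boundsRadii
    · rw [hbest]; exact h₁.hasScale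

end Padding

section Main

variable {M G N : ℕ} {ε : ℝ}

/-- A bound for the number of steps of `solveProgram`, where `m` is the total number of outliers,
`M` the number of choices for a point and `G` the number of choices for a radius. -/
def solveTime (n k m M G : ℕ) : ℕ :=
  ((M + (k + 5) * (k + m + 1)) * (M ^ (k - 1) * G ^ k * (n * k * 1110) + 100) + 10) +
    ((k + 3) * (M * (M ^ (k - 1) * G ^ k * (n * k * 1110) + 33) + 40) + 20) + (n * 120 + 25)

lemma wp_solveProgram (hD : D.Valid) {ω : ℕ} (hcol : ∀ p < D.n, D.col p < ω) (hG : 0 < G)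
    (hM : ∀ p < D.n, D.bnd (D.col p) < M) (hGε : 4 * D.k * (2 / 7) ^ (G - 1) ≤ ε)
    (hs : Ready D M G s) (hfirst : s.nat digitArr 0 = 0) (hchoices : s.nat pointChoicesVar 0 = M)
    (hbest : s.real bestVar 0 = s.real scaleVar 0) :
    WP D.d solveProgram (solveTime D.n D.k (∑ c ∈ Finset.range ω, D.bnd c) M G)
      (fun s' => Solved D s' ∧ (outCenters D s').card = D.k ∧
        ∀ S : Clustering D, s'.real bestVar 0 ≤ (7 + ε) * S.cost) s := by
  refine ((wp_lowerProgram hD hcol hG hM hs hfirst hchoices hbest).seq fun s₁ h₁ =>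
    (wp_raiseProgram hD hG hM hGε h₁).seq fun s₂ ⟨henv, hsolved, happrox⟩ =>
    (wp_padProgram hD henv hsolved).imp fun s₃ ⟨hsolved', hcard, hbest'⟩ =>
      ⟨hsolved', hcard, by rwa [hbest']⟩).mono ?_
  simp only [solveTime, searchTime, searchSize, Nat.add_assoc, Nat.reduceAdd, le_refl]

/-- A bound for the number of steps of `mainProgram`, where `m` is the total number of outliers and
`N` the index of the finest radius of the grid. -/
def mainTime (n k m N : ℕ) : ℕ :=
  n * 90 + N * 60 + k * 50 + 90 + solveTime n k m (m + 1) (N + 1)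

lemma wp_mainProgram (hD : D.Valid) (hs : Initial D ε s) {ω : ℕ} (hcol : ∀ p < D.n, D.col p < ω)
    (hN : ∀ j, ε < 4 * D.k * (2 / 7) ^ j ↔ j < N) :
    WP D.d mainProgram (mainTime D.n D.k (∑ c ∈ Finset.range ω, D.bnd c) N)
      (fun s' => Solved D s' ∧ (outCenters D s').card = D.k ∧
        ∀ S : Clustering D, s'.real bestVar 0 ≤ (7 + ε) * S.cost) s := by
  refine (wp_setupProgram hD hs hcol hN).seq
    fun s₁ ⟨M, hM, hle, hready, hfirst, hchoices, hbest⟩ =>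
    (wp_solveProgram hD hcol N.succ_pos hM ?_ hready hfirst hchoices hbest).mono ?_
  · exact not_lt.1 fun h => ((hN N).1 h).false
  · unfold solveTime
    gcongr

end Main

/-! ### The running time -/

section RunningTime

variable {n k m N Z S : ℕ}

lemma lowering_time_le (hk : 1 ≤ k) (hZ : 1 ≤ Z) (hS : S ≤ Z) :
    (m + 1 + (k + 5) * (k + m + 1)) * (S * 1110 + 100) + 10 ≤ 15740 * (k * (k + m) * Z) := by
  have hfactor : m + 1 + (k + 5) * (k + m + 1) ≤ 13 * (k * (k + m)) := by nlinarith
  have hpos : 1 ≤ k * (k + m) * Z := Nat.mul_pos (Nat.mul_pos hk (by omega)) hZ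
  calc (m + 1 + (k + 5) * (k + m + 1)) * (S * 1110 + 100) + 10
      ≤ 13 * (k * (k + m)) * (Z * 1210) + 10 := by gcongr; omega
    _ = 15730 * (k * (k + m) * Z) + 10 := by ring
    _ ≤ 15740 * (k * (k + m) * Z) := by omega

lemma raising_time_le (hk : 1 ≤ k) (hZ : 1 ≤ Z) (hS : S ≤ Z) :
    (k + 3) * ((m + 1) * (S * 1110 + 33) + 40) + 20 ≤ 4760 * (k * (k + m) * Z) := by
  have hpos : 1 ≤ (k + m) * Z := Nat.mul_pos (by omega) hZ
  have hpos' : 1 ≤ k * (k + m) * Z := Nat.mul_pos (Nat.mul_pos hk (by omega)) hZ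
  have hround : (m + 1) * (S * 1110 + 33) + 40 ≤ 1185 * ((k + m) * Z) := calc
    (m + 1) * (S * 1110 + 33) + 40 ≤ (k + m) * (Z * 1143) + 40 :=
      Nat.add_le_add_right (Nat.mul_le_mul (by omega) (by omega)) _
    _ = 1143 * ((k + m) * Z) + 40 := by ring
    _ ≤ 1185 * ((k + m) * Z) := by omega
  calc (k + 3) * ((m + 1) * (S * 1110 + 33) + 40) + 20
      ≤ (4 * k) * (1185 * ((k + m) * Z)) + 20 :=
        Nat.add_le_add_right (Nat.mul_le_mul (by omega) hround) _
    _ = 4740 * (k * (k + m) * Z) + 20 := by ring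
    _ ≤ 4760 * (k * (k + m) * Z) := by omega

lemma mainTime_le (hn : 1 ≤ n) (hk : 1 ≤ k) :
    mainTime n k m N ≤ 22000 * (n * (k + m) ^ k * (k ^ 2 * (N + 1) ^ k)) := by
  set V := (k + m) ^ (k - 1) * (N + 1) ^ k with hV
  set Z := V * (n * k) with hZ
  have hK : 0 < k + m := by omega
  have hVpos : 1 ≤ V := Nat.mul_pos (pow_pos hK _) (pow_pos N.succ_pos _)
  have hnk : 1 ≤ n * k := Nat.mul_pos hn hk
  have hN : N + 1 ≤ V := calc
    N + 1 = 1 * (N + 1) ^ 1 := by ring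
    _ ≤ V := Nat.mul_le_mul (pow_pos hK _) (Nat.pow_le_pow_right N.succ_pos hk)
  have hN_le : N + 1 ≤ Z := hN.trans (Nat.le_mul_of_pos_right _ hnk)
  have hn_le : n ≤ Z := (Nat.le_mul_of_pos_right n hk).trans (Nat.le_mul_of_pos_left _ hVpos)
  have hk_le : k ≤ Z := (Nat.le_mul_of_pos_left k hn).trans (Nat.le_mul_of_pos_left _ hVpos)
  have hS : (m + 1) ^ (k - 1) * (N + 1) ^ k * (n * k) ≤ Z :=
    Nat.mul_le_mul_right _ (Nat.mul_le_mul_right _ (Nat.pow_le_pow_left (by omega) _))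
  have hlower := lowering_time_le (m := m) hk (hn.trans hn_le) hS
  have hraise := raising_time_le (m := m) hk (hn.trans hn_le) hS
  have hZ_le : Z ≤ k * (k + m) * Z := Nat.le_mul_of_pos_left _ (Nat.mul_pos hk hK)
  have htotal : n * (k + m) ^ k * (k ^ 2 * (N + 1) ^ k) = k * (k + m) * Z := by
    rw [hZ, hV, ← pow_sub_one_mul (by omega : k ≠ 0) (k + m)]
    ring
  rw [htotal]
  rw [mainTime, solveTime, ← mul_assoc _ (n * k) 1110]
  omega

/-- The logarithmic factor of the running time. -/
def logFactor (k : ℕ) (ε : ℝ) : ℝ := Real.log (max 2 (max (k : ℝ) ((k : ℝ) / ε)))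

variable {ε : ℝ}

lemma log_le_logFactor {x : ℝ} (hx : 0 < x) (h : x ≤ max 2 (max (k : ℝ) ((k : ℝ) / ε))) :
    Real.log x ≤ logFactor k ε :=
  Real.log_le_log hx h

lemma log_two_le_logFactor : Real.log 2 ≤ logFactor k ε :=
  log_le_logFactor two_pos (le_max_left _ _)

lemma logFactor_nonneg : 0 ≤ logFactor k ε :=
  Real.log_nonneg (le_max_of_le_left one_le_two)

lemma six_fifths_le_log : (6 / 5 : ℝ) ≤ Real.log (7 / 2) := by
  rw [Real.le_log_iff_exp_le (by norm_num)]
  have hexp : Real.exp (6 / 5) ^ 5 = Real.exp 1 ^ 6 := by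
    rw [← Real.exp_nat_mul, ← Real.exp_nat_mul]
    norm_num
  refine le_of_pow_le_pow_left₀ (n := 5) (by norm_num) (by norm_num) ?_
  calc Real.exp (6 / 5) ^ 5 = Real.exp 1 ^ 6 := hexp
    _ ≤ 2.7182818286 ^ 6 := by gcongr; exact Real.exp_one_lt_d9.le
    _ ≤ (7 / 2) ^ 5 := by norm_num

lemma log_four_le : Real.log 4 ≤ 7 / 5 := by
  rw [show (4 : ℝ) = 2 ^ 2 by norm_num, Real.log_pow]
  have := Real.log_two_lt_d9
  push_cast
  linarith

lemma radius_choices_le (hk : 1 ≤ k) (hε : 0 < ε) (hN : ∀ j < N, ε < 4 * k * (2 / 7) ^ j) :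
    (N : ℝ) + 1 ≤ 5 / 6 * logFactor k ε + 4 := by
  have hlog : 0 ≤ logFactor k ε := logFactor_nonneg
  obtain _ | j := N
  · norm_num
    linarith
  have : (0 : ℝ) < k := by exact_mod_cast hk
  have hpow : (7 / 2 : ℝ) ^ j ≤ 4 * (k / ε) := by
    have hgrid := hN j j.lt_succ_self
    rw [show (2 / 7 : ℝ) = (7 / 2)⁻¹ by norm_num, inv_pow, ← div_eq_mul_inv,
      lt_div_iff₀ (by positivity)] at hgrid
    rw [← mul_div_assoc, le_div_iff₀ hε]
    linarith
  have hj : j * Real.log (7 / 2) ≤ Real.log 4 + logFactor k ε := calc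
    j * Real.log (7 / 2) = Real.log ((7 / 2) ^ j) := (Real.log_pow _ _).symm
    _ ≤ Real.log (4 * (k / ε)) := Real.log_le_log (by positivity) hpow
    _ = Real.log 4 + Real.log (k / ε) := Real.log_mul (by norm_num) (by positivity)
    _ ≤ Real.log 4 + logFactor k ε := by
      gcongr
      exact log_le_logFactor (by positivity) (le_max_of_le_right (le_max_right _ _))
  have hj' : (j : ℝ) * (6 / 5) ≤ j * Real.log (7 / 2) := by
    gcongr
    exact six_fifths_le_log
  have := log_four_le
  push_cast
  linarith

/-- As `a < 1`, additive constants and polynomial factors are absorbed by `L ^ k` for large `L`, and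
a small `L` leaves only finitely many `k`. -/
lemma exists_sq_mul_pow_le {a b δ : ℝ} (ha : 0 ≤ a) (ha1 : a < 1) (hb : 0 ≤ b) (hδ : 0 < δ) :
    ∃ c : ℝ, 0 ≤ c ∧ ∀ (k : ℕ) (g L : ℝ), 0 ≤ g → g ≤ a * L + b → δ ≤ L → Real.log k ≤ L →
      (k : ℝ) ^ 2 * g ^ k ≤ c * L ^ k := by
  obtain ⟨c₁, hc₁⟩ := (tendsto_pow_const_mul_const_pow_of_abs_lt_one 2
    (r := (a + 1) / 2) (by rw [abs_lt]; constructor <;> linarith)).bddAbove_range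
  set L₀ := 2 * b / (1 - a)
  obtain ⟨K, hK⟩ := exists_nat_ge (Real.exp L₀)
  set c₂ := (K : ℝ) ^ 2 * (1 + b / δ) ^ K
  have hc₂ : 0 ≤ c₂ := by positivity
  refine ⟨max c₁ c₂, hc₂.trans (le_max_right _ _), fun k g L hg hgL hδL hkL => ?_⟩
  have hL : 0 < L := hδ.trans_le hδL
  rcases le_or_gt L₀ L with hlarge | hsmall
  · have hgL' : g ≤ (a + 1) / 2 * L := by
      rw [div_le_iff₀ (by linarith)] at hlarge
      linarith
    calc (k : ℝ) ^ 2 * g ^ k ≤ (k : ℝ) ^ 2 * ((a + 1) / 2 * L) ^ k := by gcongr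
      _ = (k : ℝ) ^ 2 * ((a + 1) / 2) ^ k * L ^ k := by rw [mul_pow]; ring
      _ ≤ max c₁ c₂ * L ^ k := by
        gcongr
        exact le_max_of_le_left (hc₁ ⟨k, rfl⟩)
  · have hgL' : g ≤ (1 + b / δ) * L := by
      have haL : a * L ≤ L := mul_le_of_le_one_left hL.le ha1.le
      have hbL : b ≤ b / δ * L := by
        rw [div_mul_eq_mul_div, le_div_iff₀ hδ]
        gcongr
      linarith
    have hkK : k ≤ K := by
      have hkexp : (k : ℝ) ≤ Real.exp L₀ :=
        (Real.le_exp_log _).trans (Real.exp_le_exp.2 (hkL.trans hsmall.le))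
      exact_mod_cast hkexp.trans hK
    calc (k : ℝ) ^ 2 * g ^ k ≤ (k : ℝ) ^ 2 * ((1 + b / δ) * L) ^ k := by gcongr
      _ = (k : ℝ) ^ 2 * (1 + b / δ) ^ k * L ^ k := by rw [mul_pow]; ring
      _ ≤ c₂ * L ^ k := by
        have hbase : 1 ≤ 1 + b / δ := le_add_of_nonneg_right (div_nonneg hb hδ.le)
        gcongr ?_ * _
        exact mul_le_mul (by gcongr) (pow_le_pow_right₀ hbase hkK) (by positivity) (by positivity)
      _ ≤ max c₁ c₂ * L ^ k := by
        gcongr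
        exact le_max_right _ _

lemma exists_mainTime_le : ∃ c : ℝ, 0 ≤ c ∧ ∀ (n k m N : ℕ) (ε : ℝ), 1 ≤ n → 1 ≤ k → 0 < ε →
    (∀ j < N, ε < 4 * k * (2 / 7) ^ j) →
    (mainTime n k m N : ℝ) ≤ c * (n * (((k : ℝ) + m) * logFactor k ε) ^ k) := by
  obtain ⟨c, hc, habsorb⟩ := exists_sq_mul_pow_le (a := 5 / 6) (b := 4) (δ := Real.log 2)
    (by norm_num) (by norm_num) (by norm_num) (Real.log_pos one_lt_two)
  refine ⟨22000 * c, by positivity, fun n k m N ε hn hk hε hN => ?_⟩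
  have hlog : Real.log k ≤ logFactor k ε :=
    log_le_logFactor (by exact_mod_cast hk) (le_max_of_le_right (le_max_left _ _))
  have hchoices := habsorb k (N + 1) (logFactor k ε) (by positivity) (radius_choices_le hk hε hN)
    log_two_le_logFactor hlog
  calc (mainTime n k m N : ℝ)
      ≤ 22000 * (n * ((k : ℝ) + m) ^ k * ((k : ℝ) ^ 2 * ((N : ℝ) + 1) ^ k)) := by
        exact_mod_cast mainTime_le hn hk
    _ ≤ 22000 * (n * ((k : ℝ) + m) ^ k * (c * logFactor k ε ^ k)) := by gcongr
    _ = 22000 * c * (n * (((k : ℝ) + m) * logFactor k ε) ^ k) := by rw [mul_pow]; ring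

lemma exists_forall_lt_mul_pow_iff {b q : ℝ} (hε : 0 < ε) (hb : 0 ≤ b) (hq : 0 ≤ q) (hq1 : q < 1) :
    ∃ N : ℕ, ∀ j, ε < b * q ^ j ↔ j < N := by
  classical
  have hlim := (tendsto_pow_atTop_nhds_zero_of_lt_one hq hq1).const_mul b
  rw [mul_zero] at hlim
  have hex : ∃ N, b * q ^ N ≤ ε := (hlim.eventually_le_const hε).exists
  refine ⟨Nat.find hex, fun j => ⟨fun hj => lt_of_not_ge fun hle => hj.not_ge ?_,
    fun hj => not_le.1 (Nat.find_min hex hj)⟩⟩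
  calc b * q ^ j ≤ b * q ^ Nat.find hex :=
        mul_le_mul_of_nonneg_left (pow_le_pow_of_le_one hq hq1.le hle) hb
    _ ≤ ε := Nat.find_spec hex

end RunningTime

/-! ### From instances to data -/

/-- The instance in terms of natural numbers, with the default values of `Instance.input`. -/
def Instance.data (I : Instance) : Data where
  n := I.n
  k := I.k
  col i := if h : i < I.n then (I.color ⟨i, h⟩ : ℕ) else 0
  bnd i := if h : i < I.ω then I.outlierBound ⟨i, h⟩ else 0
  d := I.distTable

namespace Instance

variable {I : Instance}

lemma distTable_eq (p q : Fin I.n) : I.distTable p q = I.d p q := by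
  simp [distTable]

lemma data_valid : I.data.Valid where
  d_self i := by
    simp only [data, distTable, d]
    split_ifs <;> simp
  d_symm i j := by
    simp only [data, distTable, d]
    by_cases h : i < I.n ∧ j < I.n
    · rw [dif_pos h, dif_pos h.symm, @nndist_comm _ I.metric.toPseudoMetricSpace]
    · rw [dif_neg h, dif_neg fun h' => h h'.symm]
  d_nonneg i j := by
    simp only [data, distTable]
    split_ifs <;> simp
  d_triangle i j l hi hj hl := by
    have htriangle :=
      @nndist_triangle _ I.metric.toPseudoMetricSpace ⟨i, hi⟩ ⟨j, hj⟩ ⟨l, hl⟩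
    have hij := distTable_eq (I := I) ⟨i, hi⟩ ⟨j, hj⟩
    have hjl := distTable_eq (I := I) ⟨j, hj⟩ ⟨l, hl⟩
    have hil := distTable_eq (I := I) ⟨i, hi⟩ ⟨l, hl⟩
    simp only [data] at hij hjl hil ⊢
    rw [hij, hjl, hil]
    exact_mod_cast htriangle
  one_le_k := I.one_le_k
  k_le_n := I.k_le_n

lemma input_initial (ε : ℝ) : Initial I.data ε (I.input ε) where
  env := ⟨rfl, rfl, rfl, rfl⟩
  nat_eq_zero a ha := by
    obtain ⟨a, rfl⟩ := Nat.exists_eq_add_of_le' ha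
    rfl
  scale_eq_zero := rfl
  eps_eq := rfl

lemma data_col (p : Fin I.n) : I.data.col p = I.color p := by
  simp [data]

lemma data_bnd (i : Fin I.ω) : I.data.bnd i = I.outlierBound i := by
  simp [data]

lemma data_col_lt (p : ℕ) (hp : p < I.data.n) : I.data.col p < I.ω :=
  (data_col (I := I) ⟨p, hp⟩).trans_lt (I.color _).2

lemma sum_data_bnd : ∑ c ∈ Finset.range I.ω, I.data.bnd c = I.m := by
  simp only [m, Finset.sum_range, data_bnd]

lemma le_pow_card_classes_sq : (I.n : ℝ) ≤ (I.n : ℝ) ^ I.ω ^ 2 := by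
  have hn : 1 ≤ I.n := I.one_le_k.trans I.k_le_n
  have hω : I.ω ≠ 0 := Nat.ne_zero_of_lt (I.color ⟨0, hn⟩).2
  exact le_self_pow₀ (by exact_mod_cast hn) (pow_ne_zero 2 hω)

lemma d_le_radius (S : Solution I.n) (p : Fin I.n) :
    I.d p (S.assign p) ≤ I.radius S (S.assign p) :=
  Finset.le_sup (f := fun q => I.d q (S.assign p)) (by simp)

variable {S : Solution I.n}

/-- A feasible solution as a clustering of the points as natural numbers. -/
def IsFeasible.clustering (hS : I.IsFeasible S) : Clustering I.data where
  centers := S.centers.map Fin.valEmbedding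
  outliers := S.outliers.map Fin.valEmbedding
  assign q := if h : q < I.n then S.assign ⟨q, h⟩ else 0
  radius c := if h : c < I.n then I.radius S ⟨c, h⟩ else 0
  card_centers_le := by rw [Finset.card_map, hS.card_centers]; exact le_rfl
  lt_n c hc := by
    obtain ⟨c, -, rfl⟩ := Finset.mem_map.1 hc
    exact c.2
  card_outliers_le c := by
    rw [Finset.filter_map, Finset.card_map]
    by_cases hc : c < I.ω
    · refine (Finset.card_le_card fun p hp => ?_).trans
        ((hS.card_outliers ⟨c, hc⟩).trans_eq (data_bnd ⟨c, hc⟩).symm)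
      simp only [Finset.mem_filter, Function.comp, Fin.valEmbedding_apply, data_col] at hp ⊢
      exact ⟨hp.1, Fin.ext hp.2⟩
    · rw [Finset.filter_false_of_mem]
      · exact Nat.zero_le _
      · rintro p - rfl
        exact hc (data_col_lt _ p.2)
  assign_mem q hq hqo := by
    have hq : q < I.n := hq
    rw [dif_pos hq]
    refine Finset.mem_map_of_mem Fin.valEmbedding (hS.assign_center _ fun h => hqo ?_)
    exact Finset.mem_map_of_mem Fin.valEmbedding h
  dist_le q hq _ := by
    have hq : q < I.n := hq
    rw [dif_pos hq, dif_pos (S.assign ⟨q, hq⟩).2]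
    exact (distTable_eq ⟨q, hq⟩ (S.assign ⟨q, hq⟩)).trans_le
      (by exact_mod_cast d_le_radius S ⟨q, hq⟩)
  radius_nonneg c _ := by split_ifs <;> simp

lemma IsFeasible.cost_clustering (hS : I.IsFeasible S) : hS.clustering.cost = I.cost S := by
  simp [Clustering.cost, clustering, cost]

end Instance

/-! ### The output -/

section Output

variable {I : Instance}

/-- The solution in the output arrays. -/
def Solved.solution (h : Solved I.data s) : Solution I.n where
  centers := Finset.univ.filter fun p => s.nat outCenterArr p = 1
  outliers := Finset.univ.filter fun p => s.nat outOutlierArr p = 1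
  assign p := ⟨s.nat outAssignArr p, by
    by_cases hp : s.nat outOutlierArr p = 1
    · rw [h.assign_outlier p p.2 hp]
      exact p.2
    · exact (h.assign_center p p.2 hp).1⟩

lemma Solved.isOutput (h : Solved I.data s) : IsOutput s h.solution :=
  fun p => ⟨by simp [solution], by simp [solution], rfl⟩

lemma card_univ_filter_val (P : ℕ → Prop) [DecidablePred P] (n : ℕ) :
    (Finset.univ.filter fun p : Fin n => P p).card = ((Finset.range n).filter P).card := by
  simp only [Finset.card_filter]
  exact Fin.sum_univ_eq_sum_range (fun q => if P q then 1 else 0) n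

lemma Solved.isFeasible (h : Solved I.data s) (hk : (outCenters I.data s).card = I.data.k) :
    I.IsFeasible h.solution where
  card_centers := (card_univ_filter_val (fun q => s.nat outCenterArr q = 1) I.n).trans hk
  card_outliers i := by
    calc (h.solution.outliers.filter fun p => I.color p = i).card
        = (Finset.univ.filter fun p : Fin I.n =>
            s.nat outOutlierArr p = 1 ∧ I.data.col p = i).card := by
          simp only [solution, Finset.filter_filter, Instance.data_col, Fin.val_inj]
      _ = ((Finset.range I.n).filter
            fun q => s.nat outOutlierArr q = 1 ∧ I.data.col q = i).card :=
          card_univ_filter_val (fun q => s.nat outOutlierArr q = 1 ∧ I.data.col q = i) I.n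
      _ ≤ I.data.bnd i := h.card_outliers_le i
      _ = I.outlierBound i := Instance.data_bnd i
  assign_outlier p hp := Fin.ext (h.assign_outlier p p.2 ((h.isOutput p).2.1.2 hp))
  assign_center p hp :=
    ((h.isOutput _).1.1 (h.assign_center p p.2 fun hp' => hp ((h.isOutput p).2.1.1 hp')).2)

lemma Solved.cost_solution_le (h : Solved I.data s) : I.cost h.solution ≤ s.real bestVar 0 := by
  obtain ⟨ρ, hρ, hdist, hsum⟩ := h.boundsRadii
  have hradius : ∀ c, I.radius h.solution c ≤ (⟨ρ c, hρ c⟩ : ℝ≥0) := by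
    refine fun c => Finset.sup_le fun p hp => ?_
    obtain rfl : h.solution.assign p = c := by simpa using hp
    change (I.d p (h.solution.assign p) : ℝ) ≤ ρ (s.nat outAssignArr p)
    rw [← Instance.distTable_eq]
    by_cases hout : s.nat outOutlierArr p = 1
    · have hself : h.solution.assign p = p := Fin.ext (h.assign_outlier p p.2 hout)
      rw [hself]
      exact (Instance.data_valid.d_self p).trans_le (hρ _)
    · exact (Instance.data_valid.d_symm _ _).trans_le (hdist p p.2 hout)
  calc I.cost h.solution ≤ ∑ c : Fin I.n, (I.radius h.solution c : ℝ) :=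
        Finset.sum_le_univ_sum_of_nonneg fun c => NNReal.coe_nonneg _
    _ ≤ ∑ c : Fin I.n, ρ c := Finset.sum_le_sum fun c _ => NNReal.coe_le_coe.2 (hradius c)
    _ = ∑ c ∈ Finset.range I.data.n, ρ c := Fin.sum_univ_eq_sum_range ρ I.n
    _ ≤ s.real bestVar 0 := hsum

lemma Solved.isApprox {α : ℝ} (h : Solved I.data s) (hk : (outCenters I.data s).card = I.data.k)
    (happrox : ∀ S : Clustering I.data, s.real bestVar 0 ≤ α * S.cost) :
    I.IsApprox α h.solution := by
  refine ⟨h.isFeasible hk, fun S hS => ?_⟩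
  rw [← hS.cost_clustering]
  exact h.cost_solution_le.trans (happrox _)

end Output

end ColorfulRadii

end

theorem mainTheorem3_general :
    ∃ (A : RealRAM.Program) (c : ℝ), 0 ≤ c ∧ ∀ (I : ColorfulRadii.Instance) (ε : ℝ), 0 < ε →
      ∃ (t : ℕ) (s : RealRAM.State) (S : ColorfulRadii.Solution I.n),
        RealRAM.Run I.distTable A (I.input ε) t s ∧
        ColorfulRadii.IsOutput s S ∧
        I.IsApprox (7 + ε) S ∧
        (t : ℝ) ≤ c * ((I.n : ℝ) * (((I.k : ℝ) + (I.m : ℝ)) *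
          Real.log (max 2 (max (I.k : ℝ) ((I.k : ℝ) / ε)))) ^ I.k) := by
  open ColorfulRadii in
  obtain ⟨c, hc, htime⟩ := exists_mainTime_le
  refine ⟨mainProgram, c, hc, fun I ε hε => ?_⟩
  obtain ⟨N, hN⟩ := exists_forall_lt_mul_pow_iff (b := 4 * I.k) (q := 2 / 7) hε
    (by positivity) (by norm_num) (by norm_num)
  obtain ⟨t, s, hrun, ht, hsolved, hcard, happrox⟩ :=
    wp_mainProgram Instance.data_valid (I.input_initial ε) Instance.data_col_lt hN
  rw [Instance.sum_data_bnd] at ht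
  refine ⟨t, s, hsolved.solution, hrun, hsolved.isOutput, hsolved.isApprox hcard happrox, ?_⟩
  calc (t : ℝ) ≤ mainTime I.n I.k I.m N := by exact_mod_cast ht
    _ ≤ _ := htime I.n I.k I.m N ε (I.one_le_k.trans I.k_le_n) I.one_le_k hε fun j => (hN j).2

theorem mainTheorem3 :
    ∃ (A : RealRAM.Program) (c : ℝ), ∀ (I : ColorfulRadii.Instance) (ε : ℝ), 0 < ε →
      ∃ (t : ℕ) (s : RealRAM.State) (S : ColorfulRadii.Solution I.n),
        RealRAM.Run I.distTable A (I.input ε) t s ∧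
        ColorfulRadii.IsOutput s S ∧
        I.IsApprox (7 + ε) S ∧
        (t : ℝ) ≤ c * ((I.n : ℝ) ^ (I.ω ^ 2) *
          (((I.k : ℝ) + (I.m : ℝ)) *
            Real.log (max 2 (max (I.k : ℝ) ((I.k : ℝ) / ε)))) ^ I.k) := by
  obtain ⟨A, c, hc, hA⟩ := mainTheorem3_general
  refine ⟨A, c, fun I ε hε => ?_⟩
  obtain ⟨t, s, S, hrun, hout, happrox, ht⟩ := hA I ε hε
  have hlog : 0 ≤ Real.log (max 2 (max (I.k : ℝ) ((I.k : ℝ) / ε))) :=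
    Real.log_nonneg (le_max_of_le_left one_le_two)
  refine ⟨t, s, S, hrun, hout, happrox, ht.trans ?_⟩
  gcongr
  exact ColorfulRadii.Instance.le_pow_card_classes_sq
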